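/- **Uniqueness in a fixed domain.** Let $d\ge 1$, $T>0$, and let $\Omega\subset\mathbb R^d$ be a bounded open set with Lipschitz boundary, $\partial_D\Omega\subseteq\partial\Omega$ a (possibly empty) Borel set and $\partial_N\Omega:=\partial\Omega\setminus\partial_D\Omega$. Let $\Gamma\subset\overline\Omega$ be a closed set with $\mathcal L^d(\Gamma)=0$ and $\mathcal H^{d-1}(\Gamma\cap\partial\Omega)=0$ such that every $x\in\Gamma$ has an open neighbourhood $U$ for which $(U\cap\Omega)\setminus\Gamma$ is the union of two disjoint open sets with Lipschitz boundary, and let $\{\Gamma_t\}_{t\in[0,T]}$ be closed subsets of $\Gamma$ with $\Gamma_s\subset\Gamma_t$ for $0\le s\le t\le T$. Write $H$ for $L^2(\Omega;\mathbb R^d)$ or $L^2(\Omega;\mathbb R^{d\times d}_{sym})$, and $H_N:=L^2(\partial_N\Omega;\mathbb R^d)$. For a vector field $u$ let $Eu$ be the symmetric part of its distributional gradient, and put $$V_t:=\{u\in L^2(\Omega\setminus\Gamma_t;\mathbb R^d): Eu\in L^2(\Omega\setminus\Gamma_t;\mathbb R^{d\times d}_{sym})\},\qquad \|u\|_{V_t}^2:=\|u\|_H^2+\|Eu\|_H^2,$$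 where $Eu$ is taken in $\Omega\setminus\Gamma_t$, and $V_t^D:=\{u\in V_t: u=0\text{ on }\partial_D\Omega\}$ in the sense of traces. For $a,b\in\mathbb R^d$ let $a\odot b:=\frac12(a\otimes b+b\otimes a)$. Let $\mathbb C,\mathbb B:\Omega\to\mathscr L(\mathbb R^{d\times d}_{sym};\mathbb R^{d\times d}_{sym})$ be essentially bounded, symmetric for a.e. $x$, and uniformly coercive: $\mathbb C(x)\eta\cdot\eta\ge\lambda_1|\eta|^2$, $\mathbb B(x)\eta\cdot\eta\ge\lambda_2|\eta|^2$ for a.e. $x\in\Omega$ and all $\eta\in\mathbb R^{d\times d}_{sym}$, with constants $\lambda_1,\lambda_2>0$. Let $\Psi$ satisfy $\Psi\in L^\infty((0,T)\times\Omega)$ and $\nabla\Psi\in L^\infty((0,T)\times\Omega;\mathbb R^d)$ (gradient in $x$). Let $f\in L^2(0,T;H)$, $w\in H^2(0,T;H)\cap H^1(0,T;V_0)$, $g\in H^1(0,T;H_N)$, $u^0\in V_0$ with $u^0-w(0)\in V_0^D$, and $u^1\in H$. Set $$\mathcal V:=\{\varphi\in L^2(0,T;V_T):\dot\varphi\in L^2(0,T;H),\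 \varphi(t)\in V_t\text{ for a.e. }t\},\qquad \mathcal V^D:=\{\varphi\in\mathcal V:\varphi(t)\in V_t^D\text{ for a.e. }t\},$$ $$\mathcal W:=\{u\in\mathcal V:\Psi\dot u\in L^2(0,T;V_T),\ \Psi(t)\dot u(t)\in V_t\text{ for a.e. }t\}.$$ Consider the system $\ddot u-\operatorname{div}(\mathbb CEu)-\operatorname{div}(\Psi^2\mathbb BE\dot u)=f$ in $\Omega\setminus\Gamma_t$, $t\in(0,T)$, with $u=w$ on $\partial_D\Omega$, $(\mathbb CEu+\Psi^2\mathbb BE\dot u)\nu=g$ on $\partial_N\Omega$ and $(\mathbb CEu+\Psi^2\mathbb BE\dot u)\nu=0$ on $\Gamma_t$. A *weak solution* is a function $u\in\mathcal W$ with $u-w\in\mathcal V^D$ and $$-\int_0^T(\dot u,\dot\varphi)_H\,dt+\int_0^T(\mathbb CEu,E\varphi)_H\,dt+\int_0^T(\mathbb BE(\Psi\dot u),\Psi E\varphi)_H\,dt-\int_0^T(\mathbb B(\nabla\Psi\odot\dot u),\Psi E\varphi)_H\,dt=\int_0^T(f,\varphi)_H\,dt+\int_0^T(g,\varphi)_{H_N}\,dt$$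 for every $\varphi\in\mathcal V^D$ with $\varphi(0)=\varphi(T)=0$. It *satisfies the initial conditions* $u(0)=u^0$, $\dot u(0)=u^1$ if $$\lim_{h\to0^+}\frac1h\int_0^h\bigl(\|u(t)-u^0\|_{V_t}^2+\|\dot u(t)-u^1\|_H^2\bigr)\,dt=0.$$ Assume in addition that $\Psi$ is Lipschitz on $[0,T]\times\overline\Omega$, that $\nabla\dot\Psi\in L^\infty((0,T)\times\Omega;\mathbb R^d)$ in the sense of distributions, and that $\Gamma_T=\Gamma_0$. Then there is at most one weak solution satisfying the initial conditions: if $u_1,u_2\in\mathcal W$ are two of them, then $u_1(t)=u_2(t)$ for a.e. $t\in(0,T)$. -/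

import Mathlib

open MeasureTheory Set Filter Topology
open scoped ENNReal NNReal ContDiff

noncomputable section

namespace CrackVisco

/-- The Euclidean space `ℝ^d`. -/
abbrev Vec (d : ℕ) : Type := EuclideanSpace ℝ (Fin d)

/-- The space of real `d × d` matrices, with the Euclidean (Frobenius) scalar product. -/
abbrev Mat (d : ℕ) : Type := EuclideanSpace ℝ (Fin d × Fin d)

/-- The subspace of symmetric matrices. -/
def SymMat (d : ℕ) : Submodule ℝ (Mat d) where
  carrier := {A | ∀ i j, A (i, j) = A (j, i)}
  add_mem' := by
    intro A B hA hB i j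
    simp [hA i j, hB i j]
  zero_mem' := by
    intro i j
    simp
  smul_mem' := by
    intro c A hA i j
    simp [hA i j]

/-- The symmetrized tensor product `a ⊙ b = (a ⊗ b + b ⊗ a) / 2`. -/
def symProd {d : ℕ} (a b : Vec d) : SymMat d :=
  ⟨WithLp.toLp 2 (fun p : Fin d × Fin d => (1 / 2 : ℝ) * (a p.1 * b p.2 + b p.1 * a p.2)), by
    intro i j
    simp only
    ring⟩

/-- `∂_i η` for a scalar function of the space variable. -/
def partialX {d : ℕ} (i : Fin d) (η : Vec d → ℝ) (x : Vec d) : ℝ :=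
  fderiv ℝ η x (EuclideanSpace.single i 1)

/-! ### Lipschitz boundaries -/

/-- Near each of its boundary points, `U` is the strict subgraph of a Lipschitz function, in some
direction `e`, of the orthogonal projection of the point onto the hyperplane `e^⊥`. -/
def HasLipschitzBoundary {d : ℕ} (U : Set (Vec d)) : Prop :=
  ∀ x ∈ frontier U, ∃ e : Vec d, ‖e‖ = 1 ∧ ∃ (g : Vec d → ℝ) (L : ℝ≥0), LipschitzWith L g ∧
    ∃ W ∈ 𝓝 x, ∀ y ∈ W, (y ∈ U ↔ inner ℝ y e < g (y - (inner ℝ y e : ℝ) • e))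

/-! ### The spaces `L²` and `V` -/

/-- `H = L²(Ω; ℝ^d)`. -/
abbrev L2Vec {d : ℕ} (Ω : Set (Vec d)) : Type := Lp (Vec d) 2 (volume.restrict Ω)

/-- `H = L²(Ω; ℝ^{d×d}_sym)`. -/
abbrev L2Sym {d : ℕ} (Ω : Set (Vec d)) : Type := Lp (SymMat d) 2 (volume.restrict Ω)

/-- The surface measure `𝓗^{d-1}` on a subset `S` of `ℝ^d`
(normalized so as to agree with the Lebesgue measure on hyperplanes). -/
def surface {d : ℕ} (S : Set (Vec d)) : Measure (Vec d) :=
  (Measure.euclideanHausdorffMeasure (d - 1) : Measure (Vec d)).restrict S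

/-- `L²(S; ℝ^d)` with respect to the surface measure. -/
abbrev L2Surf {d : ℕ} (S : Set (Vec d)) : Type := Lp (Vec d) 2 (surface S)

/-- The Hilbert space of pairs `(v, e)` with norm `(‖v‖_H² + ‖e‖_H²)^{1/2}`. -/
def PairSpace {d : ℕ} (Ω : Set (Vec d)) : Type := WithLp 2 (L2Vec Ω × L2Sym Ω)

instance {d : ℕ} (Ω : Set (Vec d)) : NormedAddCommGroup (PairSpace Ω) :=
  inferInstanceAs (NormedAddCommGroup (WithLp 2 (L2Vec Ω × L2Sym Ω)))

instance {d : ℕ} (Ω : Set (Vec d)) : InnerProductSpace ℝ (PairSpace Ω) :=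
  inferInstanceAs (InnerProductSpace ℝ (WithLp 2 (L2Vec Ω × L2Sym Ω)))

instance {d : ℕ} (Ω : Set (Vec d)) : CompleteSpace (PairSpace Ω) :=
  inferInstanceAs (CompleteSpace (WithLp 2 (L2Vec Ω × L2Sym Ω)))

/-- The first component `v` of a pair `(v, e)`. -/
def PairSpace.fst {d : ℕ} {Ω : Set (Vec d)} (p : PairSpace Ω) : L2Vec Ω := WithLp.fst p

/-- The second component `e` of a pair `(v, e)`. -/
def PairSpace.snd {d : ℕ} {Ω : Set (Vec d)} (p : PairSpace Ω) : L2Sym Ω := WithLp.snd p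

theorem PairSpace.norm_sq {d : ℕ} {Ω : Set (Vec d)} (p : PairSpace Ω) :
    ‖p‖ ^ 2 = ‖p.fst‖ ^ 2 + ‖p.snd‖ ^ 2 :=
  WithLp.prod_norm_sq_eq_of_L2 (α := L2Vec Ω) (β := L2Sym Ω) p
theorem PairSpace.zero_fst {d : ℕ} {Ω : Set (Vec d)} : (0 : PairSpace Ω).fst = 0 := rfl
theorem PairSpace.zero_snd {d : ℕ} {Ω : Set (Vec d)} : (0 : PairSpace Ω).snd = 0 := rfl
theorem PairSpace.add_fst {d : ℕ} {Ω : Set (Vec d)} (p q : PairSpace Ω) :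
    (p + q).fst = p.fst + q.fst := rfl
theorem PairSpace.add_snd {d : ℕ} {Ω : Set (Vec d)} (p q : PairSpace Ω) :
    (p + q).snd = p.snd + q.snd := rfl
theorem PairSpace.smul_fst {d : ℕ} {Ω : Set (Vec d)} (c : ℝ) (p : PairSpace Ω) :
    (c • p).fst = c • p.fst := rfl
theorem PairSpace.smul_snd {d : ℕ} {Ω : Set (Vec d)} (c : ℝ) (p : PairSpace Ω) :
    (c • p).snd = c • p.snd := rfl

/-- `e` is the symmetrized distributional gradient `E v` of `v` in the open set `Ω \ K`. -/
def IsSymGrad {d : ℕ} (Ω K : Set (Vec d)) (v : L2Vec Ω) (e : L2Sym Ω) : Prop :=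
  ∀ η : Vec d → ℝ, ContDiff ℝ ∞ η → HasCompactSupport η → tsupport η ⊆ Ω \ K →
    ∀ i j : Fin d,
      ∫ x in Ω, η x * (e x : Mat d) (i, j) =
        -∫ x in Ω, (1 / 2 : ℝ) * (partialX j η x * v x i + partialX i η x * v x j)

theorem integrable_test_mul {d : ℕ} {Ω : Set (Vec d)} {F : Type*} [NormedAddCommGroup F]
    [NormedSpace ℝ F] (f : Lp F 2 (volume.restrict Ω)) (l : F →L[ℝ] ℝ) {η : Vec d → ℝ}
    (hη : Continuous η) (hc : HasCompactSupport η) :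
    Integrable (fun x => η x * l (f x)) (volume.restrict Ω) := by
  have h1 : MemLp η 2 (volume.restrict Ω) := hη.memLp_of_hasCompactSupport hc
  have h2 : MemLp (fun x => l (f x)) 2 (volume.restrict Ω) := l.comp_memLp' (Lp.memLp f)
  exact h1.integrable_mul h2

theorem continuous_partialX {d : ℕ} (i : Fin d) {η : Vec d → ℝ} (hη : ContDiff ℝ ∞ η) :
    Continuous (partialX i η) := by
  unfold partialX
  exact (hη.continuous_fderiv (by simp)).clm_apply continuous_const

theorem hasCompactSupport_partialX {d : ℕ} (i : Fin d) {η : Vec d → ℝ}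
    (hη : HasCompactSupport η) : HasCompactSupport (partialX i η) :=
  hη.fderiv_apply (𝕜 := ℝ) (EuclideanSpace.single i 1)

/-- The component `A ↦ A i j` as a functional on symmetric matrices. -/
def entry {d : ℕ} (i j : Fin d) : SymMat d →L[ℝ] ℝ :=
  (EuclideanSpace.proj (𝕜 := ℝ) (i, j)).comp (SymMat d).subtypeL

/-- The space of all `v ∈ L²(Ω; ℝ^d)` whose symmetrized distributional gradient `E v` in `Ω \ K`
is in `L²`. An element is the pair `(v, E v)`, so the norm is `(‖v‖_H² + ‖E v‖_H²)^{1/2}`. -/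
def symGradSpace {d : ℕ} (Ω K : Set (Vec d)) : Submodule ℝ (PairSpace Ω) where
  carrier := {p | IsSymGrad Ω K p.fst p.snd}
  zero_mem' := by
    intro η _ _ _ i j
    have h1 := Lp.coeFn_zero (SymMat d) 2 (volume.restrict Ω)
    have h2 := Lp.coeFn_zero (Vec d) 2 (volume.restrict Ω)
    rw [integral_eq_zero_of_ae, integral_eq_zero_of_ae, neg_zero]
    · filter_upwards [h2] with x hx
      rw [PairSpace.zero_fst, hx]
      simp
    · filter_upwards [h1] with x hx
      rw [PairSpace.zero_snd, hx]
      simp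
  add_mem' := by
    intro p q hp hq η h1 h2 h3 i j
    have ep := hp η h1 h2 h3 i j
    have eq := hq η h1 h2 h3 i j
    have I1 := fun (p : PairSpace Ω) => integrable_test_mul p.snd (entry i j) h1.continuous h2
    have I2 := fun (p : PairSpace Ω) => ((integrable_test_mul p.fst (EuclideanSpace.proj i)
      (continuous_partialX j h1) (hasCompactSupport_partialX j h2)).add
      (integrable_test_mul p.fst (EuclideanSpace.proj j)
      (continuous_partialX i h1) (hasCompactSupport_partialX i h2))).const_mul (1 / 2)
    have e1 := integral_add (I1 p) (I1 q)
    have e2 := integral_add (I2 p) (I2 q)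
    have a1 := Lp.coeFn_add p.snd q.snd
    have a2 := Lp.coeFn_add p.fst q.fst
    have c1 : ∫ x in Ω, η x * ((p + q).snd x : Mat d) (i, j) =
        ∫ x in Ω, (η x * entry i j (p.snd x) + η x * entry i j (q.snd x)) := by
      refine integral_congr_ae ?_
      filter_upwards [a1] with x hx
      rw [PairSpace.add_snd, hx]
      simp [entry]
      ring
    rw [c1, e1]
    refine (congrArg₂ (· + ·) ep eq).trans ?_
    rw [← neg_add]
    congr 1
    refine e2.symm.trans (integral_congr_ae ?_)
    filter_upwards [a2] with x hx
    rw [PairSpace.add_fst, hx]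
    simp
    ring
  smul_mem' := by
    intro c p hp η h1 h2 h3 i j
    have ep := hp η h1 h2 h3 i j
    have a1 := Lp.coeFn_smul c p.snd
    have a2 := Lp.coeFn_smul c p.fst
    have c1 : ∫ x in Ω, η x * ((c • p).snd x : Mat d) (i, j) =
        ∫ x in Ω, c * (η x * (p.snd x : Mat d) (i, j)) := by
      refine integral_congr_ae ?_
      filter_upwards [a1] with x hx
      rw [PairSpace.smul_snd, hx]
      simp
      ring
    rw [c1, integral_const_mul, ep, mul_neg, ← integral_const_mul]
    congr 1
    refine integral_congr_ae ?_
    filter_upwards [a2] with x hx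
    rw [PairSpace.smul_fst, hx]
    simp
    ring

/-! ### Traces -/

/-- `τ` is bounded and maps every `(v, E v)` for which `v` has a representative `φ` that is
continuous on `closure Ω \ K` to the restriction of `φ` to the boundary. When `Ω` and the crack `K`
are regular and `𝓗^{d-1}(K ∩ ∂Ω) = 0`, there is exactly one such map, the usual trace. -/
def IsTraceOperator {d : ℕ} (Ω K : Set (Vec d))
    (τ : symGradSpace Ω K →L[ℝ] L2Surf (frontier Ω)) : Prop :=
  ∀ (p : symGradSpace Ω K) (φ : Vec d → Vec d), ContinuousOn φ (closure Ω \ K) →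
    (p : PairSpace Ω).fst =ᵐ[volume.restrict Ω] φ → τ p =ᵐ[surface (frontier Ω)] φ

open Classical in
/-- The trace operator. The value `0` is a convention for the case of sets so irregular that there
is no bounded trace operator. -/
def trace {d : ℕ} (Ω K : Set (Vec d)) : symGradSpace Ω K →L[ℝ] L2Surf (frontier Ω) :=
  if h : ∃ τ, IsTraceOperator Ω K τ then h.choose else 0

/-! ### Functions of time -/

/-- `v` is the distributional derivative of `u` in `(0, T)`. -/
def IsWeakTimeDeriv {Y : Type*} [NormedAddCommGroup Y] [NormedSpace ℝ Y] (T : ℝ)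
    (u v : ℝ → Y) : Prop :=
  ∀ θ : ℝ → ℝ, ContDiff ℝ ∞ θ → HasCompactSupport θ → tsupport θ ⊆ Ioo 0 T →
    ∫ t in Ioo 0 T, deriv θ t • u t = -∫ t in Ioo 0 T, θ t • v t

/-- `u ∈ L²(0, T; Y)`. -/
def MemL2 {Y : Type*} [NormedAddCommGroup Y] (T : ℝ) (u : ℝ → Y) : Prop :=
  MemLp u 2 (volume.restrict (Ioo 0 T))

/-- The continuous representative of `u` on `[0, T]` has the value `y` at `s`. -/
def HasValueAt {Y : Type*} [NormedAddCommGroup Y] (T : ℝ) (u : ℝ → Y) (s : ℝ) (y : Y) : Prop :=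
  ∃ ψ : ℝ → Y, ContinuousOn ψ (Icc 0 T) ∧ u =ᵐ[volume.restrict (Ioo 0 T)] ψ ∧ ψ s = y

/-! ### The geometry -/

/-- A body `Ω` with a prescribed growing crack `t ↦ crack t`, `t ∈ [0, T]`, and a Dirichlet part
`∂D` of the boundary. -/
structure CrackedBody (d : ℕ) where
  /-- the final time -/
  T : ℝ
  /-- the reference configuration -/
  Ω : Set (Vec d)
  /-- the Dirichlet part of the boundary -/
  dirichlet : Set (Vec d)
  /-- the set that contains all cracks -/
  Γ : Set (Vec d)
  /-- the crack at time `t` -/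
  crack : ℝ → Set (Vec d)
  T_pos : 0 < T
  isOpen_Ω : IsOpen Ω
  isBounded_Ω : Bornology.IsBounded Ω
  lipschitz_Ω : HasLipschitzBoundary Ω
  dirichlet_subset : dirichlet ⊆ frontier Ω
  measurableSet_dirichlet : MeasurableSet dirichlet
  Γ_subset : Γ ⊆ closure Ω
  isClosed_Γ : IsClosed Γ
  volume_Γ : volume Γ = 0
  surface_Γ : surface (frontier Ω) Γ = 0
  two_sided : ∀ x ∈ Γ, ∃ U : Set (Vec d), IsOpen U ∧ x ∈ U ∧
    ∃ Up Um : Set (Vec d), IsOpen Up ∧ IsOpen Um ∧ Disjoint Up Um ∧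
      HasLipschitzBoundary Up ∧ HasLipschitzBoundary Um ∧ (U ∩ Ω) \ Γ = Up ∪ Um
  isClosed_crack : ∀ t ∈ Icc 0 T, IsClosed (crack t)
  crack_subset : ∀ t ∈ Icc 0 T, crack t ⊆ Γ
  crack_mono : ∀ s t, 0 ≤ s → s ≤ t → t ≤ T → crack s ⊆ crack t

namespace CrackedBody

variable {d : ℕ} (D : CrackedBody d)

/-- The Neumann part of the boundary. -/
def neumann : Set (Vec d) := frontier D.Ω \ D.dirichlet

/-- Pairs `(v, E v)` where `v, E v ∈ L²` and `E v` is taken in `Ω \ Γ`. All the spaces `V_t` are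
closed subspaces. -/
abbrev X : Type := symGradSpace D.Ω D.Γ

variable {D} in
/-- The function `v` of the pair `(v, E v)`. -/
def X.fn (p : D.X) : L2Vec D.Ω := (p : PairSpace D.Ω).fst

variable {D} in
/-- The symmetrized gradient `E v` of the pair `(v, E v)`. -/
def X.E (p : D.X) : L2Sym D.Ω := (p : PairSpace D.Ω).snd

/-- The space `V_t` (here the symmetrized gradient is that in `Ω \ Γ_t`). -/
def V (t : ℝ) : Set D.X := {p | IsSymGrad D.Ω (D.crack t) p.fn p.E}

/-- The space `V_t^D` of all `v ∈ V_t` with `v = 0` on `∂_D Ω` in the sense of traces. -/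
def VD (t : ℝ) : Set D.X :=
  {p | p ∈ D.V t ∧ ∀ᵐ x ∂(surface D.dirichlet), trace D.Ω D.Γ p x = 0}

/-- `φ ∈ L²(0, T; V_T)` and `φ(t) ∈ V_t` for a.e. `t ∈ (0, T)`. -/
def MemL2V (φ : ℝ → D.X) : Prop :=
  MemL2 D.T φ ∧ (∀ᵐ t ∂(volume.restrict (Ioo 0 D.T)), φ t ∈ D.V D.T) ∧
    ∀ᵐ t ∂(volume.restrict (Ioo 0 D.T)), φ t ∈ D.V t

/-- `ψ ∈ L²(0, T; H)` is the time derivative of `φ`. -/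
def IsDot (φ : ℝ → D.X) (ψ : ℝ → L2Vec D.Ω) : Prop :=
  MemL2 D.T ψ ∧ IsWeakTimeDeriv D.T (fun t => (φ t).fn) ψ

/-- `φ ∈ 𝓥`. -/
def MemCalV (φ : ℝ → D.X) : Prop := D.MemL2V φ ∧ ∃ ψ, D.IsDot φ ψ

/-- `φ ∈ 𝓥^D`. -/
def MemCalVD (φ : ℝ → D.X) : Prop :=
  D.MemCalV φ ∧ ∀ᵐ t ∂(volume.restrict (Ioo 0 D.T)), φ t ∈ D.VD t

end CrackedBody

/-! ### The data of the problem -/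

/-- A fourth-order tensor field on `Ω` that is essentially bounded, symmetric and uniformly
coercive on symmetric matrices. -/
structure IsTensorField {d : ℕ} (Ω : Set (Vec d)) (A : Vec d → (SymMat d →L[ℝ] SymMat d)) :
    Prop where
  bounded : MemLp A ∞ (volume.restrict Ω)
  symmetric : ∀ᵐ x ∂(volume.restrict Ω), ∀ η₁ η₂ : SymMat d,
    inner ℝ (A x η₁) η₂ = inner ℝ η₁ (A x η₂)
  coercive : ∃ c : ℝ, 0 < c ∧ ∀ᵐ x ∂(volume.restrict Ω), ∀ η : SymMat d,
    c * ‖η‖ ^ 2 ≤ inner ℝ (A x η) η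

/-- A smooth scalar test function with compact support in `(0, T) × Ω`. -/
def IsTestTX {d : ℕ} (T : ℝ) (Ω : Set (Vec d)) (η : ℝ × Vec d → ℝ) : Prop :=
  ContDiff ℝ ∞ η ∧ HasCompactSupport η ∧ tsupport η ⊆ Ioo 0 T ×ˢ Ω

/-- `F ∈ L^∞((0, T) × Ω)`. -/
def MemLInfTX {d : ℕ} {Y : Type*} [NormedAddCommGroup Y] (T : ℝ) (Ω : Set (Vec d))
    (F : ℝ × Vec d → Y) : Prop :=
  MemLp F ∞ (volume.restrict (Ioo 0 T ×ˢ Ω))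

/-- `G` is the distributional gradient `∇Ψ`, in the space variable, of `Ψ` in `(0, T) × Ω`. -/
def IsWeakSpaceGrad {d : ℕ} (T : ℝ) (Ω : Set (Vec d)) (Ψ : ℝ × Vec d → ℝ)
    (G : ℝ × Vec d → Vec d) : Prop :=
  ∀ η, IsTestTX T Ω η → ∀ i : Fin d,
    ∫ z in Ioo 0 T ×ˢ Ω, Ψ z * fderiv ℝ η z (0, EuclideanSpace.single i 1) =
      -∫ z in Ioo 0 T ×ˢ Ω, G z i * η z

/-- `M` is the mixed distributional derivative `∇ ∂_t Ψ` of `Ψ` in `(0, T) × Ω`. -/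
def IsWeakMixedGrad {d : ℕ} (T : ℝ) (Ω : Set (Vec d)) (Ψ : ℝ × Vec d → ℝ)
    (M : ℝ × Vec d → Vec d) : Prop :=
  ∀ η, IsTestTX T Ω η → ∀ i : Fin d,
    ∫ z in Ioo 0 T ×ˢ Ω, Ψ z *
        fderiv ℝ (fun y => fderiv ℝ η y (0, EuclideanSpace.single i 1)) z (1, 0) =
      ∫ z in Ioo 0 T ×ˢ Ω, M z i * η z

/-- The data of the viscoelastic problem in a cracked body. -/
structure ViscoData {d : ℕ} (D : CrackedBody d) where
  /-- the elasticity tensor -/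
  C : Vec d → (SymMat d →L[ℝ] SymMat d)
  /-- the viscosity tensor -/
  B : Vec d → (SymMat d →L[ℝ] SymMat d)
  /-- the scalar factor of the viscosity, as a function of `(t, x)` -/
  Ψ : ℝ × Vec d → ℝ
  /-- the spatial gradient of `Ψ` -/
  gradΨ : ℝ × Vec d → Vec d
  /-- the volume force -/
  f : ℝ → L2Vec D.Ω
  /-- the Dirichlet datum -/
  w : ℝ → D.X
  /-- the Neumann datum -/
  g : ℝ → L2Surf D.neumann
  /-- the initial displacement -/
  u0 : D.X
  /-- the initial velocity -/
  u1 : L2Vec D.Ω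
  tensor_C : IsTensorField D.Ω C
  tensor_B : IsTensorField D.Ω B
  Ψ_bounded : MemLInfTX D.T D.Ω Ψ
  isGrad_gradΨ : IsWeakSpaceGrad D.T D.Ω Ψ gradΨ
  gradΨ_bounded : MemLInfTX D.T D.Ω gradΨ
  f_mem : MemL2 D.T f
  /-- `w ∈ H²(0, T; H) ∩ H¹(0, T; V_0)` -/
  w_mem : MemL2 D.T w ∧ (∀ᵐ t ∂(volume.restrict (Ioo 0 D.T)), w t ∈ D.V 0) ∧
    ∃ w' : ℝ → D.X, MemL2 D.T w' ∧ (∀ᵐ t ∂(volume.restrict (Ioo 0 D.T)), w' t ∈ D.V 0) ∧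
      IsWeakTimeDeriv D.T (fun t => (w t : PairSpace D.Ω)) (fun t => (w' t : PairSpace D.Ω)) ∧
      ∃ w'' : ℝ → L2Vec D.Ω, D.IsDot w' w''
  /-- `g ∈ H¹(0, T; H_N)` -/
  g_mem : MemL2 D.T g ∧ ∃ g' : ℝ → L2Surf D.neumann, MemL2 D.T g' ∧ IsWeakTimeDeriv D.T g g'
  u0_mem : u0 ∈ D.V 0
  /-- `u⁰ - w(0) ∈ V_0^D` -/
  compatible : ∃ w0 : D.X, HasValueAt D.T w 0 w0 ∧ u0 - w0 ∈ D.VD 0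

namespace ViscoData

variable {d : ℕ} {D : CrackedBody d} (P : ViscoData D)

/-- `q = Ψ u̇` as a curve of elements of `V_t`, where `ψ = u̇`. -/
def IsPsiDot (ψ : ℝ → L2Vec D.Ω) (q : ℝ → D.X) : Prop :=
  D.MemL2V q ∧ ∀ᵐ t ∂(volume.restrict (Ioo 0 D.T)),
    (q t).fn =ᵐ[volume.restrict D.Ω] fun x => P.Ψ (t, x) • ψ t x

/-- `u ∈ 𝓦`. -/
def MemCalW (u : ℝ → D.X) : Prop :=
  D.MemCalV u ∧ ∃ ψ q, D.IsDot u ψ ∧ P.IsPsiDot ψ q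

/-- The weak formulation tested with `φ`; here `ψ = u̇`, `q = Ψ u̇` and `χ = φ̇`. -/
def WeakEquation (u : ℝ → D.X) (ψ : ℝ → L2Vec D.Ω) (q φ : ℝ → D.X) (χ : ℝ → L2Vec D.Ω) : Prop :=
  -(∫ t in Ioo 0 D.T, ∫ x in D.Ω, inner ℝ (ψ t x) (χ t x))
    + (∫ t in Ioo 0 D.T, ∫ x in D.Ω, inner ℝ (P.C x ((u t).E x)) ((φ t).E x))
    + (∫ t in Ioo 0 D.T, ∫ x in D.Ω,
        inner ℝ (P.B x ((q t).E x)) (P.Ψ (t, x) • (φ t).E x))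
    - (∫ t in Ioo 0 D.T, ∫ x in D.Ω,
        inner ℝ (P.B x (symProd (P.gradΨ (t, x)) (ψ t x))) (P.Ψ (t, x) • (φ t).E x))
  = (∫ t in Ioo 0 D.T, ∫ x in D.Ω, inner ℝ (P.f t x) ((φ t).fn x))
    + (∫ t in Ioo 0 D.T, ∫ x, inner ℝ (P.g t x) (trace D.Ω D.Γ (φ t) x) ∂(surface D.neumann))

/-- `u` is a weak solution to the viscoelastic system with its Dirichlet and Neumann boundary
conditions. -/
def IsWeakSolution (u : ℝ → D.X) : Prop :=
  P.MemCalW u ∧ D.MemCalVD (fun t => u t - P.w t) ∧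
    ∃ ψ q, D.IsDot u ψ ∧ P.IsPsiDot ψ q ∧
      ∀ φ χ, D.MemCalVD φ → D.IsDot φ χ →
        HasValueAt D.T (fun t => (φ t).fn) 0 0 → HasValueAt D.T (fun t => (φ t).fn) D.T 0 →
          P.WeakEquation u ψ q φ χ

/-- `u(0) = u⁰` and `u̇(0) = u¹` in the averaged sense. -/
def SatisfiesInitial (u : ℝ → D.X) : Prop :=
  ∃ ψ, D.IsDot u ψ ∧
    Tendsto (fun h : ℝ => (1 / h) * ∫ t in Ioo 0 h, (‖u t - P.u0‖ ^ 2 + ‖ψ t - P.u1‖ ^ 2))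
      (𝓝[>] 0) (𝓝 0)

end ViscoData

end CrackVisco

end

/-! The difference u of two weak solutions solves the homogeneous problem with zero initial data,
and since the crack does not grow, all the spaces V_t^D coincide with the closed subspace V_0^D. The
velocity is not an admissible test function: its strain is controlled only through Ψu̇, which says
nothing where Ψ vanishes. So the equation is integrated once in time and tested with u itself on (0,
s). In the weak formulation this means taking φ = ∫₀ᵗ v, where v equals u on (0, s) minus a constant
on a short initial layer (0, h) that restores zero mean, so that φ vanishes at both ends. As h → 0
the initial condition removes the velocity term of the layer
(`integral_velocity_add_integral_primitive_eq_zero`).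

The inertial and elastic terms are exact derivatives and give ½‖u(s)‖² and ½(ℂξ(s), ξ(s)), with ξ(s)
= ∫₀ˢ Eu. The viscous term requires the time primitive of p = Ψ(E(Ψu̇) - ∇Ψ ⊙ u̇), formally Ψ²Eu̇.
By `isWeakTimeDeriv_sq_mul_symGrad`, the product Ψ²Eu has the weak time derivative p + 2ΨΨ̇Eu, even
though no time derivative of Eu itself is available. This comes from testing the definition of E
with derivatives of θ(t)η(x)Ψ², which is legitimate after mollifying a Lipschitz extension of Ψ.
With z = ΨEu and m = Ψ̇z the outcome is `energy_identity`: ½‖u(s)‖² + ½(ℂξ(s), ξ(s)) + ∫₀ˢ (𝔹z, z) =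
2 ∫₀ˢ (𝔹m(t), ξ(s) - ξ(t)) dt.

Since ‖m‖ is at most a multiple of ‖z‖, coercivity leaves c₀‖ξ(s)‖² + c₁∫₀ˢ‖z‖² ≤ K∫₀ˢ‖z‖‖ξ(t) -
ξ(s)‖ dt. On a short interval, at a maximum point of ‖ξ‖, Young's inequality absorbs z and the
shortness absorbs ξ. Finitely many intervals of one fixed length give ξ = 0
(`eq_zero_of_energy_inequality`). Then Eu = 0, and the identity yields u = 0. -/

noncomputable section

namespace CrackVisco

/-! ### Weak derivatives and primitives of vector-valued functions of time -/

section TimeFunctions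

variable {H : Type*} [NormedAddCommGroup H] [NormedSpace ℝ H]

theorem setIntegral_Ioo_add {T r : ℝ} {y : ℝ → H} (hy : IntegrableOn y (Ioo 0 T))
    (hr : r ∈ Icc 0 T) :
    (∫ t in Ioo 0 r, y t) + ∫ t in Ioo r T, y t = ∫ t in Ioo 0 T, y t := by
  have h1 : IntervalIntegrable y volume 0 r := by
    rw [intervalIntegrable_iff_integrableOn_Ioo_of_le hr.1]
    exact hy.mono_set (Ioo_subset_Ioo_right hr.2)
  have h2 : IntervalIntegrable y volume r T := by
    rw [intervalIntegrable_iff_integrableOn_Ioo_of_le hr.2]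
    exact hy.mono_set (Ioo_subset_Ioo_left hr.1)
  have := intervalIntegral.integral_add_adjacent_intervals h1 h2
  rwa [intervalIntegral.integral_of_le hr.1, intervalIntegral.integral_of_le hr.2,
    intervalIntegral.integral_of_le (hr.1.trans hr.2), integral_Ioc_eq_integral_Ioo,
    integral_Ioc_eq_integral_Ioo, integral_Ioc_eq_integral_Ioo] at this

theorem continuousOn_primitive_Ioo {T : ℝ} {k : ℝ → H} (hk : IntegrableOn k (Ioo 0 T)) :
    ContinuousOn (fun t => ∫ r in Ioo 0 t, k r) (Icc 0 T) := by
  have h : IntegrableOn k (Icc 0 T) := (integrableOn_Icc_iff_integrableOn_Ioo).2 hk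
  refine (intervalIntegral.continuousOn_primitive h).congr fun t ht => ?_
  exact integral_Ioc_eq_integral_Ioo.symm

theorem IntegrableOn.test_smul {T : ℝ} {f : ℝ → H} (hf : IntegrableOn f (Ioo 0 T)) {θ : ℝ → ℝ}
    (hθ : Continuous θ) (hc : HasCompactSupport θ) :
    IntegrableOn (fun t => θ t • f t) (Ioo 0 T) := by
  obtain ⟨C, hC⟩ := hc.exists_bound_of_continuous hθ
  exact hf.bdd_smul C hθ.aestronglyMeasurable (Eventually.of_forall hC)

variable {H' Z : Type*} [CompleteSpace H]
  [NormedAddCommGroup H'] [NormedSpace ℝ H'] [CompleteSpace H']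
  [NormedAddCommGroup Z] [NormedSpace ℝ Z] [CompleteSpace Z]

/-- Fubini on the triangle r < t. It serves as integration by parts for functions that are only
integrable; the general bilinear form covers scalar multiplication, inner products, and inner
products composed with an operator. -/
theorem integral_bilin_primitive (β : H →L[ℝ] H' →L[ℝ] Z) {T : ℝ} {k : ℝ → H} {y : ℝ → H'}
    (hk : IntegrableOn k (Ioo 0 T)) (hy : IntegrableOn y (Ioo 0 T)) :
    ∫ t in Ioo 0 T, β (∫ r in Ioo 0 t, k r) (y t) =
      ∫ r in Ioo 0 T, β (k r) (∫ t in Ioo r T, y t) := by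
  have hprod : Integrable (fun z : ℝ × ℝ => β (k z.2) (y z.1))
      ((volume.restrict (Ioo 0 T)).prod (volume.restrict (Ioo 0 T))) := by
    refine hy.op_fst_snd (op := fun a b => β b a) (by fun_prop) ⟨‖β‖, fun a b => ?_⟩ hk
    refine (β.le_opNorm₂ b a).trans (le_of_eq ?_)
    ring
  have hmeas : MeasurableSet {z : ℝ × ℝ | z.2 < z.1} :=
    measurableSet_lt measurable_snd measurable_fst
  -- The restriction r < t is encoded by an indicator on the square, so that both iterated integrals
  -- run over the same product space.
  have key := integral_integral_swap (μ := volume.restrict (Ioo 0 T))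
    (ν := volume.restrict (Ioo 0 T))
    (f := fun t r => {z : ℝ × ℝ | z.2 < z.1}.indicator (fun z => β (k z.2) (y z.1)) (t, r))
    (by exact hprod.indicator hmeas)
  have e1 : ∀ t ∈ Ioo 0 T, β (∫ r in Ioo 0 t, k r) (y t) =
      ∫ r in Ioo 0 T, {z : ℝ × ℝ | z.2 < z.1}.indicator (fun z => β (k z.2) (y z.1)) (t, r) := by
    intro t ht
    have : ∀ r, {z : ℝ × ℝ | z.2 < z.1}.indicator (fun z => β (k z.2) (y z.1)) (t, r) =
        (Iio t).indicator (fun r => β (k r) (y t)) r := fun r => by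
      by_cases h : r < t <;> simp [h]
    simp_rw [this]
    rw [setIntegral_indicator measurableSet_Iio,
      show Ioo 0 T ∩ Iio t = Ioo 0 t by
      ext r; simp only [mem_inter_iff, mem_Ioo, mem_Iio]
      exact ⟨fun h => ⟨h.1.1, h.2⟩, fun h => ⟨⟨h.1, h.2.trans ht.2⟩, h.2⟩⟩]
    have hk' : IntegrableOn k (Ioo 0 t) := hk.mono_set (Ioo_subset_Ioo_right ht.2.le)
    exact ((β.flip (y t)).integral_comp_comm hk').symm
  have e2 : ∀ r ∈ Ioo 0 T, β (k r) (∫ t in Ioo r T, y t) =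
      ∫ t in Ioo 0 T, {z : ℝ × ℝ | z.2 < z.1}.indicator (fun z => β (k z.2) (y z.1)) (t, r) := by
    intro r hr
    have : ∀ t, {z : ℝ × ℝ | z.2 < z.1}.indicator (fun z => β (k z.2) (y z.1)) (t, r) =
        (Ioi r).indicator (fun t => β (k r) (y t)) t := fun t => by
      by_cases h : r < t <;> simp [h]
    simp_rw [this]
    rw [setIntegral_indicator measurableSet_Ioi, show Ioo 0 T ∩ Ioi r = Ioo r T by
      ext t; simp only [mem_inter_iff, mem_Ioo, mem_Ioi]
      exact ⟨fun h => ⟨h.2, h.1.2⟩, fun h => ⟨⟨hr.1.trans h.1, h.2⟩, h.1⟩⟩]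
    have hy' : IntegrableOn y (Ioo r T) := hy.mono_set (Ioo_subset_Ioo_left hr.1.le)
    exact ((β (k r)).integral_comp_comm hy').symm
  rw [setIntegral_congr_fun measurableSet_Ioo e1, setIntegral_congr_fun measurableSet_Ioo e2]
  exact key

theorem test_eq_zero {T : ℝ} {θ : ℝ → ℝ} (h : tsupport θ ⊆ Ioo 0 T) {t : ℝ} (ht : t ∉ Ioo 0 T) :
    θ t = 0 := image_eq_zero_of_notMem_tsupport fun h' => ht (h h')

theorem integral_deriv_test {T r : ℝ} {θ : ℝ → ℝ} (hθ : ContDiff ℝ ∞ θ)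
    (hs : tsupport θ ⊆ Ioo 0 T) (hr : r ≤ T) : ∫ t in Ioo r T, deriv θ t = - θ r := by
  rw [← integral_Ioc_eq_integral_Ioo, ← intervalIntegral.integral_of_le hr,
    intervalIntegral.integral_deriv_eq_sub
      (fun x _ => (hθ.differentiable (by simp)).differentiableAt)
      ((hθ.continuous_deriv (by simp)).intervalIntegrable _ _),
    test_eq_zero hs (t := T) (by simp)]
  simp

/-- Exchanging the order of integration turns the outer integral of θ' into ∫ᵣᵀ θ' = -θ(r). The
constant c drops out because θ' has zero mean. -/
theorem isWeakTimeDeriv_of_primitive {T : ℝ} (hT : 0 ≤ T) {u v : ℝ → H} {c : H}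
    (hv : IntegrableOn v (Ioo 0 T))
    (hu : ∀ᵐ t ∂(volume.restrict (Ioo 0 T)), u t = c + ∫ r in Ioo 0 t, v r) :
    IsWeakTimeDeriv T u v := by
  intro θ hθ hc hs
  have hd : IntegrableOn (deriv θ) (Ioo 0 T) :=
    ((hθ.continuous_deriv (by simp)).integrable_of_hasCompactSupport hc.deriv).integrableOn
  have key := integral_bilin_primitive (ContinuousLinearMap.lsmul ℝ ℝ).flip hv hd
  simp only [ContinuousLinearMap.flip_apply, ContinuousLinearMap.lsmul_apply] at key
  have e : ∫ t in Ioo 0 T, deriv θ t • u t =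
      ∫ t in Ioo 0 T, (deriv θ t • c + deriv θ t • ∫ r in Ioo 0 t, v r) := by
    refine integral_congr_ae ?_
    filter_upwards [hu] with t ht
    rw [ht, smul_add]
  have hci : IntegrableOn (fun t => deriv θ t • ∫ r in Ioo 0 t, v r) (Ioo 0 T) := by
    exact IntegrableOn.test_smul (((continuousOn_primitive_Ioo hv).integrableOn_Icc
      (μ := volume)).mono_set Ioo_subset_Icc_self) (hθ.continuous_deriv (by simp)) hc.deriv
  rw [e, integral_add (hd.smul_const c) hci, key, integral_smul_const,
    integral_deriv_test hθ hs hT, test_eq_zero hs (t := 0) (by simp), neg_zero, zero_smul, zero_add,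
    ← integral_neg]
  refine setIntegral_congr_fun measurableSet_Ioo fun r hr => ?_
  rw [integral_deriv_test hθ hs hr.2.le, neg_smul]

theorem ae_eq_zero_of_integral_test_smul {T : ℝ} {f : ℝ → H} (hf : IntegrableOn f (Ioo 0 T))
    (h : ∀ θ : ℝ → ℝ, ContDiff ℝ ∞ θ → HasCompactSupport θ → tsupport θ ⊆ Ioo 0 T →
      ∫ t in Ioo 0 T, θ t • f t = 0) : f =ᵐ[volume.restrict (Ioo 0 T)] 0 := by
  have := IsOpen.ae_eq_zero_of_integral_contDiff_smul_eq_zero (isOpen_Ioo (a := 0) (b := T))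
    hf.locallyIntegrableOn (fun g h1 h2 h3 => by
      rw [← h g h1 h2 h3, setIntegral_eq_integral_of_forall_compl_eq_zero]
      intro t ht
      rw [test_eq_zero h3 ht, zero_smul])
  exact (ae_restrict_iff' measurableSet_Ioo).2 this

theorem exists_test_integral_one {T : ℝ} (hT : 0 < T) : ∃ χ : ℝ → ℝ, ContDiff ℝ ∞ χ ∧
    HasCompactSupport χ ∧ tsupport χ ⊆ Ioo 0 T ∧ ∫ t in Ioo 0 T, χ t = 1 := by
  let φ : ContDiffBump (T / 2) := ⟨T / 8, T / 4, by positivity, by linarith⟩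
  have hs : tsupport (φ.normed volume) ⊆ Ioo 0 T := by
    rw [φ.tsupport_normed_eq, Real.closedBall_eq_Icc]
    intro t ht
    simp only [φ, mem_Icc, mem_Ioo] at ht ⊢
    constructor <;> linarith [ht.1, ht.2]
  refine ⟨φ.normed volume, φ.contDiff_normed, φ.hasCompactSupport_normed, hs, ?_⟩
  rw [setIntegral_eq_integral_of_forall_compl_eq_zero fun t ht => test_eq_zero hs ht]
  exact φ.integral_normed

/-- A compactly supported smooth function on `(0, T)` of zero mean is the derivative of another. -/
theorem exists_test_deriv_eq {T : ℝ} (hT : 0 < T) {g : ℝ → ℝ} (hg : ContDiff ℝ ∞ g)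
    (hc : HasCompactSupport g) (hs : tsupport g ⊆ Ioo 0 T) (h0 : ∫ t in Ioo 0 T, g t = 0) :
    ∃ θ : ℝ → ℝ, ContDiff ℝ ∞ θ ∧ HasCompactSupport θ ∧ tsupport θ ⊆ Ioo 0 T ∧ deriv θ = g := by
  let θ : ℝ → ℝ := fun t => ∫ r in (0 : ℝ)..t, g r
  have hder : ∀ t, HasDerivAt θ (g t) t := fun t =>
    intervalIntegral.integral_hasDerivAt_right (hg.continuous.intervalIntegrable _ _)
      (hg.continuous.stronglyMeasurableAtFilter _ _) hg.continuous.continuousAt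
  have hd : deriv θ = g := funext fun t => (hder t).deriv
  have hsm : ContDiff ℝ ∞ θ := by
    rw [contDiff_infty_iff_deriv, hd]
    exact ⟨fun t => (hder t).differentiableAt, hg⟩
  obtain ⟨a, b, hab, ha, hb⟩ : ∃ a b : ℝ, tsupport g ⊆ Icc a b ∧ 0 < a ∧ b < T := by
    rcases (tsupport g).eq_empty_or_nonempty with he | hne
    · exact ⟨T / 2, T / 2, by simp [he], by positivity, by linarith⟩
    · obtain ⟨a, ha⟩ := hc.isCompact.exists_isLeast hne
      obtain ⟨b, hb⟩ := hc.isCompact.exists_isGreatest hne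
      exact ⟨a, b, fun t ht => ⟨ha.2 ht, hb.2 ht⟩, (hs ha.1).1, (hs hb.1).2⟩
  have hz : ∀ t, t ∉ Icc a b → θ t = 0 := by
    intro t ht
    have hlow : ∀ t < a, θ t = 0 := by
      intro t ht
      have : ∀ r ∈ uIcc 0 t, g r = 0 := fun r hr => image_eq_zero_of_notMem_tsupport fun h => by
        have h1 := (hab h).1
        rcases le_total 0 t with h0 | h0
        · rw [uIcc_of_le h0] at hr; linarith [hr.2]
        · rw [uIcc_of_ge h0] at hr; linarith [hr.2]
      simp only [θ]
      rw [intervalIntegral.integral_congr (g := fun _ => 0) this]; simp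
    rcases lt_or_ge t a with h | h
    · exact hlow t h
    · have hbt : b < t := lt_of_not_ge fun h' => ht ⟨h, h'⟩
      have : ∀ r ∈ uIcc T t, g r = 0 := fun r hr => image_eq_zero_of_notMem_tsupport fun h => by
        have h1 := (hab h).2
        rcases le_total T t with h0 | h0
        · rw [uIcc_of_le h0] at hr; linarith [hr.1]
        · rw [uIcc_of_ge h0] at hr; linarith [hr.1]
      -- Here the zero mean of g enters: beyond the support the primitive equals the full integral
      -- of g.
      have h2 : ∫ r in (0 : ℝ)..T, g r = 0 := by
        rw [intervalIntegral.integral_of_le hT.le, integral_Ioc_eq_integral_Ioo, h0]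
      have h3 := intervalIntegral.integral_add_adjacent_intervals (μ := volume)
        (hg.continuous.intervalIntegrable 0 T) (hg.continuous.intervalIntegrable T t)
      simp only [θ]
      rw [← h3, h2, intervalIntegral.integral_congr (g := fun _ => 0) this]; simp
  have hts : tsupport θ ⊆ Icc a b :=
    closure_minimal (fun t ht => by_contra fun h => ht (hz t h)) isClosed_Icc
  exact ⟨θ, hsm, HasCompactSupport.of_support_subset_isCompact isCompact_Icc
    ((subset_tsupport θ).trans hts), hts.trans (fun t ht => ⟨ha.trans_le ht.1,
    ht.2.trans_lt hb⟩), hd⟩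

/-- The du Bois-Reymond lemma. A test function g minus its mean times a fixed bump χ of unit
integral is a derivative, so f pairs with g as the constant ∫ χ f does. -/
theorem exists_const_of_integral_deriv_smul {T : ℝ} (hT : 0 < T) {f : ℝ → H}
    (hf : IntegrableOn f (Ioo 0 T))
    (h : ∀ θ : ℝ → ℝ, ContDiff ℝ ∞ θ → HasCompactSupport θ → tsupport θ ⊆ Ioo 0 T →
      ∫ t in Ioo 0 T, deriv θ t • f t = 0) :
    ∃ c : H, ∀ᵐ t ∂(volume.restrict (Ioo 0 T)), f t = c := by
  obtain ⟨χ, h1, h2, h3, h4⟩ := exists_test_integral_one hT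
  refine ⟨∫ t in Ioo 0 T, χ t • f t, ?_⟩
  set c := ∫ t in Ioo 0 T, χ t • f t
  have hconst : IntegrableOn (fun _ : ℝ => c) (Ioo 0 T) := by simp
  have := ae_eq_zero_of_integral_test_smul (f := fun t => f t - c) (hf.sub hconst) ?_
  · filter_upwards [this] with t ht
    exact sub_eq_zero.1 ht
  intro g g1 g2 g3
  set m := ∫ t in Ioo 0 T, g t
  have gi : IntegrableOn g (Ioo 0 T) :=
    (g1.continuous.integrable_of_hasCompactSupport g2).integrableOn
  have χi : IntegrableOn χ (Ioo 0 T) :=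
    (h1.continuous.integrable_of_hasCompactSupport h2).integrableOn
  obtain ⟨θ, t1, t2, t3, t4⟩ := exists_test_deriv_eq hT (g := fun t => g t - m * χ t)
    (g1.sub (contDiff_const.mul h1)) (g2.sub h2.mul_left)
    ((tsupport_sub _ _).trans (union_subset g3 ((tsupport_mul_subset_right).trans h3)))
    (by rw [integral_sub gi (χi.const_mul m), integral_const_mul, h4]; simp [m])
  have := h θ t1 t2 t3
  rw [t4] at this
  simp_rw [sub_smul, mul_smul, smul_sub] at this ⊢
  have hm : IntegrableOn (fun t => m • χ t • f t) (Ioo 0 T) :=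
    (IntegrableOn.test_smul hf h1.continuous h2).smul m
  rw [integral_sub (IntegrableOn.test_smul hf g1.continuous g2) hm, integral_smul] at this
  rw [integral_sub (IntegrableOn.test_smul hf g1.continuous g2)
    (IntegrableOn.test_smul hconst g1.continuous g2), integral_smul_const]
  exact this

/-- The function and the primitive of its weak derivative have the same weak derivative, so their
difference is constant. -/
theorem IsWeakTimeDeriv.exists_primitive {T : ℝ} (hT : 0 < T) {u v : ℝ → H}
    (hu : IntegrableOn u (Ioo 0 T)) (hv : IntegrableOn v (Ioo 0 T)) (h : IsWeakTimeDeriv T u v) :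
    ∃ c : H, ∀ᵐ t ∂(volume.restrict (Ioo 0 T)), u t = c + ∫ r in Ioo 0 t, v r := by
  have hp : IntegrableOn (fun t => ∫ r in Ioo 0 t, v r) (Ioo 0 T) :=
    ((continuousOn_primitive_Ioo hv).integrableOn_Icc (μ := volume)).mono_set Ioo_subset_Icc_self
  obtain ⟨c, hc⟩ := exists_const_of_integral_deriv_smul hT
    (f := fun t => u t - ∫ r in Ioo 0 t, v r) (hu.sub hp) (fun θ h1 h2 h3 => by
      have e1 := h θ h1 h2 h3
      have e2 := isWeakTimeDeriv_of_primitive hT.le (u := fun t => ∫ r in Ioo 0 t, v r) (c := 0) hv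
        (Eventually.of_forall fun t => by simp) θ h1 h2 h3
      simp_rw [smul_sub]
      rw [integral_sub (IntegrableOn.test_smul hu (h1.continuous_deriv (by simp)) h2.deriv)
        (IntegrableOn.test_smul hp (h1.continuous_deriv (by simp)) h2.deriv), e1, e2, sub_self])
  exact ⟨c, hc.mono fun t ht => by rw [← ht]; abel⟩

theorem IsWeakTimeDeriv.unique {T : ℝ} {u v w : ℝ → H}
    (hv : IntegrableOn v (Ioo 0 T)) (hw : IntegrableOn w (Ioo 0 T)) (h : IsWeakTimeDeriv T u v)
    (h' : IsWeakTimeDeriv T u w) : v =ᵐ[volume.restrict (Ioo 0 T)] w := by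
  have := ae_eq_zero_of_integral_test_smul (f := fun t => v t - w t) (hv.sub hw)
    (fun θ h1 h2 h3 => by
      have e1 := h θ h1 h2 h3
      have e2 := h' θ h1 h2 h3
      simp_rw [smul_sub]
      rw [integral_sub (IntegrableOn.test_smul hv h1.continuous h2)
        (IntegrableOn.test_smul hw h1.continuous h2), sub_eq_zero]
      exact neg_injective (e1.symm.trans e2))
  filter_upwards [this] with t ht
  exact sub_eq_zero.1 ht

/-- A function with integrable derivative that vanishes at `0` in the averaged sense is the
primitive of its derivative. -/
theorem IsWeakTimeDeriv.eq_primitive {T : ℝ} (hT : 0 < T) {u v : ℝ → H}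
    (hu : IntegrableOn u (Ioo 0 T)) (hv : IntegrableOn v (Ioo 0 T)) (h : IsWeakTimeDeriv T u v)
    (hu2 : IntegrableOn (fun t => ‖u t‖ ^ 2) (Ioo 0 T))
    (h0 : Tendsto (fun s : ℝ => (1 / s) * ∫ t in Ioo 0 s, ‖u t‖ ^ 2) (𝓝[>] 0) (𝓝 0)) :
    ∀ᵐ t ∂(volume.restrict (Ioo 0 T)), u t = ∫ r in Ioo 0 t, v r := by
  obtain ⟨c, hc⟩ := h.exists_primitive hT hu hv
  suffices c = 0 by simpa [this] using hc
  by_contra hne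
  have hpos : 0 < ‖c‖ ^ 2 := by positivity
  have hcont : ContinuousWithinAt (fun t => ‖c + ∫ r in Ioo 0 t, v r‖ ^ 2) (Icc 0 T) 0 :=
    ((continuousOn_const.add (continuousOn_primitive_Ioo hv)).norm.pow 2) 0 ⟨le_rfl, hT.le⟩
  -- If c ≠ 0, continuity at 0 keeps the squared norm above ‖c‖²/2 on a short interval, hence also
  -- its averages there.
  have hev : ∀ᶠ t in 𝓝[Icc 0 T] 0, ‖c‖ ^ 2 / 2 < ‖c + ∫ r in Ioo 0 t, v r‖ ^ 2 := by
    refine hcont.eventually (lt_mem_nhds ?_)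
    simp
    linarith
  obtain ⟨ε, hε, hball⟩ := Metric.mem_nhdsWithin_iff.1 hev
  have hlow : ∀ᶠ s in 𝓝[>] (0 : ℝ), ‖c‖ ^ 2 / 2 ≤ (1 / s) * ∫ t in Ioo 0 s, ‖u t‖ ^ 2 := by
    have hm : Ioo (0 : ℝ) (min ε T) ∈ 𝓝[>] (0 : ℝ) := Ioo_mem_nhdsGT (lt_min hε hT)
    filter_upwards [hm] with s hs
    have hsT : s ≤ T := (hs.2.trans_le (min_le_right _ _)).le
    have hi : ∫ t in Ioo 0 s, (‖c‖ ^ 2 / 2) ≤ ∫ t in Ioo 0 s, ‖u t‖ ^ 2 := by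
      refine integral_mono_ae (by simp) (hu2.mono_set (Ioo_subset_Ioo_right hsT)) ?_
      filter_upwards [ae_restrict_of_ae_restrict_of_subset (Ioo_subset_Ioo_right hsT) hc,
        ae_restrict_mem measurableSet_Ioo] with t ht hts
      rw [ht]
      refine (hball ⟨?_, hts.1.le, hts.2.le.trans hsT⟩ : _ < _).le
      rw [Metric.mem_ball, Real.dist_eq, sub_zero, abs_of_pos hts.1]
      exact hts.2.trans (hs.2.trans_le (min_le_left _ _))
    simp only [integral_const, MeasurableSet.univ, measureReal_restrict_apply, univ_inter,
      Real.volume_real_Ioo_of_le hs.1.le, sub_zero, smul_eq_mul] at hi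
    rw [div_mul_eq_mul_div, one_mul, le_div_iff₀ hs.1]
    linarith
  have := ge_of_tendsto h0 hlow
  linarith

/-- Formally the integrand is the derivative of ½β(K, K), where K is the primitive of k. Fubini and
symmetry express the integral as β(K(s), K(s)) minus itself, so no differentiation is needed. -/
theorem integral_bilin_symm_primitive (β : H →L[ℝ] H →L[ℝ] ℝ) (hβ : ∀ a b, β a b = β b a)
    {s : ℝ} {k : ℝ → H} (hk : IntegrableOn k (Ioo 0 s)) :
    ∫ t in Ioo 0 s, β (k t) (∫ r in Ioo 0 t, k r) =
      (1 / 2) * β (∫ r in Ioo 0 s, k r) (∫ r in Ioo 0 s, k r) := by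
  have key := integral_bilin_primitive β hk hk
  have hp : IntegrableOn (fun t => β (k t) (∫ r in Ioo 0 t, k r)) (Ioo 0 s) := by
    have hc := continuousOn_primitive_Ioo hk
    obtain ⟨C, hC⟩ := isCompact_Icc.exists_bound_of_continuousOn hc
    refine ContinuousLinearMap.integrable_of_bilin_of_bdd_right β C hk
      ((hc.mono Ioo_subset_Icc_self).aestronglyMeasurable measurableSet_Ioo) ?_
    filter_upwards [ae_restrict_mem measurableSet_Ioo] with t ht
    exact hC t (Ioo_subset_Icc_self ht)
  have e : ∫ r in Ioo 0 s, β (k r) (∫ t in Ioo r s, k t) =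
      ∫ r in Ioo 0 s, (β (k r) (∫ t in Ioo 0 s, k t) - β (k r) (∫ t in Ioo 0 r, k t)) := by
    refine setIntegral_congr_fun measurableSet_Ioo fun r hr => ?_
    rw [← map_sub, ← setIntegral_Ioo_add hk ⟨hr.1.le, hr.2.le⟩, add_sub_cancel_left]
  have h1 : ∫ t in Ioo 0 s, β (k t) (∫ r in Ioo 0 s, k r) =
      β (∫ r in Ioo 0 s, k r) (∫ r in Ioo 0 s, k r) :=
    (β.flip (∫ r in Ioo 0 s, k r)).integral_comp_comm hk
  have hi : IntegrableOn (fun t => β (k t) (∫ r in Ioo 0 s, k r)) (Ioo 0 s) :=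
    (β.flip (∫ r in Ioo 0 s, k r)).integrable_comp hk
  rw [e, integral_sub hi hp, h1] at key
  simp_rw [hβ _ (k _)] at key
  linarith

end TimeFunctions

/-! ### A Gronwall-type argument for the energy inequality -/

/-- Evaluate the inequality at a point σ where ‖ξ‖ is maximal. Only (s₁, σ) contributes, since z
vanishes before s₁; there ‖ξ(t) - ξ(σ)‖ is at most twice the maximum m. Young's inequality absorbs
‖z‖² into the left side and leaves c₀m² ≤ ½c₀m² by the choice of the length. -/
theorem eq_zero_of_energy_inequality_step {H : Type*} [NormedAddCommGroup H] {s₁ s₂ c₀ c₁ C : ℝ}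
    {z ξ : ℝ → H} (h0 : 0 ≤ s₁) (h1 : s₁ ≤ s₂) (hc₀ : 0 < c₀) (hc₁ : 0 < c₁)
    (hδ : (s₂ - s₁) * C ^ 2 ≤ c₀ * c₁ / 2)
    (hzm : AEStronglyMeasurable z (volume.restrict (Ioo 0 s₂)))
    (hz : IntegrableOn (fun t => ‖z t‖ ^ 2) (Ioo 0 s₂)) (hξ : ContinuousOn ξ (Icc 0 s₂))
    (h : ∀ s ∈ Icc 0 s₂, c₀ * ‖ξ s‖ ^ 2 + c₁ * ∫ t in Ioo 0 s, ‖z t‖ ^ 2 ≤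
      C * ∫ t in Ioo 0 s, ‖z t‖ * ‖ξ t - ξ s‖)
    (hzero : ∀ s ∈ Icc 0 s₁, ξ s = 0) : ∀ s ∈ Icc 0 s₂, ξ s = 0 := by
  obtain ⟨σ, hσ, hmax⟩ := isCompact_Icc.exists_isMaxOn (nonempty_Icc.2 (h0.trans h1)) hξ.norm
  suffices hσ0 : ‖ξ σ‖ = 0 from fun s hs => norm_eq_zero.1
    (le_antisymm ((hmax hs).trans hσ0.le) (norm_nonneg _))
  by_cases hσ1 : σ ≤ s₁
  · rw [hzero σ ⟨hσ.1, hσ1⟩, norm_zero]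
  push Not at hσ1
  set m := ‖ξ σ‖
  -- At s₁ the right side vanishes because ξ = 0 up to there, so the inequality kills the integral
  -- of ‖z‖².
  have hz0 : ∀ᵐ t ∂(volume.restrict (Ioo 0 s₁)), ‖z t‖ ^ 2 = 0 := by
    have hle := h s₁ ⟨h0, h1⟩
    have e : ∫ t in Ioo 0 s₁, ‖z t‖ * ‖ξ t - ξ s₁‖ = 0 :=
      setIntegral_eq_zero_of_forall_eq_zero fun t ht => by
        rw [hzero t (Ioo_subset_Icc_self ht), hzero s₁ ⟨h0, le_rfl⟩, sub_zero, norm_zero, mul_zero]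
    rw [e, hzero s₁ ⟨h0, le_rfl⟩, norm_zero, mul_zero] at hle
    have hnn : 0 ≤ ∫ t in Ioo 0 s₁, ‖z t‖ ^ 2 := integral_nonneg fun t => by positivity
    have : ∫ t in Ioo 0 s₁, ‖z t‖ ^ 2 = 0 := le_antisymm (by nlinarith) hnn
    exact (integral_eq_zero_iff_of_nonneg (fun t => by positivity)
      (hz.mono_set (Ioo_subset_Ioo_right h1))).1 this
  have hσs := h σ hσ
  have hzσ := hz.mono_set (Ioo_subset_Ioo_right hσ.2)
  have hind : IntegrableOn ((Ioo s₁ σ).indicator fun _ => C ^ 2 / c₁ * m ^ 2) (Ioo 0 σ) :=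
    (integrable_indicator_iff measurableSet_Ioo).2 (integrableOn_const (by simp)) |>.integrableOn
  have hz0' : ∀ᵐ t, t ∈ Ioo 0 s₁ → ‖z t‖ ^ 2 = 0 := (ae_restrict_iff' measurableSet_Ioo).1 hz0
  have hne : ∀ᵐ t : ℝ, t ≠ s₁ := by simp [ae_iff, measure_singleton]
  have hbound : ∀ᵐ t ∂(volume.restrict (Ioo 0 σ)), C * (‖z t‖ * ‖ξ t - ξ σ‖) ≤
      c₁ * ‖z t‖ ^ 2 + (Ioo s₁ σ).indicator (fun _ => C ^ 2 / c₁ * m ^ 2) t := by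
    filter_upwards [ae_restrict_of_ae hz0', ae_restrict_of_ae hne,
      ae_restrict_mem measurableSet_Ioo] with t h2 h3 h4
    rcases lt_or_gt_of_ne h3 with h5 | h5
    · have : ‖z t‖ = 0 := by simpa using h2 ⟨h4.1, h5⟩
      rw [indicator_of_notMem (by simp [h5.le]), this]
      simp
    · rw [indicator_of_mem (show t ∈ Ioo s₁ σ from ⟨h5, h4.2⟩)]
      have hd : ‖ξ t - ξ σ‖ ≤ 2 * m := by
        have := hmax (show t ∈ Icc 0 s₂ from ⟨h4.1.le, h4.2.le.trans hσ.2⟩)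
        have h6 := norm_sub_le (ξ t) (ξ σ)
        simp only [mem_ofPred_eq] at this
        linarith
      -- Young's inequality, with the defect written as the square of c₁‖z‖ - |C|m divided by c₁.
      have h7 : |C| * (‖z t‖ * (2 * m)) ≤ c₁ * ‖z t‖ ^ 2 + C ^ 2 / c₁ * m ^ 2 := by
        have e : C ^ 2 / c₁ * m ^ 2 = (|C| * m) ^ 2 / c₁ := by rw [mul_pow, sq_abs]; ring
        rw [e, ← sub_nonneg]
        have : c₁ * ‖z t‖ ^ 2 + (|C| * m) ^ 2 / c₁ - |C| * (‖z t‖ * (2 * m)) =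
            (c₁ * ‖z t‖ - |C| * m) ^ 2 / c₁ := by field_simp; ring
        rw [this]; positivity
      refine le_trans ?_ h7
      exact mul_le_mul (le_abs_self C) (by gcongr) (by positivity) (abs_nonneg C)
  have hli : IntegrableOn (fun t => C * (‖z t‖ * ‖ξ t - ξ σ‖)) (Ioo 0 σ) := by
    have hzm' := hzm.mono_set (Ioo_subset_Ioo_right hσ.2)
    have hm : AEStronglyMeasurable (fun t => ‖ξ t - ξ σ‖) (volume.restrict (Ioo 0 σ)) :=
      (((hξ.sub continuousOn_const).norm).mono
        (Ioo_subset_Icc_self.trans (Icc_subset_Icc_right hσ.2))).aestronglyMeasurable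
        measurableSet_Ioo
    refine Integrable.const_mul (Integrable.mul_bdd ?_ hm (c := 2 * m) ?_) C
    · exact ((memLp_two_iff_integrable_sq_norm hzm').2 hzσ).norm.integrable (by norm_num)
    · filter_upwards [ae_restrict_mem measurableSet_Ioo] with t h4
      have := hmax (show t ∈ Icc 0 s₂ from ⟨h4.1.le, h4.2.le.trans hσ.2⟩)
      have h6 := norm_sub_le (ξ t) (ξ σ)
      simp only [mem_ofPred_eq] at this
      rw [norm_norm]
      linarith
  have hint := integral_mono_ae hli ((hzσ.const_mul c₁).add hind) hbound
  simp only [Pi.add_apply] at hint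
  rw [integral_add (hzσ.const_mul c₁) hind, integral_const_mul, integral_const_mul,
    setIntegral_indicator measurableSet_Ioo,
    inter_eq_right.2 (Ioo_subset_Ioo_left h0)] at hint
  simp only [integral_const, MeasurableSet.univ, measureReal_restrict_apply, univ_inter,
    Real.volume_real_Ioo_of_le hσ1.le, smul_eq_mul] at hint
  have h8 : c₀ * m ^ 2 ≤ (σ - s₁) * (C ^ 2 / c₁ * m ^ 2) := by linarith
  have h9 : (σ - s₁) * (C ^ 2 / c₁ * m ^ 2) ≤ c₀ / 2 * m ^ 2 := by
    have h10 : (σ - s₁) * C ^ 2 ≤ c₀ * c₁ / 2 := le_trans (by gcongr; exact hσ.2) hδ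
    have : (σ - s₁) * (C ^ 2 / c₁ * m ^ 2) = ((σ - s₁) * C ^ 2) / c₁ * m ^ 2 := by ring
    rw [this]
    refine mul_le_mul_of_nonneg_right ?_ (sq_nonneg m)
    rw [div_le_iff₀ hc₁]
    linarith
  have h11 : m ^ 2 ≤ 0 := by nlinarith
  exact pow_eq_zero_iff (two_ne_zero) |>.1 (le_antisymm h11 (by positivity))

theorem eq_zero_of_energy_inequality {H : Type*} [NormedAddCommGroup H] {T c₀ c₁ C : ℝ}
    {z ξ : ℝ → H} (hc₀ : 0 < c₀) (hc₁ : 0 < c₁)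
    (hzm : AEStronglyMeasurable z (volume.restrict (Ioo 0 T)))
    (hz : IntegrableOn (fun t => ‖z t‖ ^ 2) (Ioo 0 T)) (hξ : ContinuousOn ξ (Icc 0 T))
    (h : ∀ s ∈ Icc 0 T, c₀ * ‖ξ s‖ ^ 2 + c₁ * ∫ t in Ioo 0 s, ‖z t‖ ^ 2 ≤
      C * ∫ t in Ioo 0 s, ‖z t‖ * ‖ξ t - ξ s‖)
    (hξ0 : ξ 0 = 0) : ∀ s ∈ Icc 0 T, ξ s = 0 := by
  -- A step length independent of the position; the summand 1 keeps it well defined and positive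
  -- when C = 0.
  set δ := c₀ * c₁ / (2 * (C ^ 2 + 1))
  have hδ : 0 < δ := by positivity
  have hδC : δ * C ^ 2 ≤ c₀ * c₁ / 2 := by
    have : δ * C ^ 2 ≤ δ * (C ^ 2 + 1) := by gcongr; linarith
    refine this.trans (le_of_eq ?_)
    simp only [δ]; field_simp
  have key : ∀ n : ℕ, ∀ s ∈ Icc 0 (min (n * δ) T), ξ s = 0 := by
    intro n
    induction n with
    | zero =>
      intro s hs
      have h1 := hs.2.trans (min_le_left _ _)
      simp only [Nat.cast_zero, zero_mul] at h1
      rw [le_antisymm h1 hs.1, hξ0]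
    | succ n ih =>
      intro s hs
      have hT : 0 ≤ T := hs.1.trans (hs.2.trans (min_le_right _ _))
      have hsub : min ((n + 1 : ℕ) * δ) T ≤ T := min_le_right _ _
      refine eq_zero_of_energy_inequality_step (s₁ := min (n * δ) T)
        (s₂ := min ((n + 1 : ℕ) * δ) T) (le_min (by positivity) hT)
        (min_le_min_right _ (by push_cast; nlinarith)) hc₀ hc₁ ?_
        (hzm.mono_set (Ioo_subset_Ioo_right hsub)) (hz.mono_set (Ioo_subset_Ioo_right hsub))
        (hξ.mono (Icc_subset_Icc_right hsub)) (fun s hs => h s ⟨hs.1, hs.2.trans hsub⟩) ih s hs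
      refine le_trans ?_ hδC
      gcongr
      rw [sub_le_iff_le_add]
      push_cast
      rcases le_total (n * δ) T with h1 | h1
      · rw [min_eq_left h1]
        exact (min_le_left _ _).trans (by linarith)
      · rw [min_eq_right h1]
        exact (min_le_right _ _).trans (by linarith)
  intro s hs
  obtain ⟨n, hn⟩ := exists_nat_ge (T / δ)
  refine key n s ⟨hs.1, le_min (hs.2.trans ?_) hs.2⟩
  rwa [div_le_iff₀ hδ] at hn

/-! ### Mollification of Lipschitz functions -/

section Mollification

variable {E : Type*} [NormedAddCommGroup E] [NormedSpace ℝ E] [FiniteDimensional ℝ E]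
  [MeasurableSpace E] [BorelSpace E] (μ : Measure E) [μ.IsAddHaarMeasure]

open scoped Convolution in
-- Differentiation falls on the Lipschitz factor: by Rademacher the integrand is differentiable for
-- almost every y, and the Lipschitz constant supplies the dominating function. This form transfers
-- the bound L to the mollified derivative.
theorem hasFDerivAt_convolution_lipschitz {f : E → ℝ} {L : ℝ≥0} (hf : LipschitzWith L f)
    (φ : ContDiffBump (0 : E)) (z : E) :
    HasFDerivAt (φ.normed μ ⋆[ContinuousLinearMap.lsmul ℝ ℝ, μ] f)
      ((φ.normed μ ⋆[ContinuousLinearMap.lsmul ℝ ℝ, μ] fderiv ℝ f) z) z := by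
  have hφc := φ.continuous_normed (μ := μ)
  have hdiff : ∀ᵐ y ∂μ, DifferentiableAt ℝ f (z - y) :=
    (μ.measurePreserving_sub_left z).quasiMeasurePreserving.ae hf.ae_differentiableAt
  have hm : ∀ x : E, AEStronglyMeasurable (fun y => φ.normed μ y • f (x - y)) μ := fun x =>
    (hφc.smul (hf.continuous.comp (continuous_const.sub continuous_id))).aestronglyMeasurable
  have := (hasFDerivAt_integral_of_dominated_loc_of_lip (μ := μ) (𝕜 := ℝ) (x₀ := z) (s := univ)
    (F := fun x y => φ.normed μ y • f (x - y))
    (F' := fun y => φ.normed μ y • fderiv ℝ f (z - y)) (bound := fun y => φ.normed μ y * L)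
    univ_mem (Eventually.of_forall hm) ?_ ?_ ?_ ?_ ?_).2
  · exact this
  · exact (hφc.smul (hf.continuous.comp (continuous_const.sub
      continuous_id))).integrable_of_hasCompactSupport φ.hasCompactSupport_normed.smul_right
  · exact hφc.aestronglyMeasurable.smul
      ((measurable_fderiv ℝ f).comp (measurable_const.sub measurable_id)).aestronglyMeasurable
  · refine Eventually.of_forall fun y => LipschitzOnWith.of_dist_le_mul fun a _ b _ => ?_
    rw [Real.coe_nnabs, abs_of_nonneg (mul_nonneg (φ.nonneg_normed (μ := μ) y) L.coe_nonneg),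
      dist_smul₀,
      Real.norm_of_nonneg (φ.nonneg_normed y), mul_assoc]
    refine mul_le_mul_of_nonneg_left ?_ (φ.nonneg_normed y)
    simpa using hf.dist_le_mul (a - y) (b - y)
  · exact (φ.integrable_normed).mul_const _
  · filter_upwards [hdiff] with y hy
    have h := (hy.hasFDerivAt.comp z ((hasFDerivAt_id z).sub_const y)).const_smul (φ.normed μ y)
    rwa [ContinuousLinearMap.comp_id] at h

open scoped Convolution in
/-- Smooth approximation of a Lipschitz function and of its derivative. -/
theorem exists_smooth_approx {f : E → ℝ} {L : ℝ≥0} (hf : LipschitzWith L f) :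
    ∃ F : ℕ → E → ℝ, (∀ n, ContDiff ℝ ∞ (F n)) ∧ (∀ n z, |F n z - f z| ≤ L) ∧
      (∀ z, Tendsto (fun n => F n z) atTop (𝓝 (f z))) ∧ (∀ n z, ‖fderiv ℝ (F n) z‖ ≤ L) ∧
      ∀ᵐ z ∂μ, Tendsto (fun n => fderiv ℝ (F n) z) atTop (𝓝 (fderiv ℝ f z)) := by
  -- The outer radius tends to 0 with a fixed ratio 2 to the inner one, which the Lebesgue
  -- differentiation argument for the derivatives requires.
  let φ : ℕ → ContDiffBump (0 : E) := fun n =>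
    ⟨1 / (n + 1) / 2, 1 / (n + 1), by positivity, by
      have : (0 : ℝ) < 1 / (n + 1) := by positivity
      linarith⟩
  have hout : Tendsto (fun n => (φ n).rOut) atTop (𝓝 0) := tendsto_one_div_add_atTop_nhds_zero_nat
  let F : ℕ → E → ℝ := fun n => (φ n).normed μ ⋆[ContinuousLinearMap.lsmul ℝ ℝ, μ] f
  have hbound : ∀ z, ‖fderiv ℝ f z‖ ≤ L := fun z => norm_fderiv_le_of_lipschitz ℝ hf
  have hder : ∀ n z, fderiv ℝ (F n) z =
      ((φ n).normed μ ⋆[ContinuousLinearMap.lsmul ℝ ℝ, μ] fderiv ℝ f) z := fun n z =>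
    (hasFDerivAt_convolution_lipschitz μ hf (φ n) z).fderiv
  refine ⟨F, fun n => ?_, fun n z => ?_, fun z => ?_, fun n z => ?_, ?_⟩
  · exact (φ n).hasCompactSupport_normed.contDiff_convolution_left _ (φ n).contDiff_normed
      hf.continuous.locallyIntegrable
  · rw [← Real.dist_eq]
    refine (φ n).dist_normed_convolution_le hf.continuous.aestronglyMeasurable fun x hx => ?_
    refine (hf.dist_le_mul x z).trans ?_
    have h1 : dist x z < 1 / (n + 1) := hx
    have h2 : (1 : ℝ) / (n + 1) ≤ 1 := by
      rw [div_le_one (by positivity)]; linarith [(Nat.cast_nonneg n : (0 : ℝ) ≤ n)]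
    calc (L : ℝ) * dist x z ≤ L * 1 := by gcongr; linarith
      _ = L := mul_one _
  · exact ContDiffBump.convolution_tendsto_right_of_continuous hout hf.continuous z
  · rw [hder, convolution_def]
    refine (norm_integral_le_of_norm_le (g := fun y => (φ n).normed μ y * L)
      ((φ n).integrable_normed.mul_const _) (Eventually.of_forall fun y => ?_)).trans ?_
    · rw [ContinuousLinearMap.lsmul_apply, norm_smul, Real.norm_of_nonneg ((φ n).nonneg_normed y)]
      exact mul_le_mul_of_nonneg_left (hbound _) ((φ n).nonneg_normed y)
    · rw [integral_mul_const, (φ n).integral_normed, one_mul]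
  · have hloc : LocallyIntegrable (fderiv ℝ f) μ := by
      intro x
      refine ⟨Metric.closedBall x 1, Metric.closedBall_mem_nhds x one_pos, ?_⟩
      refine Measure.integrableOn_of_bounded (M := L)
        (isCompact_closedBall x 1).measure_lt_top.ne
        (measurable_fderiv ℝ f).aestronglyMeasurable (Eventually.of_forall hbound)
    filter_upwards [ContDiffBump.ae_convolution_tendsto_right_of_locallyIntegrable (K := 2) hout
      (Eventually.of_forall fun n => by simp only [φ]; linarith) hloc] with z hz
    simpa only [hder] using hz

/-- Integration by parts of a Lipschitz function against a test function. -/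
theorem integral_fderiv_mul_test {f : E → ℝ} {L : ℝ≥0} (hf : LipschitzWith L f) {η : E → ℝ}
    (hη : ContDiff ℝ ∞ η) (hc : HasCompactSupport η) (v : E) :
    ∫ z, fderiv ℝ f z v * η z ∂μ = -∫ z, f z * fderiv ℝ η z v ∂μ := by
  obtain ⟨D, hD⟩ := hη.lipschitzWith_of_hasCompactSupport hc (by simp)
  have key := hf.integral_lineDeriv_mul_eq (μ := μ) hD hc v
  rw [← integral_neg]
  refine Eq.trans (integral_congr_ae ?_) (key.trans (integral_congr_ae ?_))
  · filter_upwards [hf.ae_differentiableAt (μ := μ)] with z hz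
    rw [hz.lineDeriv_eq_fderiv]
  · refine Eventually.of_forall fun z => ?_
    simp only
    rw [(hη.differentiable (by simp) z).lineDeriv_eq_fderiv, map_neg]
    ring

end Mollification

instance isAddHaarMeasure_volume_spaceTime {d : ℕ} :
    (volume : Measure (ℝ × Vec d)).IsAddHaarMeasure :=
  inferInstanceAs ((volume : Measure ℝ).prod (volume : Measure (Vec d))).IsAddHaarMeasure

/-- The distributional gradient and the Rademacher gradient satisfy the same integration by parts
against functions supported in the cylinder, and there f agrees with Ψ. -/
theorem ae_eq_fderiv_of_isWeakSpaceGrad {d : ℕ} {T : ℝ} {Ω : Set (Vec d)} (hΩ : IsOpen Ω)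
    {Ψ f : ℝ × Vec d → ℝ} {G : ℝ × Vec d → Vec d} (hG : IsWeakSpaceGrad T Ω Ψ G)
    (hGb : LocallyIntegrableOn G (Ioo 0 T ×ˢ Ω)) {L : ℝ≥0} (hf : LipschitzWith L f)
    (hfΨ : ∀ z ∈ Ioo 0 T ×ˢ Ω, f z = Ψ z) (i : Fin d) :
    ∀ᵐ z ∂(volume.restrict (Ioo 0 T ×ˢ Ω)),
      G z i = fderiv ℝ f z (0, EuclideanSpace.single i 1) := by
  have hU : IsOpen (Ioo 0 T ×ˢ Ω) := isOpen_Ioo.prod hΩ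
  set v : ℝ × Vec d := (0, EuclideanSpace.single i 1)
  have hGi : LocallyIntegrableOn (fun z => G z i) (Ioo 0 T ×ˢ Ω) := by
    intro z hz
    obtain ⟨s, hs, hi⟩ := hGb z hz
    exact ⟨s, hs, (EuclideanSpace.proj (𝕜 := ℝ) i).integrable_comp hi⟩
  have hfd : LocallyIntegrable (fun z => fderiv ℝ f z v) := by
    intro z
    refine ⟨Metric.closedBall z 1, Metric.closedBall_mem_nhds z one_pos, ?_⟩
    refine Measure.integrableOn_of_bounded (M := L * ‖v‖)
      (isCompact_closedBall z 1).measure_lt_top.ne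
      (measurable_fderiv_apply_const ℝ f v).aestronglyMeasurable (Eventually.of_forall fun y => ?_)
    exact (ContinuousLinearMap.le_opNorm _ _).trans
      (by gcongr; exact norm_fderiv_le_of_lipschitz ℝ hf)
  have key := hU.ae_eq_zero_of_integral_contDiff_smul_eq_zero (μ := volume)
    (f := fun z => G z i - fderiv ℝ f z v) (hGi.sub (hfd.locallyIntegrableOn _)) ?_
  · rw [ae_restrict_iff' hU.measurableSet]
    filter_upwards [key] with z hz h
    exact sub_eq_zero.1 (hz h)
  intro η h1 h2 h3
  have e1 := hG η ⟨h1, h2, h3⟩ i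
  have e2 := integral_fderiv_mul_test volume hf h1 h2 v
  have hz : ∀ z, z ∉ Ioo 0 T ×ˢ Ω → η z = 0 := fun z hz =>
    image_eq_zero_of_notMem_tsupport fun h => hz (h3 h)
  have hz' : ∀ z, z ∉ Ioo 0 T ×ˢ Ω → fderiv ℝ η z v = 0 := fun z hz => by
    rw [image_eq_zero_of_notMem_tsupport (f := fderiv ℝ η)
      fun h => hz (h3 (tsupport_fderiv_subset ℝ h))]; rfl
  -- G is controlled only locally inside the cylinder, so integrability is checked on the compact
  -- support of η.
  have i1 : Integrable (fun z => η z * G z i) := by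
    have : IntegrableOn (fun z => G z i) (tsupport η) := hGi.integrableOn_compact_subset h3 h2
    rw [← integrableOn_iff_integrable_of_support_subset (s := tsupport η)
      (fun z hz => subset_tsupport η fun h => hz (by simp [h]))]
    obtain ⟨C, hC⟩ := h2.exists_bound_of_continuous h1.continuous
    exact this.bdd_mul h1.continuous.aestronglyMeasurable (Eventually.of_forall hC)
  have i2 : Integrable (fun z => η z * fderiv ℝ f z v) :=
    hfd.integrable_smul_left_of_hasCompactSupport h1.continuous h2
  simp_rw [smul_eq_mul, mul_sub]
  rw [integral_sub i1 i2, sub_eq_zero]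
  have e3 : ∫ z in Ioo 0 T ×ˢ Ω, Ψ z * fderiv ℝ η z v = ∫ z, f z * fderiv ℝ η z v := by
    rw [← setIntegral_eq_integral_of_forall_compl_eq_zero (s := Ioo 0 T ×ˢ Ω) (μ := volume)
      (f := fun z => f z * fderiv ℝ η z v) (fun z hz => by rw [hz' z hz, mul_zero])]
    exact setIntegral_congr_fun hU.measurableSet fun z hz => by simp only [hfΨ z hz]
  have e4 : ∫ z in Ioo 0 T ×ˢ Ω, G z i * η z = ∫ z, η z * G z i := by
    rw [setIntegral_eq_integral_of_forall_compl_eq_zero (fun z h => by rw [hz z h, mul_zero])]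
    simp_rw [mul_comm]
  rw [e3, e4] at e1
  simp_rw [mul_comm (η _) (fderiv ℝ f _ _)]
  linarith

/-! ### Multiplication operators on L² -/

section Multiplication

variable {α Y : Type*} [MeasurableSpace α] {μ : Measure α}
  [NormedAddCommGroup Y] [InnerProductSpace ℝ Y]

open Classical in
/-- Multiplication of an `L²` function by an essentially bounded scalar function. -/
def mulOp (μ : Measure α) (Y : Type*) [NormedAddCommGroup Y] [InnerProductSpace ℝ Y] (a : α → ℝ) :
    Lp Y 2 μ →L[ℝ] Lp Y 2 μ :=
  if h : MemLp a ∞ μ then (ContinuousLinearMap.lsmul ℝ ℝ).holderL μ ∞ 2 2 (h.toLp a) else 0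

theorem coeFn_mulOp {a : α → ℝ} (ha : MemLp a ∞ μ) (f : Lp Y 2 μ) :
    mulOp μ Y a f =ᵐ[μ] fun x => a x • f x := by
  rw [mulOp, dif_pos ha, ContinuousLinearMap.holderL_apply_apply]
  filter_upwards [ContinuousLinearMap.coeFn_holder (r := 2) (ContinuousLinearMap.lsmul ℝ ℝ)
    (ha.toLp a) f, ha.coeFn_toLp] with x h1 h2
  rw [h1, h2, ContinuousLinearMap.lsmul_apply]

theorem norm_mulOp_sub_le {a b : α → ℝ} (ha : MemLp a ∞ μ) (hb : MemLp b ∞ μ) {C : ℝ}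
    (hC : 0 ≤ C) (h : ∀ᵐ x ∂μ, |a x - b x| ≤ C) : ‖mulOp μ Y a - mulOp μ Y b‖ ≤ C := by
  refine ContinuousLinearMap.opNorm_le_bound _ hC fun f => Lp.norm_le_mul_norm_of_ae_le_mul ?_
  rw [sub_apply]
  filter_upwards [coeFn_mulOp ha f, coeFn_mulOp hb f, h,
    Lp.coeFn_sub (mulOp μ Y a f) (mulOp μ Y b f)] with x h1 h2 h3 h4
  rw [h4, Pi.sub_apply, h1, h2, ← sub_smul, norm_smul, Real.norm_eq_abs]
  gcongr

theorem norm_mulOp_apply_le {a : α → ℝ} (ha : AEStronglyMeasurable a μ) {C : ℝ}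
    (h : ∀ᵐ x ∂μ, |a x| ≤ C) (f : Lp Y 2 μ) : ‖mulOp μ Y a f‖ ≤ C * ‖f‖ := by
  refine Lp.norm_le_mul_norm_of_ae_le_mul ?_
  filter_upwards [coeFn_mulOp (memLp_top_of_bound ha C h) f, h] with x h1 h3
  rw [h1, norm_smul, Real.norm_eq_abs]
  gcongr

theorem lp_norm_sq_eq_integral (f : Lp Y 2 μ) : ‖f‖ ^ 2 = ∫ x, ‖f x‖ ^ 2 ∂μ := by
  rw [← real_inner_self_eq_norm_sq, L2.inner_def]
  simp_rw [real_inner_self_eq_norm_sq]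

theorem integrable_norm_sq_lp {Y : Type*} [NormedAddCommGroup Y] (f : Lp Y 2 μ) :
    Integrable (fun x => ‖f x‖ ^ 2) μ :=
  (memLp_two_iff_integrable_sq_norm (Lp.aestronglyMeasurable f)).1 (Lp.memLp f)

/-- Dominated convergence for |aₙ - b|²‖f‖². The convergence is strong, not in operator norm; this
is all that almost everywhere convergence of mollified derivatives can give. -/
theorem tendsto_mulOp_apply {a : ℕ → α → ℝ} {b : α → ℝ} {C : ℝ}
    (ha : ∀ n, AEStronglyMeasurable (a n) μ) (haC : ∀ n, ∀ᵐ x ∂μ, |a n x| ≤ C)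
    (hlim : ∀ᵐ x ∂μ, Tendsto (fun n => a n x) atTop (𝓝 (b x))) (f : Lp Y 2 μ) :
    Tendsto (fun n => mulOp μ Y (a n) f) atTop (𝓝 (mulOp μ Y b f)) := by
  have hb : AEStronglyMeasurable b μ := aestronglyMeasurable_of_tendsto_ae atTop ha hlim
  have hall : ∀ᵐ x ∂μ, ∀ n, |a n x| ≤ C := ae_all_iff.2 haC
  have hbC : ∀ᵐ x ∂μ, |b x| ≤ C := by
    filter_upwards [hall, hlim] with x h1 h2
    exact le_of_tendsto h2.abs (Eventually.of_forall h1)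
  have hma := fun n => memLp_top_of_bound (ha n) C (haC n)
  have hmb := memLp_top_of_bound hb C hbC
  rw [tendsto_iff_norm_sub_tendsto_zero]
  have hsq : Tendsto (fun n => ‖mulOp μ Y (a n) f - mulOp μ Y b f‖ ^ 2) atTop (𝓝 0) := by
    simp_rw [lp_norm_sq_eq_integral]
    have e : ∀ n, ∫ x, ‖(mulOp μ Y (a n) f - mulOp μ Y b f : Lp Y 2 μ) x‖ ^ 2 ∂μ =
        ∫ x, |a n x - b x| ^ 2 * ‖f x‖ ^ 2 ∂μ := fun n => by
      refine integral_congr_ae ?_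
      filter_upwards [coeFn_mulOp (hma n) f, coeFn_mulOp hmb f,
        Lp.coeFn_sub (mulOp μ Y (a n) f) (mulOp μ Y b f)] with x h1 h2 h4
      rw [h4, Pi.sub_apply, h1, h2, ← sub_smul, norm_smul, Real.norm_eq_abs, mul_pow]
    simp_rw [e]
    rw [show (0 : ℝ) = ∫ x : α, (0 : ℝ) ∂μ by simp]
    refine tendsto_integral_of_dominated_convergence (fun x => (2 * C) ^ 2 * ‖f x‖ ^ 2)
      (fun n => ?_) ((integrable_norm_sq_lp f).const_mul _) (fun n => ?_) ?_
    · exact (((ha n).sub hb).norm.pow 2).mul ((Lp.aestronglyMeasurable f).norm.pow 2)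
    · filter_upwards [hall, hbC] with x h1 h2
      rw [Real.norm_of_nonneg (by positivity)]
      gcongr
      exact (abs_sub _ _).trans (by linarith [h1 n])
    · filter_upwards [hlim] with x hx
      have := ((hx.sub_const (b x)).abs.pow 2).mul_const (‖f x‖ ^ 2)
      simpa using this
  have := (hsq.sqrt)
  simpa [Real.sqrt_sq (norm_nonneg _)] using this

variable [IsFiniteMeasure μ]

/-- The integral as a functional on `L²`. -/
def integralL2 (μ : Measure α) [IsFiniteMeasure μ] : Lp ℝ 2 μ →L[ℝ] ℝ :=
  innerSL ℝ (indicatorConstLp 2 MeasurableSet.univ (measure_ne_top μ univ) (1 : ℝ))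

theorem integralL2_apply (f : Lp ℝ 2 μ) : integralL2 μ f = ∫ x, f x ∂μ := by
  rw [integralL2, innerSL_apply_apply, L2.inner_indicatorConstLp_one, setIntegral_univ]

theorem integralL2_mulOp {a : α → ℝ} (ha : MemLp a ∞ μ) (f : Lp ℝ 2 μ) :
    integralL2 μ (mulOp μ ℝ a f) = ∫ x, a x * f x ∂μ := by
  rw [integralL2_apply]
  exact integral_congr_ae (coeFn_mulOp ha f)

end Multiplication

theorem continuous_clm_of_norm_sub_le {V W : Type*}
    [NormedAddCommGroup V] [NormedSpace ℝ V] [NormedAddCommGroup W] [NormedSpace ℝ W]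
    {M : Type*} [PseudoMetricSpace M] {A : ℝ → V →L[ℝ] W} {m : ℝ → M} (hm : Continuous m)
    (h : ∀ s t, ‖A s - A t‖ ≤ dist (m s) (m t)) : Continuous A :=
  continuous_iff_continuousAt.2 fun t => tendsto_iff_norm_sub_tendsto_zero.2 <|
    squeeze_zero (fun _ => norm_nonneg _) (fun s => h s t)
      (tendsto_iff_dist_tendsto_zero.1 (hm.tendsto t))

theorem aestronglyMeasurable_clm_apply {V W : Type*} {μ : Measure ℝ}
    [NormedAddCommGroup V] [NormedSpace ℝ V] [NormedAddCommGroup W] [NormedSpace ℝ W]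
    {A : ℝ → V →L[ℝ] W} {f : ℝ → V} (hA : Continuous A)
    (hf : AEStronglyMeasurable f μ) : AEStronglyMeasurable (fun t => A t (f t)) μ :=
  isBoundedBilinearMap_apply.continuous.comp_aestronglyMeasurable
    (hA.aestronglyMeasurable.prodMk hf)

theorem integrableOn_clm_apply {V W : Type*} [NormedAddCommGroup V] [NormedSpace ℝ V]
    [NormedAddCommGroup W] [NormedSpace ℝ W] (A : V →L[ℝ] W) {f : ℝ → V} {s : Set ℝ}
    (hf : IntegrableOn f s) : IntegrableOn (fun t => A (f t)) s :=
  A.integrable_comp hf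

/-! ### Time-dependent multiplication operators -/

section SpaceTimeMultiplication

variable {d : ℕ} {Ω : Set (Vec d)} {Y : Type*} [NormedAddCommGroup Y] [InnerProductSpace ℝ Y]

theorem isFiniteMeasure_restrict_of_isBounded (hΩ : Bornology.IsBounded Ω) :
    IsFiniteMeasure (volume.restrict Ω) :=
  ⟨by simpa using hΩ.measure_lt_top⟩

theorem memLp_top_of_continuous (hΩo : IsOpen Ω) (hΩ : Bornology.IsBounded Ω) {a : Vec d → ℝ}
    (ha : Continuous a) : MemLp a ∞ (volume.restrict Ω) := by
  obtain ⟨C, hC⟩ := hΩ.isCompact_closure.exists_bound_of_continuousOn ha.continuousOn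
  refine memLp_top_of_bound ha.aestronglyMeasurable C ?_
  filter_upwards [ae_restrict_mem hΩo.measurableSet] with x hx
  exact hC x (subset_closure hx)

/-- Multiplication by the time slice at `t` of a function on space-time. -/
def sliceOp (Ω : Set (Vec d)) (Y : Type*) [NormedAddCommGroup Y] [InnerProductSpace ℝ Y]
    (a : ℝ × Vec d → ℝ) (t : ℝ) : Lp Y 2 (volume.restrict Ω) →L[ℝ] Lp Y 2 (volume.restrict Ω) :=
  mulOp (volume.restrict Ω) Y (fun x => a (t, x))

/-- A continuous function on space-time is a continuous curve in C(closure Ω), by currying and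
compactness, and the operator norm is dominated by the supremum norm. -/
theorem continuous_sliceOp (hΩo : IsOpen Ω) (hΩ : Bornology.IsBounded Ω) {a : ℝ × Vec d → ℝ}
    (ha : Continuous a) : Continuous (sliceOp Ω Y a) := by
  have : CompactSpace (closure Ω) := isCompact_iff_compactSpace.1 hΩ.isCompact_closure
  let A : C(ℝ, C(closure Ω, ℝ)) := ContinuousMap.curry
    ⟨fun p : ℝ × closure Ω => a (p.1, p.2), by fun_prop⟩
  have hm : ∀ t, MemLp (fun x => a (t, x)) ∞ (volume.restrict Ω) := fun t =>
    memLp_top_of_continuous hΩo hΩ (by fun_prop)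
  refine continuous_clm_of_norm_sub_le A.continuous fun s t =>
    norm_mulOp_sub_le (hm s) (hm t) dist_nonneg ?_
  filter_upwards [ae_restrict_mem hΩo.measurableSet] with x hx
  rw [← Real.dist_eq]
  exact ContinuousMap.dist_apply_le_dist (f := A s) (g := A t) ⟨x, subset_closure hx⟩

variable {T C : ℝ} {a : ℕ → ℝ × Vec d → ℝ} {b : ℝ × Vec d → ℝ}
  {F : ℝ → Lp Y 2 (volume.restrict Ω)}

theorem aestronglyMeasurable_sliceOp_of_continuous (hΩo : IsOpen Ω) (hΩ : Bornology.IsBounded Ω)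
    {a : ℝ × Vec d → ℝ} (ha : Continuous a)
    (hF : AEStronglyMeasurable F (volume.restrict (Ioo 0 T))) :
    AEStronglyMeasurable (fun t => sliceOp Ω Y a t (F t)) (volume.restrict (Ioo 0 T)) :=
  aestronglyMeasurable_clm_apply (continuous_sliceOp hΩo hΩ ha) hF

theorem ae_slice_of_ae {p : ℝ × Vec d → Prop}
    (h : ∀ᵐ z ∂(volume.restrict (Ioo 0 T ×ˢ Ω)), p z) :
    ∀ᵐ t ∂(volume.restrict (Ioo 0 T)), ∀ᵐ x ∂(volume.restrict Ω), p (t, x) := by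
  rw [Measure.volume_eq_prod, ← Measure.prod_restrict] at h
  exact Measure.ae_ae_of_ae_prod h

theorem ae_tendsto_sliceOp (hΩo : IsOpen Ω) (ha : ∀ n, Continuous (a n))
    (haC : ∀ n, ∀ t ∈ Ioo 0 T, ∀ x ∈ Ω, |a n (t, x)| ≤ C)
    (hlim : ∀ᵐ z ∂(volume.restrict (Ioo 0 T ×ˢ Ω)), Tendsto (fun n => a n z) atTop (𝓝 (b z))) :
    ∀ᵐ t ∂(volume.restrict (Ioo 0 T)), ∀ f : Lp Y 2 (volume.restrict Ω),
      Tendsto (fun n => sliceOp Ω Y (a n) t f) atTop (𝓝 (sliceOp Ω Y b t f)) := by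
  filter_upwards [ae_slice_of_ae hlim, ae_restrict_mem measurableSet_Ioo] with t h1 h2 f
  refine tendsto_mulOp_apply (C := C) (fun n => ?_) (fun n => ?_) h1 f
  · exact ((ha n).comp (by fun_prop)).aestronglyMeasurable
  · filter_upwards [ae_restrict_mem hΩo.measurableSet] with x hx
    exact haC n t h2 x hx

/-- For a discontinuous multiplier b the operators need not depend continuously on t, so
measurability of the product curve is inherited from continuous approximants. -/
theorem aestronglyMeasurable_sliceOp (hΩo : IsOpen Ω) (hΩ : Bornology.IsBounded Ω)
    (ha : ∀ n, Continuous (a n)) (haC : ∀ n, ∀ t ∈ Ioo 0 T, ∀ x ∈ Ω, |a n (t, x)| ≤ C)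
    (hlim : ∀ᵐ z ∂(volume.restrict (Ioo 0 T ×ˢ Ω)), Tendsto (fun n => a n z) atTop (𝓝 (b z)))
    (hF : AEStronglyMeasurable F (volume.restrict (Ioo 0 T))) :
    AEStronglyMeasurable (fun t => sliceOp Ω Y b t (F t)) (volume.restrict (Ioo 0 T)) :=
  aestronglyMeasurable_of_tendsto_ae atTop
    (fun n => aestronglyMeasurable_sliceOp_of_continuous hΩo hΩ (ha n) hF)
    ((ae_tendsto_sliceOp hΩo ha haC hlim).mono fun t ht => ht (F t))

theorem tendsto_integral_sliceOp (hΩo : IsOpen Ω) (hΩ : Bornology.IsBounded Ω)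
    (ha : ∀ n, Continuous (a n)) (haC : ∀ n, ∀ t ∈ Ioo 0 T, ∀ x ∈ Ω, |a n (t, x)| ≤ C)
    (hlim : ∀ᵐ z ∂(volume.restrict (Ioo 0 T ×ˢ Ω)), Tendsto (fun n => a n z) atTop (𝓝 (b z)))
    (hF : IntegrableOn F (Ioo 0 T)) (l : Lp Y 2 (volume.restrict Ω) →L[ℝ] ℝ) :
    Tendsto (fun n => ∫ t in Ioo 0 T, l (sliceOp Ω Y (a n) t (F t))) atTop
      (𝓝 (∫ t in Ioo 0 T, l (sliceOp Ω Y b t (F t)))) := by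
  refine tendsto_integral_of_dominated_convergence (fun t => ‖l‖ * (C * ‖F t‖))
    (fun n => l.continuous.comp_aestronglyMeasurable
      (aestronglyMeasurable_sliceOp_of_continuous hΩo hΩ (ha n) hF.aestronglyMeasurable))
    ((hF.norm.const_mul C).const_mul _) (fun n => ?_)
    ((ae_tendsto_sliceOp hΩo ha haC hlim).mono fun t ht => (l.continuous.tendsto _).comp (ht (F t)))
  filter_upwards [ae_restrict_mem measurableSet_Ioo] with t ht
  refine l.le_opNorm_of_le
    (norm_mulOp_apply_le ((ha n).comp (by fun_prop)).aestronglyMeasurable ?_ _)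
  filter_upwards [ae_restrict_mem hΩo.measurableSet] with x hx
  exact haC n t ht x hx

end SpaceTimeMultiplication

section MultiplicationAlgebra

variable {α Y Y' : Type*} [MeasurableSpace α] {μ : Measure α}
  [NormedAddCommGroup Y] [InnerProductSpace ℝ Y] [NormedAddCommGroup Y'] [InnerProductSpace ℝ Y']

theorem mulOp_mulOp {a b : α → ℝ} (ha : MemLp a ∞ μ) (hb : MemLp b ∞ μ) (f : Lp Y 2 μ) :
    mulOp μ Y a (mulOp μ Y b f) = mulOp μ Y (fun x => a x * b x) f := by
  refine Lp.ext ?_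
  filter_upwards [coeFn_mulOp ha (mulOp μ Y b f), coeFn_mulOp hb f,
    coeFn_mulOp (show MemLp (fun x => a x * b x) ∞ μ from hb.mul ha) f] with x h1 h2 h3
  rw [h1, h2, h3, mul_smul]

theorem mulOp_add {a b : α → ℝ} (ha : MemLp a ∞ μ) (hb : MemLp b ∞ μ) (f : Lp Y 2 μ) :
    mulOp μ Y (fun x => a x + b x) f = mulOp μ Y a f + mulOp μ Y b f := by
  refine Lp.ext ?_
  filter_upwards [coeFn_mulOp ha f, coeFn_mulOp hb f,
    coeFn_mulOp (show MemLp (fun x => a x + b x) ∞ μ from ha.add hb) f,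
    Lp.coeFn_add (mulOp μ Y a f) (mulOp μ Y b f)] with x h1 h2 h3 h4
  rw [h4, Pi.add_apply, h1, h2, h3, add_smul]

theorem mulOp_const_mul {a : α → ℝ} (c : ℝ) (ha : MemLp a ∞ μ) (f : Lp Y 2 μ) :
    mulOp μ Y (fun x => c * a x) f = c • mulOp μ Y a f := by
  refine Lp.ext ?_
  filter_upwards [coeFn_mulOp ha f, coeFn_mulOp (show MemLp (fun x => c * a x) ∞ μ from
    ha.const_mul c) f, Lp.coeFn_smul c (mulOp μ Y a f)] with x h1 h2 h3
  rw [h3, Pi.smul_apply, h1, h2, mul_smul]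

theorem compLpL_mulOp (l : Y →L[ℝ] Y') {a : α → ℝ} (ha : MemLp a ∞ μ) (f : Lp Y 2 μ) :
    l.compLpL 2 μ (mulOp μ Y a f) = mulOp μ Y' a (l.compLpL 2 μ f) := by
  refine Lp.ext ?_
  filter_upwards [coeFn_mulOp ha f, coeFn_mulOp ha (l.compLpL 2 μ f), l.coeFn_compLpL f,
    l.coeFn_compLpL (mulOp μ Y a f)] with x h1 h2 h3 h4
  rw [h4, h1, h2, h3, map_smul]

theorem inner_mulOp_left {a : α → ℝ} (ha : MemLp a ∞ μ) (f g : Lp Y 2 μ) :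
    inner ℝ (mulOp μ Y a f) g = inner ℝ f (mulOp μ Y a g) := by
  rw [L2.inner_def, L2.inner_def]
  refine integral_congr_ae ?_
  filter_upwards [coeFn_mulOp ha f, coeFn_mulOp ha g] with x h1 h2
  rw [h1, h2, real_inner_smul_left, real_inner_smul_right]

end MultiplicationAlgebra

/-! ### Integration by parts in time and functional form of the symmetrized gradient -/

section TestFunctions

variable {d : ℕ} {Ω : Set (Vec d)}

theorem continuous_fderiv_const {g : ℝ × Vec d → ℝ} (hg : ContDiff ℝ ∞ g) (v : ℝ × Vec d) :
    Continuous fun z => fderiv ℝ g z v :=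
  (hg.continuous_fderiv (by simp)).clm_apply continuous_const

theorem contDiff_fderiv_const {g : ℝ × Vec d → ℝ} (hg : ContDiff ℝ ∞ g) (v : ℝ × Vec d) :
    ContDiff ℝ ∞ fun z => fderiv ℝ g z v :=
  (hg.fderiv_right (by simp)).clm_apply contDiff_const

theorem fderiv_fderiv_comm {g : ℝ × Vec d → ℝ} (hg : ContDiff ℝ ∞ g) (v w z : ℝ × Vec d) :
    fderiv ℝ (fun y => fderiv ℝ g y v) z w = fderiv ℝ (fun y => fderiv ℝ g y w) z v := by
  have hd : DifferentiableAt ℝ (fderiv ℝ g) z :=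
    (hg.fderiv_right (m := ∞) (by simp)).differentiable (by simp) z
  have e : ∀ v w : ℝ × Vec d, fderiv ℝ (fun y => fderiv ℝ g y v) z w =
      fderiv ℝ (fderiv ℝ g) z w v := fun v w => by
    rw [fderiv_clm_apply hd (differentiableAt_const v)]
    simp
  rw [e, e]
  exact (hg.contDiffAt.isSymmSndFDerivAt (by
    rw [minSmoothness_of_isRCLikeNormedField]; exact WithTop.coe_le_coe.2 le_top)).eq w v

variable [IsFiniteMeasure (volume.restrict Ω)]

/-- Since u is a primitive that starts from 0, g has to vanish only at the final time. Fubini in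
time reduces the claim to the integral of ∂ₜg over (r, T). -/
theorem integral_sliceOp_primitive (hΩo : IsOpen Ω) (hΩ : Bornology.IsBounded Ω) {T : ℝ}
    {k u : ℝ → Lp ℝ 2 (volume.restrict Ω)} (hk : IntegrableOn k (Ioo 0 T))
    (hu : ∀ᵐ t ∂(volume.restrict (Ioo 0 T)), u t = ∫ r in Ioo 0 t, k r)
    {g : ℝ × Vec d → ℝ} (hg : ContDiff ℝ ∞ g) (hgT : ∀ x, g (T, x) = 0) :
    ∫ t in Ioo 0 T, integralL2 _ (sliceOp Ω ℝ (fun z => fderiv ℝ g z (1, 0)) t (u t)) =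
      -∫ t in Ioo 0 T, integralL2 _ (sliceOp Ω ℝ g t (k t)) := by
  set one : Lp ℝ 2 (volume.restrict Ω) :=
    indicatorConstLp 2 MeasurableSet.univ (measure_ne_top _ univ) (1 : ℝ)
  set gt : ℝ × Vec d → ℝ := fun z => fderiv ℝ g z (1, 0)
  have hgt : Continuous gt := continuous_fderiv_const hg (1, 0)
  have hmg : ∀ t, MemLp (fun x => g (t, x)) ∞ (volume.restrict Ω) := fun t =>
    memLp_top_of_continuous hΩo hΩ (hg.continuous.comp (by fun_prop))
  have hmgt : ∀ t, MemLp (fun x => gt (t, x)) ∞ (volume.restrict Ω) := fun t =>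
    memLp_top_of_continuous hΩo hΩ (hgt.comp (by fun_prop))
  have hJ : ∀ {a : Vec d → ℝ} (_ : MemLp a ∞ (volume.restrict Ω)) (h : Lp ℝ 2 (volume.restrict Ω)),
      integralL2 _ (mulOp _ ℝ a h) = inner ℝ h (mulOp _ ℝ a one) := fun ha h => by
    rw [← inner_mulOp_left ha, real_inner_comm]; rfl
  have hycont : Continuous fun t => sliceOp Ω ℝ gt t one := by
    have := continuous_sliceOp (Y := ℝ) hΩo hΩ hgt
    fun_prop
  have hy : ∀ a b : ℝ, IntegrableOn (fun t => sliceOp Ω ℝ gt t one) (Ioo a b) := fun a b =>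
    (hycont.integrableOn_Icc).mono_set Ioo_subset_Icc_self
  have key := integral_bilin_primitive (innerSL ℝ) hk (hy 0 T)
  -- This identity in L² is checked weakly: pair with h, exchange the integrals, and apply the
  -- fundamental theorem of calculus for each x.
  have hprim : ∀ r ∈ Ioo 0 T, ∫ t in Ioo r T, sliceOp Ω ℝ gt t one = -sliceOp Ω ℝ g r one := by
    intro r hr
    refine ext_inner_left ℝ fun h => ?_
    rw [inner_neg_right, sliceOp, ← hJ (hmg r), integralL2_mulOp (hmg r),
      ← integral_inner (hy r T)]
    have e : ∀ t, inner ℝ h (sliceOp Ω ℝ gt t one) = ∫ x in Ω, gt (t, x) * h x := fun t => by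
      rw [← integralL2_mulOp (hmgt t), hJ (hmgt t)]; rfl
    simp_rw [e]
    have hh : Integrable h (volume.restrict Ω) := (Lp.memLp h).integrable (by norm_num)
    obtain ⟨C, hC⟩ := (isCompact_Icc.prod hΩ.isCompact_closure).exists_bound_of_continuousOn
      (s := Icc r T ×ˢ closure Ω) hgt.continuousOn
    have hint : Integrable (Function.uncurry fun t x => gt (t, x) * h x)
        ((volume.restrict (Ioo r T)).prod (volume.restrict Ω)) := by
      have h1 : Integrable (fun z : ℝ × Vec d => (1 : ℝ) * h z.2)
          ((volume.restrict (Ioo r T)).prod (volume.restrict Ω)) :=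
        Integrable.mul_prod (integrable_const _) hh
      simp only [one_mul] at h1
      refine Integrable.bdd_mul (c := C) h1 hgt.aestronglyMeasurable ?_
      rw [Measure.prod_restrict]
      filter_upwards [ae_restrict_mem (measurableSet_Ioo.prod hΩo.measurableSet)] with z hz
      exact hC z ⟨Ioo_subset_Icc_self hz.1, subset_closure hz.2⟩
    rw [integral_integral_swap hint, ← integral_neg]
    refine integral_congr_ae (Eventually.of_forall fun x => ?_)
    simp only
    rw [integral_mul_const, ← integral_Ioc_eq_integral_Ioo,
      ← intervalIntegral.integral_of_le hr.2.le]
    have hder : ∀ t, HasDerivAt (fun t => g (t, x)) (gt (t, x)) t := fun t => by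
      have h1 := ((hg.differentiable (by simp)) (t, x)).hasFDerivAt
      have h2 : HasDerivAt (fun s : ℝ => (s, x)) ((1 : ℝ), (0 : Vec d)) t :=
        (hasDerivAt_id t).prodMk (hasDerivAt_const t x)
      exact h1.comp_hasDerivAt t h2
    rw [intervalIntegral.integral_eq_sub_of_hasDerivAt (fun t _ => hder t)
      ((hgt.comp (by fun_prop)).intervalIntegrable _ _), hgT x]
    ring
  have e1 : ∫ t in Ioo 0 T, integralL2 _ (sliceOp Ω ℝ gt t (u t)) =
      ∫ t in Ioo 0 T, innerSL ℝ (∫ r in Ioo 0 t, k r) (sliceOp Ω ℝ gt t one) := by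
    refine integral_congr_ae ?_
    filter_upwards [hu] with t ht
    rw [ht]
    exact hJ (hmgt t) _
  rw [e1, key, ← integral_neg]
  refine setIntegral_congr_fun measurableSet_Ioo fun r hr => ?_
  rw [hprim r hr, map_neg, innerSL_apply_apply]
  exact congrArg Neg.neg (hJ (hmg r) _).symm

/-- The `i`-th component of a vector field in `L²`. -/
def compVec (Ω : Set (Vec d)) (i : Fin d) : L2Vec Ω →L[ℝ] Lp ℝ 2 (volume.restrict Ω) :=
  (EuclideanSpace.proj (𝕜 := ℝ) i).compLpL 2 _

/-- The `(i, j)` component of a field of symmetric matrices in `L²`. -/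
def compSym (Ω : Set (Vec d)) (i j : Fin d) : L2Sym Ω →L[ℝ] Lp ℝ 2 (volume.restrict Ω) :=
  (entry i j).compLpL 2 _

/-- Rewriting the definition through bounded functionals on L² makes closedness, limits and time
integration immediate. -/
theorem isSymGrad_iff_integralL2 {K : Set (Vec d)} {v : L2Vec Ω} {e : L2Sym Ω}
    (hΩo : IsOpen Ω) (hΩ : Bornology.IsBounded Ω) : IsSymGrad Ω K v e ↔
    ∀ η : Vec d → ℝ, ContDiff ℝ ∞ η → HasCompactSupport η → tsupport η ⊆ Ω \ K → ∀ i j : Fin d,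
      integralL2 _ (mulOp _ ℝ η (compSym Ω i j e)) =
      -((1 / 2) * (integralL2 _ (mulOp _ ℝ (partialX j η) (compVec Ω i v)) +
        integralL2 _ (mulOp _ ℝ (partialX i η) (compVec Ω j v)))) := by
  refine forall_congr' fun η => forall_congr' fun h1 => forall_congr' fun h2 =>
    forall_congr' fun h3 => forall_congr' fun i => forall_congr' fun j => ?_
  have hm := memLp_top_of_continuous hΩo hΩ h1.continuous
  have hmd : ∀ i, MemLp (partialX i η) ∞ (volume.restrict Ω) := fun i =>
    memLp_top_of_continuous hΩo hΩ (continuous_partialX i h1)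
  rw [← map_add, integralL2_mulOp hm, integralL2_apply, ← integral_const_mul]
  refine Eq.congr (integral_congr_ae ?_) (congrArg Neg.neg (integral_congr_ae ?_))
  · filter_upwards [(entry i j).coeFn_compLpL (𝕜 := ℝ) e] with x hx
    rw [compSym, hx]
    rfl
  · filter_upwards [Lp.coeFn_add (mulOp _ ℝ (partialX j η) (compVec Ω i v))
      (mulOp _ ℝ (partialX i η) (compVec Ω j v)), coeFn_mulOp (hmd j) (compVec Ω i v),
      coeFn_mulOp (hmd i) (compVec Ω j v),
      (EuclideanSpace.proj (𝕜 := ℝ) i).coeFn_compLpL v,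
      (EuclideanSpace.proj (𝕜 := ℝ) j).coeFn_compLpL v] with x h4 h5 h6 h7 h8
    rw [h4, Pi.add_apply, h5, h6, compVec, compVec, h7, h8]
    rfl

theorem IsSymGrad.integralL2_eq {K : Set (Vec d)} {v : L2Vec Ω} {e : L2Sym Ω}
    (h : IsSymGrad Ω K v e) (hΩo : IsOpen Ω) (hΩ : Bornology.IsBounded Ω)
    {η : Vec d → ℝ} (h1 : ContDiff ℝ ∞ η) (h2 : HasCompactSupport η)
    (h3 : tsupport η ⊆ Ω \ K) (i j : Fin d) :
    integralL2 _ (mulOp _ ℝ η (compSym Ω i j e)) =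
      -((1 / 2) * (integralL2 _ (mulOp _ ℝ (partialX j η) (compVec Ω i v)) +
        integralL2 _ (mulOp _ ℝ (partialX i η) (compVec Ω j v)))) :=
  (isSymGrad_iff_integralL2 hΩo hΩ).1 h η h1 h2 h3 i j

end TestFunctions

/-! ### Bounded multipliers approximable by continuous ones -/

section Multipliers

variable {d : ℕ} {Ω : Set (Vec d)} {Y : Type*} [NormedAddCommGroup Y] [InnerProductSpace ℝ Y]

/-- A bounded function on space-time that is an almost everywhere limit of uniformly bounded
continuous functions. -/
structure IsMultiplier (T : ℝ) (Ω : Set (Vec d)) (a : ℝ × Vec d → ℝ) (C : ℝ) : Prop where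
  measurable : Measurable a
  bound : ∀ t ∈ Ioo 0 T, ∀ x ∈ Ω, |a (t, x)| ≤ C
  approx : ∃ b : ℕ → ℝ × Vec d → ℝ, (∀ n, Continuous (b n)) ∧
    (∀ n, ∀ t ∈ Ioo 0 T, ∀ x ∈ Ω, |b n (t, x)| ≤ C) ∧
    ∀ᵐ z ∂(volume.restrict (Ioo 0 T ×ˢ Ω)), Tendsto (fun n => b n z) atTop (𝓝 (a z))

theorem exists_isMultiplier_of_continuous (T : ℝ) (hΩ : Bornology.IsBounded Ω)
    {a : ℝ × Vec d → ℝ} (ha : Continuous a) : ∃ C, IsMultiplier T Ω a C := by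
  obtain ⟨C, hC⟩ := (isCompact_Icc.prod hΩ.isCompact_closure).exists_bound_of_continuousOn
    (s := Icc 0 T ×ˢ closure Ω) ha.continuousOn
  have hb : ∀ t ∈ Ioo 0 T, ∀ x ∈ Ω, |a (t, x)| ≤ C := fun t ht x hx =>
    hC (t, x) ⟨Ioo_subset_Icc_self ht, subset_closure hx⟩
  exact ⟨C, ha.measurable, hb, fun _ => a, fun _ => ha, fun _ => hb,
    Eventually.of_forall fun _ => tendsto_const_nhds⟩

/-- The partial derivatives of a Lipschitz function are the reason for this class: they may be
discontinuous, but mollification approximates them almost everywhere with the same bound. -/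
theorem isMultiplier_fderiv (T : ℝ) (Ω : Set (Vec d)) {f : ℝ × Vec d → ℝ} {L : ℝ≥0}
    (hf : LipschitzWith L f) (v : ℝ × Vec d) :
    IsMultiplier T Ω (fun z => fderiv ℝ f z v) (L * ‖v‖) := by
  obtain ⟨F, h1, -, -, h4, h5⟩ := exists_smooth_approx volume hf
  refine ⟨measurable_fderiv_apply_const ℝ f v, fun t _ x _ => ?_,
    fun n z => fderiv ℝ (F n) z v, fun n => continuous_fderiv_const (h1 n) v,
    fun n t _ x _ => ?_, ?_⟩
  · exact ContinuousLinearMap.le_of_opNorm_le _ (norm_fderiv_le_of_lipschitz ℝ hf) v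
  · exact ContinuousLinearMap.le_of_opNorm_le _ (h4 n _) v
  · filter_upwards [ae_restrict_of_ae h5] with z hz
    exact ((ContinuousLinearMap.apply ℝ ℝ v).continuous.tendsto _).comp hz

namespace IsMultiplier

variable {T C : ℝ} {a : ℝ × Vec d → ℝ} {F : ℝ → Lp Y 2 (volume.restrict Ω)}

theorem memLp_slice (h : IsMultiplier T Ω a C) (hΩo : IsOpen Ω) {t : ℝ} (ht : t ∈ Ioo 0 T) :
    MemLp (fun x => a (t, x)) ∞ (volume.restrict Ω) := by
  refine memLp_top_of_bound (h.measurable.comp (by fun_prop)).aestronglyMeasurable C ?_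
  filter_upwards [ae_restrict_mem hΩo.measurableSet] with x hx
  exact h.bound t ht x hx

theorem norm_apply_le (h : IsMultiplier T Ω a C) (hΩo : IsOpen Ω) {t : ℝ} (ht : t ∈ Ioo 0 T)
    (f : Lp Y 2 (volume.restrict Ω)) : ‖sliceOp Ω Y a t f‖ ≤ C * ‖f‖ := by
  refine norm_mulOp_apply_le (h.measurable.comp (by fun_prop)).aestronglyMeasurable ?_ f
  filter_upwards [ae_restrict_mem hΩo.measurableSet] with x hx
  exact h.bound t ht x hx

theorem memLp_curve (h : IsMultiplier T Ω a C) (hΩo : IsOpen Ω) (hΩ : Bornology.IsBounded Ω)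
    {p : ℝ≥0∞} (hF : MemLp F p (volume.restrict (Ioo 0 T))) :
    MemLp (fun t => sliceOp Ω Y a t (F t)) p (volume.restrict (Ioo 0 T)) := by
  obtain ⟨b, h1, h2, h3⟩ := h.approx
  refine hF.of_le_mul (c := C)
    (aestronglyMeasurable_sliceOp hΩo hΩ h1 h2 h3 hF.aestronglyMeasurable) ?_
  filter_upwards [ae_restrict_mem measurableSet_Ioo] with t ht
  exact h.norm_apply_le hΩo ht _

theorem integrableOn_curve (h : IsMultiplier T Ω a C) (hΩo : IsOpen Ω)
    (hΩ : Bornology.IsBounded Ω) (hF : IntegrableOn F (Ioo 0 T)) :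
    IntegrableOn (fun t => sliceOp Ω Y a t (F t)) (Ioo 0 T) :=
  memLp_one_iff_integrable.1 (h.memLp_curve hΩo hΩ (memLp_one_iff_integrable.2 hF))

end IsMultiplier
end Multipliers

/-! ### Commuting the time derivative with the symmetrized gradient -/

section SymmetricGradient

variable {d : ℕ} {Ω : Set (Vec d)}

theorem slice_fderiv_eq_zero {g : ℝ × Vec d → ℝ} {A : Set (Vec d)} (hA : IsClosed A)
    (hg0 : ∀ z, z.2 ∉ A → g z = 0) (v : ℝ × Vec d) (t : ℝ) {x : Vec d} (hx : x ∉ A) :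
    fderiv ℝ g (t, x) v = 0 := by
  have : g =ᶠ[𝓝 (t, x)] fun _ => 0 := by
    filter_upwards [(hA.isOpen_compl.preimage continuous_snd).mem_nhds hx] with z hz
    exact hg0 z hz
  rw [this.fderiv_eq]
  simp

theorem partialX_slice {g : ℝ × Vec d → ℝ} (hg : ContDiff ℝ ∞ g) (i : Fin d) (t : ℝ) (x : Vec d) :
    partialX i (fun x => g (t, x)) x = fderiv ℝ g (t, x) (0, EuclideanSpace.single i 1) := by
  have h1 := ((hg.differentiable (by simp)) (t, x)).hasFDerivAt
  have h2 : HasFDerivAt (fun y : Vec d => (t, y)) (ContinuousLinearMap.inr ℝ ℝ (Vec d)) x :=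
    (hasFDerivAt_const t x).prodMk (hasFDerivAt_id x)
  have h3 : HasFDerivAt (fun x => g (t, x)) _ x := h1.comp x h2
  rw [partialX, h3.fderiv]
  simp

variable [IsFiniteMeasure (volume.restrict Ω)]

/-- The identity `∂ₜ(E v) = E(∂ₜ v)`, tested with a smooth function on space-time. -/
theorem integral_sliceOp_symGrad (hΩo : IsOpen Ω) (hΩ : Bornology.IsBounded Ω) {T : ℝ}
    {K A : Set (Vec d)} (hA : IsCompact A) (hAK : A ⊆ Ω \ K) {v ψ : ℝ → L2Vec Ω} {e : ℝ → L2Sym Ω}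
    (hψ : IntegrableOn ψ (Ioo 0 T))
    (hv : ∀ᵐ t ∂(volume.restrict (Ioo 0 T)), v t = ∫ r in Ioo 0 t, ψ r)
    (he : ∀ᵐ t ∂(volume.restrict (Ioo 0 T)), IsSymGrad Ω K (v t) (e t))
    {g : ℝ × Vec d → ℝ} (hg : ContDiff ℝ ∞ g) (hg0 : ∀ z, z.2 ∉ A → g z = 0)
    (hgT : ∀ x, g (T, x) = 0) {gt : ℝ × Vec d → ℝ} (hgt' : ∀ z, fderiv ℝ g z (1, 0) = gt z)
    {gx : Fin d → ℝ × Vec d → ℝ}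
    (hgx' : ∀ i z, fderiv ℝ g z (0, EuclideanSpace.single i 1) = gx i z) (i j : Fin d) :
    ∫ t in Ioo 0 T, integralL2 _ (sliceOp Ω ℝ gt t (compSym Ω i j (e t))) =
      (1 / 2) * ((∫ t in Ioo 0 T, integralL2 _ (sliceOp Ω ℝ (gx j) t (compVec Ω i (ψ t)))) +
        ∫ t in Ioo 0 T, integralL2 _ (sliceOp Ω ℝ (gx i) t (compVec Ω j (ψ t)))) := by
  obtain rfl : gt = fun z => fderiv ℝ g z (1, 0) := funext fun z => (hgt' z).symm
  obtain rfl : gx = fun i z => fderiv ℝ g z (0, EuclideanSpace.single i 1) :=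
    funext fun i => funext fun z => (hgx' i z).symm
  let gt : ℝ × Vec d → ℝ := fun z => fderiv ℝ g z (1, 0)
  let gx : Fin d → ℝ × Vec d → ℝ := fun i z => fderiv ℝ g z (0, EuclideanSpace.single i 1)
  have hgt : ContDiff ℝ ∞ gt := contDiff_fderiv_const hg _
  let gx : Fin d → ℝ × Vec d → ℝ := fun j z => fderiv ℝ g z (0, EuclideanSpace.single j 1)
  have hgx : ∀ j, ContDiff ℝ ∞ (gx j) := fun j => contDiff_fderiv_const hg _
  have hgxT : ∀ j x, gx j (T, x) = 0 := fun j x => by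
    simp only [gx]
    rw [← partialX_slice hg j T x, partialX]
    simp [hgT]
  -- A component is a bounded functional of the field, so it passes through the Bochner integral and
  -- each v_i is the primitive of ψ_i.
  have hvi : ∀ i, ∀ᵐ t ∂(volume.restrict (Ioo 0 T)),
      compVec Ω i (v t) = ∫ r in Ioo 0 t, compVec Ω i (ψ r) := fun i => by
    filter_upwards [hv, ae_restrict_mem measurableSet_Ioo] with t ht h
    rw [ht]
    exact ((compVec Ω i).integral_comp_comm
      (hψ.mono_set (Ioo_subset_Ioo_right h.2.le))).symm
  have hψi : ∀ i, IntegrableOn (fun t => compVec Ω i (ψ t)) (Ioo 0 T) := fun i =>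
    integrableOn_clm_apply (compVec Ω i) hψ
  have hvint : ∀ i, IntegrableOn (fun t => compVec Ω i (v t)) (Ioo 0 T) := fun i =>
    (((continuousOn_primitive_Ioo (hψi i)).integrableOn_Icc (μ := volume)).mono_set
      Ioo_subset_Icc_self).congr ((hvi i).mono fun _ h => h.symm)
  have hib : ∀ i j, ∫ t in Ioo 0 T, integralL2 _ (sliceOp Ω ℝ
      (fun z => fderiv ℝ (gx j) z (1, 0)) t (compVec Ω i (v t))) =
      -∫ t in Ioo 0 T, integralL2 _ (sliceOp Ω ℝ (gx j) t (compVec Ω i (ψ t))) := fun i j =>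
    integral_sliceOp_primitive hΩo hΩ (hψi i) (hvi i) (hgx j) (hgxT j)
  have hI : ∀ i j, IntegrableOn (fun t => integralL2 _ (sliceOp Ω ℝ
      (fun z => fderiv ℝ (gx j) z (1, 0)) t (compVec Ω i (v t)))) (Ioo 0 T) := fun i j => by
    obtain ⟨C, hC⟩ := exists_isMultiplier_of_continuous T hΩ
      (continuous_fderiv_const (hgx j) (1, 0))
    exact integrableOn_clm_apply (integralL2 (volume.restrict Ω))
      (hC.integrableOn_curve hΩo hΩ (hvint i))
  have e1 : ∫ t in Ioo 0 T, integralL2 _ (sliceOp Ω ℝ gt t (compSym Ω i j (e t))) =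
      ∫ t in Ioo 0 T, -((1 / 2) * (integralL2 _ (sliceOp Ω ℝ
        (fun z => fderiv ℝ (gx j) z (1, 0)) t (compVec Ω i (v t))) +
        integralL2 _ (sliceOp Ω ℝ
        (fun z => fderiv ℝ (gx i) z (1, 0)) t (compVec Ω j (v t))))) := by
    refine integral_congr_ae ?_
    filter_upwards [he] with t ht
    have hz : ∀ x, x ∉ A → gt (t, x) = 0 := fun x hx =>
      slice_fderiv_eq_zero hA.isClosed hg0 _ t hx
    have hts : tsupport (fun x => gt (t, x)) ⊆ A :=
      closure_minimal (fun x hx => by_contra fun h => hx (hz x h)) hA.isClosed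
    -- At almost every fixed time the slice of ∂ₜg is an admissible spatial test function. Its
    -- spatial derivatives are then rewritten as ∂ₜ of those of g, ready for integration by parts in
    -- time.
    have := ht.integralL2_eq hΩo hΩ (η := fun x => gt (t, x)) (hgt.comp (by fun_prop))
      (HasCompactSupport.of_support_subset_isCompact hA ((subset_tsupport _).trans hts))
      (hts.trans hAK) i j
    have hp : ∀ i, partialX i (fun x => gt (t, x)) =
        fun x => fderiv ℝ (gx i) (t, x) (1, 0) := fun i => funext fun x => by
      rw [partialX_slice hgt i t x]
      exact fderiv_fderiv_comm hg _ _ _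
    rw [hp, hp] at this
    exact this
  have e2 : ∀ a b c : ℝ, c = -((1 / 2) * (-a + -b)) → c = (1 / 2) * (a + b) := fun a b c h => by
    rw [h]; ring
  refine e1.trans (e2 _ _ _ ?_)
  rw [integral_neg, integral_const_mul, integral_add (hI i j) (hI j i), hib, hib]

end SymmetricGradient

/-! ### Test functions weighted by the square of a Lipschitz function -/

section ProductTest

variable {d : ℕ} {Ω : Set (Vec d)}

/-- The derivative in the direction `v` of `θ(t) η(x) F(t, x)²`, if `D` is that of `F`. -/
def prodTestDeriv (θ : ℝ → ℝ) (η : Vec d → ℝ) (v : ℝ × Vec d) (F D : ℝ × Vec d → ℝ)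
    (z : ℝ × Vec d) : ℝ :=
  (v.1 * deriv θ z.1 * η z.2 + θ z.1 * fderiv ℝ η z.2 v.2) * (F z * F z) +
    2 * (θ z.1 * η z.2) * (F z * D z)

theorem fderiv_prodTest {θ : ℝ → ℝ} {η : Vec d → ℝ} (hθ : ContDiff ℝ ∞ θ) (hη : ContDiff ℝ ∞ η)
    {F : ℝ × Vec d → ℝ} (hF : ContDiff ℝ ∞ F) (v z : ℝ × Vec d) :
    fderiv ℝ (fun z : ℝ × Vec d => θ z.1 * η z.2 * (F z * F z)) z v =
      prodTestDeriv θ η v F (fun z => fderiv ℝ F z v) z := by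
  have h1 : HasFDerivAt (fun z : ℝ × Vec d => θ z.1) _ z :=
    ((hθ.differentiable (by simp) z.1).hasDerivAt.hasFDerivAt).comp z hasFDerivAt_fst
  have h2 : HasFDerivAt (fun z : ℝ × Vec d => η z.2) _ z :=
    ((hη.differentiable (by simp) z.2).hasFDerivAt).comp z hasFDerivAt_snd
  have h3 := (hF.differentiable (by simp) z).hasFDerivAt
  have h4 : HasFDerivAt (fun z : ℝ × Vec d => θ z.1 * η z.2 * (F z * F z)) _ z :=
    (h1.mul h2).mul (h3.mul h3)
  rw [h4.fderiv, prodTestDeriv]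
  simp
  ring

variable {Y : Type*} [NormedAddCommGroup Y] [InnerProductSpace ℝ Y]

/-- The mollified functions are bounded on the bounded cylinder by M + L and their derivatives by L,
uniformly in n, so the product derivatives converge almost everywhere under one common bound. -/
theorem tendsto_integral_prodTest (hΩo : IsOpen Ω) (hΩ : Bornology.IsBounded Ω) {T : ℝ}
    {θ : ℝ → ℝ} {η : Vec d → ℝ} (hθ : ContDiff ℝ ∞ θ) (hη : ContDiff ℝ ∞ η)
    {f : ℝ × Vec d → ℝ} {L : ℝ≥0} (hfc : Continuous f) {F : ℕ → ℝ × Vec d → ℝ}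
    (hF : ∀ n, ContDiff ℝ ∞ (F n)) (hFL : ∀ n z, |F n z - f z| ≤ L)
    (hFlim : ∀ z, Tendsto (fun n => F n z) atTop (𝓝 (f z))) (hDL : ∀ n z, ‖fderiv ℝ (F n) z‖ ≤ L)
    (hDlim : ∀ᵐ z, Tendsto (fun n => fderiv ℝ (F n) z) atTop (𝓝 (fderiv ℝ f z)))
    (v : ℝ × Vec d) {G : ℝ → Lp Y 2 (volume.restrict Ω)} (hG : IntegrableOn G (Ioo 0 T))
    (l : Lp Y 2 (volume.restrict Ω) →L[ℝ] ℝ) :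
    Tendsto (fun n => ∫ t in Ioo 0 T, l (sliceOp Ω Y
        (prodTestDeriv θ η v (F n) (fun z => fderiv ℝ (F n) z v)) t (G t))) atTop
      (𝓝 (∫ t in Ioo 0 T, l (sliceOp Ω Y
        (prodTestDeriv θ η v f (fun z => fderiv ℝ f z v)) t (G t)))) := by
  have hc1 : Continuous fun z : ℝ × Vec d =>
      v.1 * deriv θ z.1 * η z.2 + θ z.1 * fderiv ℝ η z.2 v.2 := by
    have i1 := hθ.continuous_deriv (by simp)
    have i2 := hθ.continuous
    have i3 := hη.continuous
    have i4 := hη.continuous_fderiv (by simp)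
    fun_prop
  have hc2 : Continuous fun z : ℝ × Vec d => 2 * (θ z.1 * η z.2) := by
    have i2 := hθ.continuous
    have i3 := hη.continuous
    fun_prop
  have hcomp := isCompact_Icc.prod hΩ.isCompact_closure (s := Icc 0 T)
  obtain ⟨C₁, h1⟩ := hcomp.exists_bound_of_continuousOn hc1.continuousOn
  obtain ⟨C₂, h2⟩ := hcomp.exists_bound_of_continuousOn hc2.continuousOn
  obtain ⟨M, h3⟩ := hcomp.exists_bound_of_continuousOn hfc.continuousOn
  refine tendsto_integral_sliceOp hΩo hΩ
    (C := C₁ * ((M + L) * (M + L)) + C₂ * ((M + L) * (L * ‖v‖)))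
    (fun n => ?_) (fun n t ht x hx => ?_) ?_ hG l
  · have i1 := (hF n).continuous
    have i2 := continuous_fderiv_const (hF n) v
    exact (hc1.mul (i1.mul i1)).add (hc2.mul (i1.mul i2))
  · have hz : (t, x) ∈ Icc 0 T ×ˢ closure Ω := ⟨Ioo_subset_Icc_self ht, subset_closure hx⟩
    have hFM : |F n (t, x)| ≤ M + L := by
      have := abs_sub_abs_le_abs_sub (F n (t, x)) (f (t, x))
      have h5 := hFL n (t, x)
      have h6 : |f (t, x)| ≤ M := h3 _ hz
      linarith
    have hD : |fderiv ℝ (F n) (t, x) v| ≤ L * ‖v‖ :=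
      ContinuousLinearMap.le_of_opNorm_le _ (hDL n _) v
    refine (abs_add_le _ _).trans ?_
    rw [abs_mul, abs_mul, abs_mul, abs_mul (F n (t, x))]
    have i1 := h1 _ hz
    have i2 := h2 _ hz
    rw [Real.norm_eq_abs] at i1 i2
    gcongr
    · exact (abs_nonneg _).trans i1
    · exact (abs_nonneg _).trans hFM
    · exact (abs_nonneg _).trans i2
    · exact (abs_nonneg _).trans hFM
  · filter_upwards [ae_restrict_of_ae hDlim] with z hz
    have := ((ContinuousLinearMap.apply ℝ ℝ v).continuous.tendsto _).comp hz
    exact ((hFlim z).mul (hFlim z)).const_mul _ |>.add (((hFlim z).mul this).const_mul _)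

variable [IsFiniteMeasure (volume.restrict Ω)]

/-- The identity `∂ₜ(E v) = E(∂ₜ v)`, tested with `θ(t) η(x) f(t, x)²`, where `f` is Lipschitz. -/
theorem integral_prodTest_symGrad (hΩo : IsOpen Ω) (hΩ : Bornology.IsBounded Ω) {T : ℝ}
    {K : Set (Vec d)} {v ψ : ℝ → L2Vec Ω} {e : ℝ → L2Sym Ω}
    (hψ : IntegrableOn ψ (Ioo 0 T))
    (hv : ∀ᵐ t ∂(volume.restrict (Ioo 0 T)), v t = ∫ r in Ioo 0 t, ψ r)
    (he : ∀ᵐ t ∂(volume.restrict (Ioo 0 T)), IsSymGrad Ω K (v t) (e t))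
    (hei : IntegrableOn e (Ioo 0 T))
    {f : ℝ × Vec d → ℝ} {L : ℝ≥0} (hf : LipschitzWith L f)
    {θ : ℝ → ℝ} (hθ : ContDiff ℝ ∞ θ) (hθT : θ T = 0) {η : Vec d → ℝ} (hη : ContDiff ℝ ∞ η)
    (hηc : HasCompactSupport η) (hηs : tsupport η ⊆ Ω \ K) (i j : Fin d) :
    ∫ t in Ioo 0 T, integralL2 _ (sliceOp Ω ℝ
        (prodTestDeriv θ η (1, 0) f (fun z => fderiv ℝ f z (1, 0))) t (compSym Ω i j (e t))) =
      (1 / 2) * ((∫ t in Ioo 0 T, integralL2 _ (sliceOp Ω ℝ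
          (prodTestDeriv θ η (0, EuclideanSpace.single j 1) f
            (fun z => fderiv ℝ f z (0, EuclideanSpace.single j 1))) t (compVec Ω i (ψ t)))) +
        ∫ t in Ioo 0 T, integralL2 _ (sliceOp Ω ℝ
          (prodTestDeriv θ η (0, EuclideanSpace.single i 1) f
            (fun z => fderiv ℝ f z (0, EuclideanSpace.single i 1))) t (compVec Ω j (ψ t)))) := by
  obtain ⟨F, h1, h2, h3, h4, h5⟩ := exists_smooth_approx volume hf
  have lim := fun (w : ℝ × Vec d) (G : ℝ → Lp ℝ 2 (volume.restrict Ω))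
    (hG : IntegrableOn G (Ioo 0 T) volume) => tendsto_integral_prodTest (Y := ℝ) hΩo hΩ hθ hη
      hf.continuous h1 h2 h3
      h4 h5 w hG (integralL2 _)
  have hl := lim (1, 0) _ (integrableOn_clm_apply (compSym Ω i j) hei)
  have hr := ((lim (0, EuclideanSpace.single j 1) _ (integrableOn_clm_apply (compVec Ω i) hψ)).add
    (lim (0, EuclideanSpace.single i 1) _
      (integrableOn_clm_apply (compVec Ω j) hψ))).const_mul (1 / 2)
  -- Both sides are limits of the identity for smooth approximants, where the product θηFₙ² is a
  -- genuine smooth test function.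
  refine tendsto_nhds_unique (hl.congr fun n => ?_) hr
  exact integral_sliceOp_symGrad hΩo hΩ hηc.isCompact hηs hψ hv he
    (g := fun z => θ z.1 * η z.2 * (F n z * F n z))
    (((hθ.comp contDiff_fst).mul (hη.comp contDiff_snd)).mul ((h1 n).mul (h1 n)))
    (fun z hz => by rw [image_eq_zero_of_notMem_tsupport hz]; ring)
    (fun x => by rw [hθT]; ring) (fderiv_prodTest hθ hη (h1 n) _)
    (fun i => fderiv_prodTest hθ hη (h1 n) (0, EuclideanSpace.single i 1)) i j

end ProductTest

/-! ### Products and sums of multipliers -/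

section MultiplierAlgebra

variable {d : ℕ} {Ω : Set (Vec d)} {T C C' : ℝ} {a b : ℝ × Vec d → ℝ}

theorem IsMultiplier.mul (ha : IsMultiplier T Ω a C) (hb : IsMultiplier T Ω b C') :
    IsMultiplier T Ω (fun z => a z * b z) (C * C') := by
  have key : ∀ {x y : ℝ}, |x| ≤ C → |y| ≤ C' → |x * y| ≤ C * C' := fun {x y} hx hy => by
    rw [abs_mul]
    exact mul_le_mul hx hy (abs_nonneg _) ((abs_nonneg _).trans hx)
  obtain ⟨u, u1, u2, u3⟩ := ha.approx
  obtain ⟨v, v1, v2, v3⟩ := hb.approx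
  refine ⟨ha.measurable.mul hb.measurable, fun t ht x hx => key (ha.bound t ht x hx)
    (hb.bound t ht x hx), fun n z => u n z * v n z, fun n => (u1 n).mul (v1 n),
    fun n t ht x hx => key (u2 n t ht x hx) (v2 n t ht x hx), ?_⟩
  filter_upwards [u3, v3] with z h1 h2 using h1.mul h2

theorem IsMultiplier.add (ha : IsMultiplier T Ω a C) (hb : IsMultiplier T Ω b C') :
    IsMultiplier T Ω (fun z => a z + b z) (C + C') := by
  have key : ∀ {x y : ℝ}, |x| ≤ C → |y| ≤ C' → |x + y| ≤ C + C' := fun {x y} hx hy =>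
    (abs_add_le _ _).trans (add_le_add hx hy)
  obtain ⟨u, u1, u2, u3⟩ := ha.approx
  obtain ⟨v, v1, v2, v3⟩ := hb.approx
  refine ⟨ha.measurable.add hb.measurable, fun t ht x hx => key (ha.bound t ht x hx)
    (hb.bound t ht x hx), fun n z => u n z + v n z, fun n => (u1 n).add (v1 n),
    fun n t ht x hx => key (u2 n t ht x hx) (v2 n t ht x hx), ?_⟩
  filter_upwards [u3, v3] with z h1 h2 using h1.add h2

theorem exists_isMultiplier_prodTestDeriv (T : ℝ) (hΩ : Bornology.IsBounded Ω) {θ : ℝ → ℝ}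
    {η : Vec d → ℝ} (hθ : ContDiff ℝ ∞ θ) (hη : ContDiff ℝ ∞ η) {f : ℝ × Vec d → ℝ} {L : ℝ≥0}
    (hf : LipschitzWith L f) (v : ℝ × Vec d) :
    ∃ C, IsMultiplier T Ω (prodTestDeriv θ η v f (fun z => fderiv ℝ f z v)) C := by
  have i1 := hθ.continuous_deriv (by simp)
  have i2 := hθ.continuous
  have i3 := hη.continuous
  have i4 := hη.continuous_fderiv (by simp)
  obtain ⟨C₁, h1⟩ := exists_isMultiplier_of_continuous (a := fun z : ℝ × Vec d =>
    v.1 * deriv θ z.1 * η z.2 + θ z.1 * fderiv ℝ η z.2 v.2) T hΩ (by fun_prop)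
  obtain ⟨C₂, h2⟩ := exists_isMultiplier_of_continuous (a := fun z : ℝ × Vec d =>
    2 * (θ z.1 * η z.2)) T hΩ (by fun_prop)
  obtain ⟨C₃, h3⟩ := exists_isMultiplier_of_continuous T hΩ hf.continuous
  exact ⟨_, (h1.mul (h3.mul h3)).add (h2.mul (h3.mul (isMultiplier_fderiv T Ω hf v)))⟩

theorem mulOp_comm {α Y : Type*} [MeasurableSpace α] {μ : Measure α} [NormedAddCommGroup Y]
    [InnerProductSpace ℝ Y] {a b : α → ℝ} (ha : MemLp a ∞ μ) (hb : MemLp b ∞ μ) (f : Lp Y 2 μ) :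
    mulOp μ Y a (mulOp μ Y b f) = mulOp μ Y b (mulOp μ Y a f) := by
  rw [mulOp_mulOp ha hb, mulOp_mulOp hb ha]
  simp_rw [mul_comm]

/-- The product rule at operator level. It separates the derivative of θ, that of η and that of f,
so that the terms can be matched with those of the equation for E q. -/
theorem sliceOp_prodTestDeriv (hΩo : IsOpen Ω) (hΩ : Bornology.IsBounded Ω) {θ : ℝ → ℝ}
    {η : Vec d → ℝ} (hη : ContDiff ℝ ∞ η) {f : ℝ × Vec d → ℝ} {L : ℝ≥0} (hf : LipschitzWith L f)
    (v : ℝ × Vec d) {t : ℝ} (ht : t ∈ Ioo 0 T) (G : Lp ℝ 2 (volume.restrict Ω)) :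
    sliceOp Ω ℝ (prodTestDeriv θ η v f (fun z => fderiv ℝ f z v)) t G =
      (v.1 * deriv θ t) • mulOp _ ℝ η (sliceOp Ω ℝ f t (sliceOp Ω ℝ f t G)) +
      θ t • mulOp _ ℝ (fun x => fderiv ℝ η x v.2) (sliceOp Ω ℝ f t (sliceOp Ω ℝ f t G)) +
      (2 * θ t) • mulOp _ ℝ η (sliceOp Ω ℝ f t (sliceOp Ω ℝ (fun z => fderiv ℝ f z v) t G)) := by
  have m1 := memLp_top_of_continuous hΩo hΩ hη.continuous
  have m2 : MemLp (fun x => fderiv ℝ η x v.2) ∞ (volume.restrict Ω) :=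
    memLp_top_of_continuous hΩo hΩ ((hη.continuous_fderiv (by simp)).clm_apply continuous_const)
  have m3 : MemLp (fun x => f (t, x)) ∞ (volume.restrict Ω) :=
    memLp_top_of_continuous hΩo hΩ (hf.continuous.comp (by fun_prop))
  have m4 := (isMultiplier_fderiv T Ω hf v).memLp_slice hΩo ht
  have m33 : MemLp (fun x => f (t, x) * f (t, x)) ∞ (volume.restrict Ω) := m3.mul m3
  have m34 : MemLp (fun x => f (t, x) * fderiv ℝ f (t, x) v) ∞ (volume.restrict Ω) := m4.mul m3
  have c : ∀ {a : Vec d → ℝ} (r : ℝ), MemLp a ∞ (volume.restrict Ω) →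
      MemLp (fun x => r * a x) ∞ (volume.restrict Ω) := fun r h => h.const_mul r
  have n1 : MemLp (fun x => η x * (f (t, x) * f (t, x))) ∞ (volume.restrict Ω) := m33.mul m1
  have n2 : MemLp (fun x => fderiv ℝ η x v.2 * (f (t, x) * f (t, x))) ∞ (volume.restrict Ω) :=
    m33.mul m2
  have n3 : MemLp (fun x => η x * (f (t, x) * fderiv ℝ f (t, x) v)) ∞ (volume.restrict Ω) :=
    m34.mul m1
  simp only [sliceOp]
  rw [mulOp_mulOp m3 m3, mulOp_mulOp m3 m4, mulOp_mulOp m1 m33, mulOp_mulOp m2 m33,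
    mulOp_mulOp m1 m34, ← mulOp_const_mul _ n1, ← mulOp_const_mul _ n2, ← mulOp_const_mul _ n3,
    ← mulOp_add (c _ n1) (c _ n2), ← mulOp_add (show MemLp (fun x => _ + _) ∞ _ from
      (c _ n1).add (c _ n2)) (c _ n3)]
  congr 2
  funext x
  simp only [prodTestDeriv]
  ring

end MultiplierAlgebra

theorem memLp_clm_apply {V W : Type*} [NormedAddCommGroup V] [NormedSpace ℝ V]
    [NormedAddCommGroup W] [NormedSpace ℝ W] (A : V →L[ℝ] W) {f : ℝ → V} {μ : Measure ℝ} {p : ℝ≥0∞}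
    (hf : MemLp f p μ) : MemLp (fun t => A (f t)) p μ :=
  A.comp_memLp' hf

/-! ### The operator v ↦ ∇f ⊙ v -/

section SymmetrizedProduct

variable {d : ℕ} {Ω : Set (Vec d)}

/-- The spatial gradient of a function on space-time. -/
def gradField (f : ℝ × Vec d → ℝ) (z : ℝ × Vec d) : Vec d :=
  WithLp.toLp 2 fun i => fderiv ℝ f z (0, EuclideanSpace.single i 1)

/-- The map `b ↦ a ⊙ b`. -/
def symProdCLM (a : Vec d) : Vec d →L[ℝ] SymMat d :=
  LinearMap.toContinuousLinearMap
    { toFun := symProd a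
      map_add' := fun b c => by
        ext p
        simp [symProd]
        ring
      map_smul' := fun r b => by
        ext p
        simp [symProd]
        ring }

theorem symProdCLM_apply (a b : Vec d) : symProdCLM a b = symProd a b := rfl

theorem sum_smul_symProd_single (c a : Vec d) :
    ∑ i, c i • symProd (EuclideanSpace.single i 1) a = symProd c a := by
  ext p
  simp [symProd, mul_add, Finset.sum_add_distrib, PiLp.single_apply]
  ring

/-- The operator `v ↦ ∇f(t) ⊙ v`. -/
def symGradOp (Ω : Set (Vec d)) (f : ℝ × Vec d → ℝ) (t : ℝ) : L2Vec Ω →L[ℝ] L2Sym Ω :=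
  ∑ i, (sliceOp Ω (SymMat d) (fun z => fderiv ℝ f z (0, EuclideanSpace.single i 1)) t).comp
    ((symProdCLM (EuclideanSpace.single i 1)).compLpL 2 (volume.restrict Ω))

/-- Expanding over coordinate directions leaves only scalar multipliers, to which measurability and
boundedness of partial derivatives apply. -/
theorem symGradOp_apply (f : ℝ × Vec d → ℝ) (t : ℝ) (g : L2Vec Ω) :
    symGradOp Ω f t g = ∑ i, sliceOp Ω (SymMat d)
      (fun z => fderiv ℝ f z (0, EuclideanSpace.single i 1)) t
      ((symProdCLM (EuclideanSpace.single i 1)).compLpL 2 (volume.restrict Ω) g) := by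
  simp [symGradOp]

theorem coeFn_symGradOp (hΩo : IsOpen Ω) {T : ℝ} {f : ℝ × Vec d → ℝ} {L : ℝ≥0}
    (hf : LipschitzWith L f) {t : ℝ} (ht : t ∈ Ioo 0 T) (g : L2Vec Ω) :
    symGradOp Ω f t g =ᵐ[volume.restrict Ω] fun x => symProd (gradField f (t, x)) (g x) := by
  rw [symGradOp_apply]
  have h1 : ∀ᵐ x ∂(volume.restrict Ω), ∀ i : Fin d, (sliceOp Ω (SymMat d)
      (fun z => fderiv ℝ f z (0, EuclideanSpace.single i 1)) t
      ((symProdCLM (EuclideanSpace.single i 1)).compLpL 2 (volume.restrict Ω) g)) x =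
      fderiv ℝ f (t, x) (0, EuclideanSpace.single i 1) •
        symProd (EuclideanSpace.single i 1) (g x) := by
    refine ae_all_iff.2 fun i => ?_
    filter_upwards [coeFn_mulOp ((isMultiplier_fderiv T Ω hf
      (0, EuclideanSpace.single i 1)).memLp_slice hΩo ht)
      ((symProdCLM (EuclideanSpace.single i 1)).compLpL 2 (volume.restrict Ω) g),
      (symProdCLM (EuclideanSpace.single i 1)).coeFn_compLpL g] with x h2 h3
    rw [sliceOp, h2, h3, symProdCLM_apply]
  filter_upwards [h1, Lp.coeFn_fun_finsetSum (Finset.univ : Finset (Fin d)) (fun i =>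
    sliceOp Ω (SymMat d) (fun z => fderiv ℝ f z (0, EuclideanSpace.single i 1)) t
      ((symProdCLM (EuclideanSpace.single i 1)).compLpL 2 (volume.restrict Ω) g))] with x h2 h3
  rw [h3, ← sum_smul_symProd_single]
  exact Finset.sum_congr rfl fun i _ => h2 i

theorem memLp_symGradOp (hΩo : IsOpen Ω) (hΩ : Bornology.IsBounded Ω) {T : ℝ}
    {f : ℝ × Vec d → ℝ} {L : ℝ≥0} (hf : LipschitzWith L f) {p : ℝ≥0∞} {ψ : ℝ → L2Vec Ω}
    (hψ : MemLp ψ p (volume.restrict (Ioo 0 T))) :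
    MemLp (fun t => symGradOp Ω f t (ψ t)) p (volume.restrict (Ioo 0 T)) := by
  simp_rw [symGradOp_apply]
  refine memLp_finsetSum _ fun i _ => (isMultiplier_fderiv T Ω hf _).memLp_curve hΩo hΩ ?_
  exact memLp_clm_apply (W := L2Sym Ω)
    ((symProdCLM (EuclideanSpace.single i 1)).compLpL 2 (volume.restrict Ω)) hψ

theorem compSym_symGradOp (hΩo : IsOpen Ω) {T : ℝ} {f : ℝ × Vec d → ℝ} {L : ℝ≥0}
    (hf : LipschitzWith L f) {t : ℝ} (ht : t ∈ Ioo 0 T) (g : L2Vec Ω) (i j : Fin d) :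
    compSym Ω i j (symGradOp Ω f t g) = (1 / 2 : ℝ) •
      (sliceOp Ω ℝ (fun z => fderiv ℝ f z (0, EuclideanSpace.single j 1)) t (compVec Ω i g) +
        sliceOp Ω ℝ (fun z => fderiv ℝ f z (0, EuclideanSpace.single i 1)) t (compVec Ω j g)) := by
  have m := fun i => (isMultiplier_fderiv T Ω hf (0, EuclideanSpace.single i 1)).memLp_slice hΩo ht
  refine Lp.ext ?_
  set p := sliceOp Ω ℝ (fun z => fderiv ℝ f z (0, EuclideanSpace.single j 1)) t (compVec Ω i g)
  set q := sliceOp Ω ℝ (fun z => fderiv ℝ f z (0, EuclideanSpace.single i 1)) t (compVec Ω j g)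
  filter_upwards [(entry i j).coeFn_compLpL (symGradOp Ω f t g), coeFn_symGradOp hΩo hf ht g,
    Lp.coeFn_smul (1 / 2 : ℝ) (p + q), Lp.coeFn_add p q, coeFn_mulOp (m j) (compVec Ω i g),
    coeFn_mulOp (m i) (compVec Ω j g), (EuclideanSpace.proj (𝕜 := ℝ) i).coeFn_compLpL g,
    (EuclideanSpace.proj (𝕜 := ℝ) j).coeFn_compLpL g] with x h1 h2 h3 h4 h5 h6 h7 h8
  rw [compSym, h1, h2, h3, Pi.smul_apply, h4, Pi.add_apply]
  simp only [p, q, sliceOp]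
  rw [h5, h6, compVec, compVec, h7, h8]
  simp [entry, symProd, gradField]
  ring

end SymmetrizedProduct

/-! ### The weak time derivative of f² E v -/

section WeakDerivative

variable {d : ℕ} {Ω : Set (Vec d)} [IsFiniteMeasure (volume.restrict Ω)]

/-- The defining identity of the symmetrized gradient, tested with `η(x) f(t, x)`, where `f` is
Lipschitz. -/
theorem ae_isSymGrad_mul_lipschitz (hΩo : IsOpen Ω) (hΩ : Bornology.IsBounded Ω) (T : ℝ)
    (K : Set (Vec d)) {f : ℝ × Vec d → ℝ} {L : ℝ≥0} (hf : LipschitzWith L f) :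
    ∀ᵐ t ∂(volume.restrict (Ioo 0 T)), ∀ (v : L2Vec Ω) (e : L2Sym Ω), IsSymGrad Ω K v e →
      ∀ η : Vec d → ℝ, ContDiff ℝ ∞ η → HasCompactSupport η → tsupport η ⊆ Ω \ K →
      ∀ i j : Fin d, integralL2 _ (mulOp _ ℝ η (sliceOp Ω ℝ f t (compSym Ω i j e))) =
        -((1 / 2) * (integralL2 _ (mulOp _ ℝ (partialX j η) (sliceOp Ω ℝ f t (compVec Ω i v)) +
            mulOp _ ℝ η (sliceOp Ω ℝ
              (fun z => fderiv ℝ f z (0, EuclideanSpace.single j 1)) t (compVec Ω i v))) +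
          integralL2 _ (mulOp _ ℝ (partialX i η) (sliceOp Ω ℝ f t (compVec Ω j v)) +
            mulOp _ ℝ η (sliceOp Ω ℝ
              (fun z => fderiv ℝ f z (0, EuclideanSpace.single i 1)) t (compVec Ω j v))))) := by
  obtain ⟨F, h1, h2, h3, h4, h5⟩ := exists_smooth_approx volume hf
  obtain ⟨M, hM⟩ := (isCompact_Icc.prod hΩ.isCompact_closure).exists_bound_of_continuousOn
    (s := Icc 0 T ×ˢ closure Ω) hf.continuous.continuousOn
  have hFM : ∀ n, ∀ t ∈ Ioo 0 T, ∀ x ∈ Ω, |F n (t, x)| ≤ M + L := fun n t ht x hx => by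
    have i1 := abs_sub_abs_le_abs_sub (F n (t, x)) (f (t, x))
    have i2 := h2 n (t, x)
    have i3 : |f (t, x)| ≤ M := hM (t, x) ⟨Ioo_subset_Icc_self ht, subset_closure hx⟩
    linarith
  have hlim1 := ae_tendsto_sliceOp (Y := ℝ) hΩo (fun n => (h1 n).continuous) hFM
    (Eventually.of_forall h3)
  have hlim2 : ∀ i : Fin d, _ := fun i => ae_tendsto_sliceOp (Y := ℝ) (Ω := Ω) (T := T) hΩo
    (b := fun z => fderiv ℝ f z (0, EuclideanSpace.single i 1))
    (C := L * ‖((0 : ℝ), (EuclideanSpace.single i 1 : Vec d))‖)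
    (fun n => continuous_fderiv_const (h1 n) (0, EuclideanSpace.single i 1))
    (fun n t _ x _ => ContinuousLinearMap.le_of_opNorm_le _ (h4 n _) _) (by
      filter_upwards [ae_restrict_of_ae h5] with z hz
      exact ((ContinuousLinearMap.apply ℝ ℝ
        ((0 : ℝ), (EuclideanSpace.single i 1 : Vec d))).continuous.tendsto _).comp hz)
  filter_upwards [hlim1, ae_all_iff.2 hlim2] with t l1 l2 v e hve η g1 g2 g3 i j
  have m1 := memLp_top_of_continuous hΩo hΩ g1.continuous
  have m2 : ∀ i, MemLp (partialX i η) ∞ (volume.restrict Ω) := fun i =>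
    memLp_top_of_continuous hΩo hΩ (continuous_partialX i g1)
  have m3 : ∀ n, MemLp (fun x => F n (t, x)) ∞ (volume.restrict Ω) := fun n =>
    memLp_top_of_continuous hΩo hΩ ((h1 n).continuous.comp (by fun_prop))
  have m4 : ∀ n (i : Fin d), MemLp (fun x => fderiv ℝ (F n) (t, x) (0, EuclideanSpace.single i 1)) ∞
      (volume.restrict Ω) := fun n i =>
    memLp_top_of_continuous hΩo hΩ ((continuous_fderiv_const (h1 n) _).comp (by fun_prop))
  have hlhs := ((integralL2 _).continuous.tendsto _).comp
    (((mulOp _ ℝ η).continuous.tendsto _).comp (l1 (compSym Ω i j e)))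
  have hterm : ∀ i j, Tendsto (fun n => integralL2 (volume.restrict Ω)
      (mulOp _ ℝ (partialX j η) (sliceOp Ω ℝ (F n) t (compVec Ω i v)) +
        mulOp _ ℝ η (sliceOp Ω ℝ
          (fun z => fderiv ℝ (F n) z (0, EuclideanSpace.single j 1)) t (compVec Ω i v)))) atTop
      (𝓝 (integralL2 (volume.restrict Ω)
      (mulOp _ ℝ (partialX j η) (sliceOp Ω ℝ f t (compVec Ω i v)) +
        mulOp _ ℝ η (sliceOp Ω ℝ
          (fun z => fderiv ℝ f z (0, EuclideanSpace.single j 1)) t (compVec Ω i v))))) := fun i j =>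
    ((integralL2 _).continuous.tendsto _).comp
      ((((mulOp _ ℝ (partialX j η)).continuous.tendsto _).comp (l1 (compVec Ω i v))).add
        (((mulOp _ ℝ η).continuous.tendsto _).comp (l2 j (compVec Ω i v))))
  refine tendsto_nhds_unique (hlhs.congr fun n => ?_)
    (((hterm i j).add (hterm j i)).const_mul (1 / 2)).neg
  -- For smooth Fₙ the product ηFₙ(t, ·) is still supported off K, so the definition applies to it
  -- directly. The exceptional times come only from the convergence of the derivatives and do not
  -- depend on v, e or η.
  have key := hve.integralL2_eq hΩo hΩ (η := fun x => η x * F n (t, x))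
    (g1.mul ((h1 n).comp (by fun_prop))) g2.mul_right
    ((tsupport_mul_subset_left).trans g3) i j
  have hpart : ∀ i, partialX i (fun x => η x * F n (t, x)) = fun x =>
      partialX i η x * F n (t, x) +
        η x * fderiv ℝ (F n) (t, x) (0, EuclideanSpace.single i 1) := fun i => by
    funext x
    rw [← partialX_slice (h1 n) i t x, partialX, fderiv_fun_mul (g1.differentiable (by simp) x)
      (show DifferentiableAt ℝ (fun x => F n (t, x)) x from
        ((h1 n).comp (by fun_prop : ContDiff ℝ ∞ fun x : Vec d => (t, x))).differentiable
          (by simp) x)]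
    simp [partialX]
    ring
  have hsplit : ∀ i j, mulOp _ ℝ (partialX j fun x => η x * F n (t, x)) (compVec Ω i v) =
      mulOp _ ℝ (partialX j η) (sliceOp Ω ℝ (F n) t (compVec Ω i v)) +
        mulOp _ ℝ η (sliceOp Ω ℝ
          (fun z => fderiv ℝ (F n) z (0, EuclideanSpace.single j 1)) t (compVec Ω i v)) :=
    fun i j => by
    rw [hpart, mulOp_add (show MemLp (fun x => partialX j η x * F n (t, x)) ∞ _ from
      (m3 n).mul (m2 j)) (show MemLp (fun x => η x * fderiv ℝ (F n) (t, x)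
        (0, EuclideanSpace.single j 1)) ∞ _ from (m4 n j).mul m1), sliceOp, sliceOp,
      mulOp_mulOp (m2 j) (m3 n), mulOp_mulOp m1 (m4 n j)]
  rw [hsplit, hsplit, ← mulOp_mulOp m1 (m3 n)] at key
  exact key

/-- Testing on Ω \ K gives vanishing almost everywhere there, and K is negligible. -/
theorem l2Sym_eq_zero_of_forall_test (hΩo : IsOpen Ω) (hΩ : Bornology.IsBounded Ω)
    {K : Set (Vec d)} (hK : IsClosed K) (hK0 : volume K = 0) (X : L2Sym Ω)
    (h : ∀ η : Vec d → ℝ, ContDiff ℝ ∞ η → HasCompactSupport η → tsupport η ⊆ Ω \ K →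
      ∀ i j : Fin d, integralL2 _ (mulOp _ ℝ η (compSym Ω i j X)) = 0) : X = 0 := by
  have hU : IsOpen (Ω \ K) := hΩo.sdiff hK
  have hcomp : ∀ i j, ∀ᵐ x ∂(volume.restrict Ω), compSym Ω i j X x = 0 := by
    intro i j
    have hint : IntegrableOn (compSym Ω i j X) Ω :=
      (Lp.memLp (compSym Ω i j X)).integrable (by norm_num)
    have := hU.ae_eq_zero_of_integral_contDiff_smul_eq_zero (μ := volume)
      (f := compSym Ω i j X) (hint.mono_set sdiff_subset).locallyIntegrableOn fun η h1 h2 h3 => by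
        have := h η h1 h2 h3 i j
        rw [integralL2_mulOp (memLp_top_of_continuous hΩo hΩ h1.continuous)] at this
        rw [← this, setIntegral_eq_integral_of_forall_compl_eq_zero]
        · rfl
        · intro x hx
          rw [image_eq_zero_of_notMem_tsupport fun h' => hx (h3 h').1, zero_mul]
    rw [ae_restrict_iff' hΩo.measurableSet]
    filter_upwards [this, measure_eq_zero_iff_ae_notMem.1 hK0] with x h1 h2 h3
    exact h1 ⟨h3, h2⟩
  refine Lp.ext ?_
  have hall : ∀ᵐ x ∂(volume.restrict Ω), ∀ i j : Fin d, (X x : Mat d) (i, j) = 0 := by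
    refine ae_all_iff.2 fun i => ae_all_iff.2 fun j => ?_
    filter_upwards [hcomp i j, (entry i j).coeFn_compLpL X] with x h1 h2
    rw [compSym, h2] at h1
    exact h1
  filter_upwards [hall, Lp.coeFn_zero (SymMat d) 2 (volume.restrict Ω)] with x h1 h2
  rw [h2]
  ext p
  exact h1 p.1 p.2

/-- The gradient of f² carries a factor 2. One copy of f∇f ⊙ ψ comes from testing E q, where q = fψ,
with ηf; the other is the term subtracted from E q. -/
theorem integralL2_prodTest_pointwise (hΩo : IsOpen Ω) (hΩ : Bornology.IsBounded Ω) {T : ℝ}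
    {f : ℝ × Vec d → ℝ} {L : ℝ≥0} (hf : LipschitzWith L f) {θ : ℝ → ℝ} {η : Vec d → ℝ}
    (g1 : ContDiff ℝ ∞ η) {t : ℝ} (ht : t ∈ Ioo 0 T) (ψ : L2Vec Ω) (e qe : L2Sym Ω) (i j : Fin d)
    (h : integralL2 _ (mulOp _ ℝ η (sliceOp Ω ℝ f t (compSym Ω i j qe))) =
      -((1 / 2) * (integralL2 _ (mulOp _ ℝ (partialX j η) (sliceOp Ω ℝ f t
            (compVec Ω i (sliceOp Ω (Vec d) f t ψ))) +
          mulOp _ ℝ η (sliceOp Ω ℝ (fun z => fderiv ℝ f z (0, EuclideanSpace.single j 1)) t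
            (compVec Ω i (sliceOp Ω (Vec d) f t ψ)))) +
        integralL2 _ (mulOp _ ℝ (partialX i η) (sliceOp Ω ℝ f t
            (compVec Ω j (sliceOp Ω (Vec d) f t ψ))) +
          mulOp _ ℝ η (sliceOp Ω ℝ (fun z => fderiv ℝ f z (0, EuclideanSpace.single i 1)) t
            (compVec Ω j (sliceOp Ω (Vec d) f t ψ))))))) :
    integralL2 _ (mulOp _ ℝ η (compSym Ω i j
      (deriv θ t • sliceOp Ω (SymMat d) f t (sliceOp Ω (SymMat d) f t e) +
        θ t • (sliceOp Ω (SymMat d) f t (qe - symGradOp Ω f t ψ) +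
          (2 : ℝ) • sliceOp Ω (SymMat d) (fun z => fderiv ℝ f z (1, 0)) t
            (sliceOp Ω (SymMat d) f t e))))) =
    integralL2 _ (sliceOp Ω ℝ (prodTestDeriv θ η (1, 0) f (fun z => fderiv ℝ f z (1, 0))) t
        (compSym Ω i j e)) -
      1 / 2 * (integralL2 _ (sliceOp Ω ℝ (prodTestDeriv θ η (0, EuclideanSpace.single j 1) f
          (fun z => fderiv ℝ f z (0, EuclideanSpace.single j 1))) t (compVec Ω i ψ)) +
        integralL2 _ (sliceOp Ω ℝ (prodTestDeriv θ η (0, EuclideanSpace.single i 1) f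
          (fun z => fderiv ℝ f z (0, EuclideanSpace.single i 1))) t (compVec Ω j ψ))) := by
  have m1 := memLp_top_of_continuous hΩo hΩ g1.continuous
  have m3 : MemLp (fun x => f (t, x)) ∞ (volume.restrict Ω) :=
    memLp_top_of_continuous hΩo hΩ (hf.continuous.comp (by fun_prop))
  have mD := fun w => (isMultiplier_fderiv T Ω hf w).memLp_slice hΩo ht
  have c1 : ∀ x, compSym Ω i j (sliceOp Ω (SymMat d) f t x) = sliceOp Ω ℝ f t (compSym Ω i j x) :=
    fun x => compLpL_mulOp _ m3 x
  have c2 : ∀ x, compSym Ω i j (sliceOp Ω (SymMat d) (fun z => fderiv ℝ f z (1, 0)) t x) =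
      sliceOp Ω ℝ (fun z => fderiv ℝ f z (1, 0)) t (compSym Ω i j x) :=
    fun x => compLpL_mulOp _ (mD _) x
  have c3 : ∀ i, compVec Ω i (sliceOp Ω (Vec d) f t ψ) = sliceOp Ω ℝ f t (compVec Ω i ψ) :=
    fun i => compLpL_mulOp _ m3 _
  have c4 : ∀ w x, sliceOp Ω ℝ (fun z => fderiv ℝ f z w) t (sliceOp Ω ℝ f t x) =
      sliceOp Ω ℝ f t (sliceOp Ω ℝ (fun z => fderiv ℝ f z w) t x) := fun w x =>
    mulOp_comm (mD w) m3 x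
  -- The direction (1, 0) has no spatial part, so the derivative of η does not appear in the time
  -- term.
  have c5 : mulOp (volume.restrict Ω) ℝ (fun x => fderiv ℝ η x 0) = 0 := by
    ext1 x
    have := mulOp_const_mul 0 m1 x
    simpa using this
  have E0 := fun w G => congrArg (integralL2 (volume.restrict Ω))
    (sliceOp_prodTestDeriv (θ := θ) hΩo hΩ g1 hf w ht G)
  have E1 := E0 (1, 0) (compSym Ω i j e)
  have E2 := E0 (0, EuclideanSpace.single j 1) (compVec Ω i ψ)
  have E3 := E0 (0, EuclideanSpace.single i 1) (compVec Ω j ψ)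
  clear E0
  rw [c5] at E1
  have p1 : ∀ i : Fin d, (fun x => fderiv ℝ η x (EuclideanSpace.single i 1)) = partialX i η :=
    fun i => rfl
  simp only [map_add, map_smul, smul_eq_mul, zero_apply, map_zero, p1]
    at E1 E2 E3
  simp only [c3, c4, map_add] at h
  have E4 := congrArg (fun y => integralL2 _ (mulOp _ ℝ η (sliceOp Ω ℝ f t y)))
    (compSym_symGradOp hΩo hf ht ψ i j)
  simp only [map_add, map_smul, smul_eq_mul] at E4
  simp only [map_add, map_sub, map_smul, c1, c2, c4, smul_eq_mul]
  linear_combination θ t * h - θ t * E4 - E1 + (1 / 2) * (E2 + E3)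

theorem clm_integral_comm {V W : Type*} [NormedAddCommGroup V] [NormedSpace ℝ V] [CompleteSpace V]
    [NormedAddCommGroup W] [NormedSpace ℝ W] [CompleteSpace W] (A : V →L[ℝ] W) {α : Type*}
    [MeasurableSpace α] {μ : Measure α} {f : α → V} (hf : Integrable f μ) :
    A (∫ t, f t ∂μ) = ∫ t, A (f t) ∂μ :=
  (A.integral_comp_comm hf).symm

/-- If `q = f v̇` in `V`, then `f² E v` has the weak derivative
`f (E q - ∇f ⊙ v̇) + 2 f ḟ E v`. -/
theorem isWeakTimeDeriv_sq_mul_symGrad (hΩo : IsOpen Ω) (hΩ : Bornology.IsBounded Ω) {T : ℝ}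
    {K : Set (Vec d)} (hK : IsClosed K) (hK0 : volume K = 0)
    {v ψ qv : ℝ → L2Vec Ω} {e qe : ℝ → L2Sym Ω}
    (hψ : IntegrableOn ψ (Ioo 0 T))
    (hv : ∀ᵐ t ∂(volume.restrict (Ioo 0 T)), v t = ∫ r in Ioo 0 t, ψ r)
    (he : ∀ᵐ t ∂(volume.restrict (Ioo 0 T)), IsSymGrad Ω K (v t) (e t))
    (hei : IntegrableOn e (Ioo 0 T)) {f : ℝ × Vec d → ℝ} {L : ℝ≥0} (hf : LipschitzWith L f)
    (hqv : ∀ᵐ t ∂(volume.restrict (Ioo 0 T)), qv t = sliceOp Ω (Vec d) f t (ψ t))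
    (hq : ∀ᵐ t ∂(volume.restrict (Ioo 0 T)), IsSymGrad Ω K (qv t) (qe t))
    (hqe : IntegrableOn qe (Ioo 0 T)) :
    IsWeakTimeDeriv T (fun t => sliceOp Ω (SymMat d) f t (sliceOp Ω (SymMat d) f t (e t)))
      (fun t => sliceOp Ω (SymMat d) f t (qe t - symGradOp Ω f t (ψ t)) +
        (2 : ℝ) • sliceOp Ω (SymMat d) (fun z => fderiv ℝ f z (1, 0)) t
          (sliceOp Ω (SymMat d) f t (e t))) := by
  intro θ hθ hθc hθs
  obtain ⟨C, hfm⟩ := exists_isMultiplier_of_continuous T hΩ hf.continuous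
  have hDm := isMultiplier_fderiv T Ω hf (1, 0)
  let Z := fun t => sliceOp Ω (SymMat d) f t (sliceOp Ω (SymMat d) f t (e t))
  let k := fun t => sliceOp Ω (SymMat d) f t (qe t - symGradOp Ω f t (ψ t)) +
        (2 : ℝ) • sliceOp Ω (SymMat d) (fun z => fderiv ℝ f z (1, 0)) t
          (sliceOp Ω (SymMat d) f t (e t))
  have hsg : IntegrableOn (fun t => symGradOp Ω f t (ψ t)) (Ioo 0 T) :=
    memLp_one_iff_integrable.1 (memLp_symGradOp hΩo hΩ hf (memLp_one_iff_integrable.2 hψ))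
  have hZi : IntegrableOn Z (Ioo 0 T) :=
    hfm.integrableOn_curve hΩo hΩ (hfm.integrableOn_curve hΩo hΩ hei)
  have hki : IntegrableOn k (Ioo 0 T) :=
    (hfm.integrableOn_curve hΩo hΩ (hqe.sub hsg)).add
      ((hDm.integrableOn_curve hΩo hΩ (hfm.integrableOn_curve hΩo hΩ hei)).smul (2 : ℝ))
  have i1 : IntegrableOn (fun t => deriv θ t • Z t) (Ioo 0 T) :=
    IntegrableOn.test_smul hZi (hθ.continuous_deriv (by simp)) hθc.deriv
  have i2 : IntegrableOn (fun t => θ t • k t) (Ioo 0 T) :=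
    IntegrableOn.test_smul hki hθ.continuous hθc
  -- The two sides are gathered into one L² field, whose vanishing can be tested componentwise in
  -- space.
  rw [eq_neg_iff_add_eq_zero, ← integral_add i1 i2]
  refine l2Sym_eq_zero_of_forall_test hΩo hΩ hK hK0 _ fun η g1 g2 g3 i j => ?_
  let l : L2Sym Ω →L[ℝ] ℝ := (integralL2 _).comp ((mulOp _ ℝ η).comp (compSym Ω i j))
  have hint : IntegrableOn (fun t => deriv θ t • Z t + θ t • k t) (Ioo 0 T) := i1.add i2
  refine (clm_integral_comm l hint).trans ?_
  have hJ : ∀ (w : ℝ × Vec d) (G : ℝ → Lp ℝ 2 (volume.restrict Ω)),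
      IntegrableOn G (Ioo 0 T) volume → IntegrableOn (fun t => integralL2 _ (sliceOp Ω ℝ
        (prodTestDeriv θ η w f (fun z => fderiv ℝ f z w)) t (G t))) (Ioo 0 T) := fun w G hG => by
    obtain ⟨C, hC⟩ := exists_isMultiplier_prodTestDeriv T hΩ hθ g1 hf w
    exact integrableOn_clm_apply (integralL2 (volume.restrict Ω)) (hC.integrableOn_curve hΩo hΩ hG)
  have j1 := hJ (1, 0) _ (integrableOn_clm_apply (compSym Ω i j) hei)
  have j2 := hJ (0, EuclideanSpace.single j 1) _ (integrableOn_clm_apply (compVec Ω i) hψ)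
  have j3 := hJ (0, EuclideanSpace.single i 1) _ (integrableOn_clm_apply (compVec Ω j) hψ)
  have key := integral_prodTest_symGrad hΩo hΩ hψ hv he hei hf hθ (test_eq_zero hθs (by simp))
    g1 g2 g3 i j
  -- The tested identity becomes the vanishing of a single time integral, whose integrand agrees
  -- almost everywhere with the required one by the pointwise computation.
  rw [← sub_eq_zero, ← integral_add j2 j3, ← integral_const_mul] at key
  refine Eq.trans ?_ ((integral_sub j1 ((j2.add j3).const_mul (1 / 2))).trans key)
  refine integral_congr_ae ?_
  filter_upwards [ae_isSymGrad_mul_lipschitz hΩo hΩ T K hf, hqv, hq,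
    ae_restrict_mem measurableSet_Ioo] with t h1 h2 h3 ht
  have h4 := h1 _ _ h3 η g1 g2 g3 i j
  rw [h2] at h4
  exact integralL2_prodTest_pointwise hΩo hΩ hf g1 ht (ψ t) (e t) (qe t) i j h4

end WeakDerivative

/-! ### Integrals in closed subspaces and averages near the initial time -/

/-- A closed convex set contains the averages of its members, and the integral is a multiple of the
average. -/
theorem integral_mem_submodule {X α : Type*} [NormedAddCommGroup X] [NormedSpace ℝ X]
    [CompleteSpace X] [MeasurableSpace α] {μ : Measure α} [IsFiniteMeasure μ] {W : Submodule ℝ X}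
    (hW : IsClosed (W : Set X)) {f : α → X} (hf : Integrable f μ) (h : ∀ᵐ x ∂μ, f x ∈ W) :
    ∫ x, f x ∂μ ∈ W := by
  rcases eq_or_ne μ 0 with rfl | hμ
  · simp
  · have : NeZero μ := ⟨hμ⟩
    rw [← measure_smul_average]
    exact W.smul_mem _ (W.convex.average_mem hW h hf)

theorem integrable_inner_of_memLp_two {Y α : Type*} [NormedAddCommGroup Y] [InnerProductSpace ℝ Y]
    [MeasurableSpace α] {μ : Measure α} {f g : α → Y} (hf : MemLp f 2 μ) (hg : MemLp g 2 μ) :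
    Integrable (fun x => inner ℝ (f x) (g x)) μ := by
  refine Integrable.mono' (hf.norm.integrable_mul hg.norm) (hf.1.inner hg.1)
    (Eventually.of_forall fun x => ?_)
  exact norm_inner_le_norm _ _

theorem tendsto_average_zero {T : ℝ} (hT : 0 < T) {F : ℝ → ℝ} (hF : ContinuousOn F (Icc 0 T)) :
    Tendsto (fun h : ℝ => (1 / h) * ∫ t in Ioo 0 h, F t) (𝓝[>] 0) (𝓝 (F 0)) := by
  have hc : ContinuousWithinAt F (Ioi 0) 0 :=
    (hF 0 ⟨le_rfl, hT.le⟩).mono_of_mem_nhdsWithin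
      (mem_of_superset (Ioo_mem_nhdsGT hT) Ioo_subset_Icc_self)
  have hd := intervalIntegral.integral_hasDerivWithinAt_right (a := 0) (b := 0) (f := F)
    (s := Ici 0) (t := Ioi 0) (by simp)
    (hF.stronglyMeasurableAtFilter_nhdsWithin measurableSet_Icc 0 |>.filter_mono
      (nhdsWithin_le_of_mem (mem_of_superset (Ioo_mem_nhdsGT hT) Ioo_subset_Icc_self))) hc
  have hd' := hd.mono Ioi_subset_Ici_self
  rw [hasDerivWithinAt_iff_tendsto_slope' (by simp)] at hd'
  refine hd'.congr' ?_
  filter_upwards [self_mem_nhdsWithin] with h hh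
  simp [slope, intervalIntegral.integral_of_le (le_of_lt hh : (0 : ℝ) ≤ h),
    integral_Ioc_eq_integral_Ioo]

/-- The mean of the norm is bounded by the root of the mean square. Young's inequality with weight ε
is used in place of Cauchy–Schwarz. -/
theorem tendsto_average_norm_zero {Y : Type*} [NormedAddCommGroup Y] {T : ℝ} (hT : 0 < T)
    {ψ : ℝ → Y} (hψ : MemLp ψ 2 (volume.restrict (Ioo 0 T)))
    (h0 : Tendsto (fun h : ℝ => (1 / h) * ∫ t in Ioo 0 h, ‖ψ t‖ ^ 2) (𝓝[>] 0) (𝓝 0)) :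
    Tendsto (fun h : ℝ => (1 / h) * ∫ t in Ioo 0 h, ‖ψ t‖) (𝓝[>] 0) (𝓝 0) := by
  rw [Metric.tendsto_nhds] at h0 ⊢
  intro ε hε
  filter_upwards [h0 (ε ^ 2) (by positivity), Ioo_mem_nhdsGT hT] with h h1 hh
  have hsub : Ioo 0 h ⊆ Ioo 0 T := Ioo_subset_Ioo_right hh.2.le
  have hψ' : MemLp ψ 2 (volume.restrict (Ioo 0 h)) :=
    hψ.mono_measure (Measure.restrict_mono_set _ hsub)
  have i1 : IntegrableOn (fun t => ‖ψ t‖) (Ioo 0 h) := hψ'.norm.integrable (by norm_num)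
  have i2 : IntegrableOn (fun t => ‖ψ t‖ ^ 2) (Ioo 0 h) :=
    (memLp_two_iff_integrable_sq_norm hψ'.1).1 hψ'
  have hpos : 0 ≤ ∫ t in Ioo 0 h, ‖ψ t‖ := integral_nonneg fun _ => norm_nonneg _
  have hpos2 : 0 ≤ ∫ t in Ioo 0 h, ‖ψ t‖ ^ 2 := integral_nonneg fun _ => by positivity
  have hh0 := hh.1
  rw [Real.dist_eq, sub_zero, abs_of_nonneg (by positivity)] at h1 ⊢
  have hle : ∫ t in Ioo 0 h, ‖ψ t‖ ≤ ∫ t in Ioo 0 h, (ε / 2 + (1 / (2 * ε)) * ‖ψ t‖ ^ 2) := by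
    refine integral_mono i1 ((integrable_const _).add (i2.const_mul _)) fun t => ?_
    have : 0 ≤ (ε - ‖ψ t‖) ^ 2 / (2 * ε) := by positivity
    calc ‖ψ t‖ ≤ ‖ψ t‖ + (ε - ‖ψ t‖) ^ 2 / (2 * ε) := by linarith
      _ = ε / 2 + (1 / (2 * ε)) * ‖ψ t‖ ^ 2 := by field_simp; ring
  rw [integral_add (integrable_const _) (i2.const_mul _), integral_const_mul, integral_const] at hle
  simp only [MeasurableSet.univ, measureReal_restrict_apply, univ_inter,
    Real.volume_real_Ioo_of_le hh0.le, sub_zero, smul_eq_mul] at hle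
  calc (1 / h) * ∫ t in Ioo 0 h, ‖ψ t‖
      ≤ (1 / h) * (h * (ε / 2) + (1 / (2 * ε)) * ∫ t in Ioo 0 h, ‖ψ t‖ ^ 2) := by gcongr
    _ = ε / 2 + (1 / (2 * ε)) * ((1 / h) * ∫ t in Ioo 0 h, ‖ψ t‖ ^ 2) := by field_simp
    _ < ε / 2 + (1 / (2 * ε)) * ε ^ 2 := by gcongr
    _ = ε := by field_simp; ring

/-! ### Testing the time-integrated equation with the solution -/

section TestIdentity

variable {H S X : Type*} [NormedAddCommGroup H] [InnerProductSpace ℝ H] [CompleteSpace H]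
  [NormedAddCommGroup S] [InnerProductSpace ℝ S] [CompleteSpace S]
  [NormedAddCommGroup X] [NormedSpace ℝ X] [CompleteSpace X]

/-- Formally, ψ(t) - div ∫₀ᵗ g = 0 is tested with u on (0, s). Admissible v must have zero mean, so
the mean c of the truncated u over (0, s), unnormalized, is removed by subtracting c/h on (0, h). As
h → 0 the layer contributes only (G(0), E c), because averages of ψ tend to 0. Combined with the
tail G, this replaces ∫ₜᵀ g by ∫₀ᵗ g. -/
theorem integral_velocity_add_integral_primitive_eq_zero {T : ℝ} (hT : 0 < T) (fn : X →L[ℝ] H)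
    (E : X →L[ℝ] S) {W : Submodule ℝ X} (hW : IsClosed (W : Set X)) {u : ℝ → X} {ψ : ℝ → H}
    {g : ℝ → S} (hu : MemLp u 2 (volume.restrict (Ioo 0 T)))
    (huW : ∀ᵐ t ∂(volume.restrict (Ioo 0 T)), u t ∈ W)
    (hψ : MemLp ψ 2 (volume.restrict (Ioo 0 T)))
    (hψ0 : Tendsto (fun h : ℝ => (1 / h) * ∫ t in Ioo 0 h, ‖ψ t‖ ^ 2) (𝓝[>] 0) (𝓝 0))
    (hg : MemLp g 2 (volume.restrict (Ioo 0 T)))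
    (heq : ∀ v : ℝ → X, MemLp v 2 (volume.restrict (Ioo 0 T)) →
      (∀ᵐ t ∂(volume.restrict (Ioo 0 T)), v t ∈ W) → ∫ t in Ioo 0 T, v t = 0 →
      -(∫ t in Ioo 0 T, inner ℝ (ψ t) (fn (v t))) +
        ∫ t in Ioo 0 T, inner ℝ (g t) (E (∫ r in Ioo 0 t, v r)) = 0)
    {s : ℝ} (hs : s ∈ Icc 0 T) :
    (∫ t in Ioo 0 s, inner ℝ (ψ t) (fn (u t))) +
      ∫ t in Ioo 0 s, inner ℝ (∫ r in Ioo 0 t, g r) (E (u t)) = 0 := by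
  have hsub : Ioo 0 s ⊆ Ioo 0 T := Ioo_subset_Ioo_right hs.2
  have hgi : IntegrableOn g (Ioo 0 T) := hg.integrable (by norm_num)
  have hui : IntegrableOn u (Ioo 0 T) := hu.integrable (by norm_num)
  -- The tail ∫ᵣᵀ g, which is what multiplies E v(r) after exchanging the order of integration in
  -- the weak equation.
  let G : ℝ → S := fun r : ℝ => (∫ t in Ioo 0 T, g t) - ∫ t in Ioo 0 r, g t
  have hGc : ContinuousOn G (Icc 0 T) := continuousOn_const.sub (continuousOn_primitive_Ioo hgi)
  obtain ⟨M, hM⟩ := (isCompact_Icc (a := 0) (b := T)).exists_bound_of_continuousOn hGc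
  have hG2 : MemLp G 2 (volume.restrict (Ioo 0 T)) := by
    refine MemLp.of_bound ((hGc.mono Ioo_subset_Icc_self).aestronglyMeasurable measurableSet_Ioo)
      M ?_
    filter_upwards [ae_restrict_mem measurableSet_Ioo] with t ht
    exact hM t (Ioo_subset_Icc_self ht)
  have heq' : ∀ v : ℝ → X, MemLp v 2 (volume.restrict (Ioo 0 T)) →
      (∀ᵐ t ∂(volume.restrict (Ioo 0 T)), v t ∈ W) → ∫ t in Ioo 0 T, v t = 0 →
      ∫ t in Ioo 0 T, (inner ℝ (G t) (E (v t)) - inner ℝ (ψ t) (fn (v t))) = 0 := by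
    intro v hv hvW hv0
    have hvi : IntegrableOn v (Ioo 0 T) := hv.integrable (by norm_num)
    have i1 := integrable_inner_of_memLp_two hG2 (memLp_clm_apply E hv)
    have i2 := integrable_inner_of_memLp_two hψ (memLp_clm_apply fn hv)
    have h1 := heq v hv hvW hv0
    have h2 := integral_bilin_primitive ((innerSL ℝ (E := S)).flip.comp E) hvi hgi
    simp only [ContinuousLinearMap.comp_apply, ContinuousLinearMap.flip_apply,
      innerSL_apply_apply] at h2
    rw [h2] at h1
    refine (integral_sub i1 i2).trans (Eq.trans ?_ h1)
    rw [sub_eq_neg_add]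
    congr 1
    refine setIntegral_congr_fun measurableSet_Ioo fun r hr => ?_
    simp only [G]
    rw [← setIntegral_Ioo_add hgi ⟨hr.1.le, hr.2.le⟩, add_sub_cancel_left]
  let c := ∫ t in Ioo 0 s, u t
  have hcW : c ∈ W := integral_mem_submodule hW (hui.mono_set hsub)
    (ae_restrict_of_ae_restrict_of_subset hsub huW)
  let Fc : ℝ → ℝ := fun t => inner ℝ (G t) (E c) - inner ℝ (ψ t) (fn c)
  let Fu : ℝ → ℝ := fun t => inner ℝ (G t) (E (u t)) - inner ℝ (ψ t) (fn (u t))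
  have hconst : ∀ x : X, MemLp (fun _ : ℝ => x) 2 (volume.restrict (Ioo 0 T)) := fun x =>
    memLp_const x
  have iFc : IntegrableOn Fc (Ioo 0 T) :=
    (integrable_inner_of_memLp_two hG2 (memLp_const (E c))).sub
      (integrable_inner_of_memLp_two hψ (memLp_const (fn c)))
  have iFu : IntegrableOn Fu (Ioo 0 T) :=
    (integrable_inner_of_memLp_two hG2 (E.comp_memLp' hu)).sub
      (integrable_inner_of_memLp_two hψ (fn.comp_memLp' hu))
  -- The layer may be longer or shorter than (0, s): the identity is linear in v and needs no
  -- relation between h and s.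
  have havg : ∀ h ∈ Ioo 0 T, (1 / h) * ∫ t in Ioo 0 h, Fc t = ∫ t in Ioo 0 s, Fu t := by
    intro h hh
    have hsubh : Ioo 0 h ⊆ Ioo 0 T := Ioo_subset_Ioo_right hh.2.le
    have m1 : MemLp ((Ioo 0 s).indicator u) 2 (volume.restrict (Ioo 0 T)) :=
      hu.indicator measurableSet_Ioo
    have m2 : MemLp ((Ioo 0 h).indicator fun _ => (1 / h) • c) 2 (volume.restrict (Ioo 0 T)) :=
      (hconst _).indicator measurableSet_Ioo
    have e := heq' (fun t => (Ioo 0 s).indicator u t - (Ioo 0 h).indicator (fun _ => (1 / h) • c) t)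
      (m1.sub m2) ?_ ?_
    · have e3 : ∀ t, inner ℝ (G t) (E ((Ioo 0 s).indicator u t -
          (Ioo 0 h).indicator (fun _ => (1 / h) • c) t)) - inner ℝ (ψ t) (fn
          ((Ioo 0 s).indicator u t - (Ioo 0 h).indicator (fun _ => (1 / h) • c) t)) =
          (Ioo 0 s).indicator Fu t - (1 / h) * (Ioo 0 h).indicator Fc t := fun t => by
        by_cases a1 : t ∈ Ioo 0 s <;> by_cases a2 : t ∈ Ioo 0 h <;>
          simp [indicator_of_mem, indicator_of_notMem, a1, a2, Fu, Fc, inner_sub_right,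
            inner_smul_right] <;> ring
      simp_rw [e3] at e
      rw [integral_sub (iFu.indicator measurableSet_Ioo)
        ((iFc.indicator measurableSet_Ioo).const_mul _), integral_const_mul,
        setIntegral_indicator measurableSet_Ioo, setIntegral_indicator measurableSet_Ioo,
        inter_eq_right.2 hsub, inter_eq_right.2 hsubh] at e
      linarith
    · filter_upwards [huW] with t ht
      refine W.sub_mem ?_ ?_
      · by_cases a : t ∈ Ioo 0 s <;> simp [a, ht]
      · by_cases a : t ∈ Ioo 0 h <;> simp [a, W.smul_mem _ hcW]
    · rw [integral_sub (m1.integrable (by norm_num)) (m2.integrable (by norm_num)),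
        setIntegral_indicator measurableSet_Ioo, setIntegral_indicator measurableSet_Ioo,
        inter_eq_right.2 hsub, inter_eq_right.2 hsubh, integral_const]
      simp [Real.volume_real_Ioo_of_le hh.1.le, smul_smul, hh.1.ne', c]
  -- Continuity of the tail gives its value at 0. The velocity term is controlled by the mean of ‖ψ‖
  -- times ‖fn c‖.
  have hlim1 : Tendsto (fun h : ℝ => (1 / h) * ∫ t in Ioo 0 h, Fc t) (𝓝[>] 0)
      (𝓝 (inner ℝ (G 0) (E c) - 0)) := by
    have l1 := tendsto_average_zero hT (F := fun t => inner ℝ (G t) (E c))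
      (hGc.inner continuousOn_const)
    have l2 : Tendsto (fun h : ℝ => (1 / h) * ∫ t in Ioo 0 h, inner ℝ (ψ t) (fn c)) (𝓝[>] 0)
        (𝓝 0) := by
      refine squeeze_zero_norm' ?_ (by
        simpa only [zero_mul] using (tendsto_average_norm_zero hT hψ hψ0).mul_const ‖fn c‖)
      filter_upwards [Ioo_mem_nhdsGT hT] with h hh
      have hi : IntegrableOn (fun t => ‖ψ t‖) (Ioo 0 h) :=
        IntegrableOn.mono_set (hψ.norm.integrable (by norm_num)) (Ioo_subset_Ioo_right hh.2.le)
      rw [norm_mul, Real.norm_of_nonneg (one_div_nonneg.2 hh.1.le), mul_assoc,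
        ← integral_mul_const]
      refine mul_le_mul_of_nonneg_left ?_ (one_div_nonneg.2 hh.1.le)
      exact norm_integral_le_of_norm_le (hi.mul_const _)
        (Eventually.of_forall fun t => norm_inner_le_norm (𝕜 := ℝ) (ψ t) (fn c))
    refine (l1.sub l2).congr' ?_
    filter_upwards [Ioo_mem_nhdsGT hT] with h hh
    have hsubh : Ioo 0 h ⊆ Ioo 0 T := Ioo_subset_Ioo_right hh.2.le
    rw [← mul_sub, ← integral_sub]
    · exact (show IntegrableOn _ (Ioo 0 T) from
        integrable_inner_of_memLp_two hG2 (memLp_const (E c))).mono_set hsubh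
    · exact (show IntegrableOn _ (Ioo 0 T) from
        integrable_inner_of_memLp_two hψ (memLp_const (fn c))).mono_set hsubh
  have hlim2 : Tendsto (fun h : ℝ => (1 / h) * ∫ t in Ioo 0 h, Fc t) (𝓝[>] 0)
      (𝓝 (∫ t in Ioo 0 s, Fu t)) := by
    refine tendsto_const_nhds.congr' ?_
    filter_upwards [Ioo_mem_nhdsGT hT] with h hh using (havg h hh).symm
  have hfin := tendsto_nhds_unique hlim1 hlim2
  have hEu : IntegrableOn (fun t => E (u t)) (Ioo 0 s) :=
    integrableOn_clm_apply E (hui.mono_set hsub)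
  have hG0 : inner ℝ (G 0) (E c) = ∫ t in Ioo 0 s, inner ℝ (G 0) (E (u t)) :=
    (clm_integral_comm ((innerSL ℝ (G 0)).comp E) (hui.mono_set hsub))
  have m0 : MemLp (fun t => E (u t)) 2 (volume.restrict (Ioo 0 s)) :=
    (E.comp_memLp' hu).mono_measure (Measure.restrict_mono_set _ hsub)
  have m1 : MemLp G 2 (volume.restrict (Ioo 0 s)) :=
    hG2.mono_measure (Measure.restrict_mono_set _ hsub)
  have m2 : MemLp ψ 2 (volume.restrict (Ioo 0 s)) :=
    hψ.mono_measure (Measure.restrict_mono_set _ hsub)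
  have m3 : MemLp (fun t => fn (u t)) 2 (volume.restrict (Ioo 0 s)) :=
    (fn.comp_memLp' hu).mono_measure (Measure.restrict_mono_set _ hsub)
  -- The primitive from 0 is the difference G(0) - G(t) of tails.
  have e4 : ∫ t in Ioo 0 s, inner ℝ (∫ r in Ioo 0 t, g r) (E (u t)) =
      (∫ t in Ioo 0 s, inner ℝ (G 0) (E (u t))) - ∫ t in Ioo 0 s, inner ℝ (G t) (E (u t)) := by
    rw [← integral_sub (integrable_inner_of_memLp_two (memLp_const (G 0)) m0)
      (integrable_inner_of_memLp_two m1 m0)]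
    refine integral_congr_ae (Eventually.of_forall fun t => ?_)
    simp only [G]
    rw [← inner_sub_left]
    simp
  have e5 : ∫ t in Ioo 0 s, Fu t = (∫ t in Ioo 0 s, inner ℝ (G t) (E (u t))) -
      ∫ t in Ioo 0 s, inner ℝ (ψ t) (fn (u t)) :=
    integral_sub (integrable_inner_of_memLp_two m1 m0) (integrable_inner_of_memLp_two m2 m3)
  rw [e4]
  linarith

end TestIdentity

/-! ### The energy identity and its consequence -/

section EnergyIdentity

variable {H S : Type*} [NormedAddCommGroup H] [InnerProductSpace ℝ H] [CompleteSpace H]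
  [NormedAddCommGroup S] [InnerProductSpace ℝ S] [CompleteSpace S]

theorem integrableOn_inner_of_bound {T : ℝ} {G e : ℝ → S} (hG : ContinuousOn G (Icc 0 T))
    (he : IntegrableOn e (Ioo 0 T)) : IntegrableOn (fun t => inner ℝ (G t) (e t)) (Ioo 0 T) := by
  obtain ⟨M, hM⟩ := (isCompact_Icc (a := 0) (b := T)).exists_bound_of_continuousOn hG
  refine ContinuousLinearMap.integrable_of_bilin_of_bdd_left (innerSL ℝ (E := S)) M
    ((hG.mono Ioo_subset_Icc_self).aestronglyMeasurable measurableSet_Ioo) ?_ he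
  filter_upwards [ae_restrict_mem measurableSet_Ioo] with t ht
  exact hM t (Ioo_subset_Icc_self ht)

/-- The energy identity. Here `ξ(t)` is the primitive of `e`. -/
theorem energy_identity {s : ℝ} {B C : S →L[ℝ] S}
    (hC : ∀ a b, inner ℝ (C a) b = inner ℝ a (C b)) {ψ U : ℝ → H} {e z m p y : ℝ → S}
    (hψ : IntegrableOn ψ (Ioo 0 s))
    (hU : ∀ᵐ t ∂(volume.restrict (Ioo 0 s)), U t = ∫ r in Ioo 0 t, ψ r)
    (he : MemLp e 2 (volume.restrict (Ioo 0 s))) (hz : MemLp z 2 (volume.restrict (Ioo 0 s)))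
    (hm : IntegrableOn m (Ioo 0 s)) (hp : IntegrableOn p (Ioo 0 s))
    (hy : ∀ᵐ t ∂(volume.restrict (Ioo 0 s)), y t = ∫ r in Ioo 0 t, (p r + (2 : ℝ) • m r))
    (hyz : ∀ᵐ t ∂(volume.restrict (Ioo 0 s)), inner ℝ (B (y t)) (e t) = inner ℝ (B (z t)) (z t))
    (h : (∫ t in Ioo 0 s, inner ℝ (ψ t) (U t)) +
      ∫ t in Ioo 0 s, inner ℝ (∫ r in Ioo 0 t, (C (e r) + B (p r))) (e t) = 0) :
    1 / 2 * ‖∫ t in Ioo 0 s, ψ t‖ ^ 2 +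
      1 / 2 * inner ℝ (C (∫ t in Ioo 0 s, e t)) (∫ t in Ioo 0 s, e t) +
      ∫ t in Ioo 0 s, inner ℝ (B (z t)) (z t) =
    2 * ∫ t in Ioo 0 s, inner ℝ (B (m t)) ((∫ r in Ioo 0 s, e r) - ∫ r in Ioo 0 t, e r) := by
  have hei : IntegrableOn e (Ioo 0 s) := he.integrable (by norm_num)
  have e1 : ∫ t in Ioo 0 s, inner ℝ (ψ t) (U t) = 1 / 2 * ‖∫ t in Ioo 0 s, ψ t‖ ^ 2 := by
    rw [← real_inner_self_eq_norm_sq]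
    refine Eq.trans (integral_congr_ae ?_) (integral_bilin_symm_primitive (innerSL ℝ (E := H))
      (fun a b => real_inner_comm _ _) hψ)
    filter_upwards [hU] with t ht
    rw [ht, innerSL_apply_apply]
  have e2 : ∫ t in Ioo 0 s, inner ℝ (C (∫ r in Ioo 0 t, e r)) (e t) =
      1 / 2 * inner ℝ (C (∫ t in Ioo 0 s, e t)) (∫ t in Ioo 0 s, e t) := by
    refine Eq.trans (integral_congr_ae (Eventually.of_forall fun t => ?_))
      (integral_bilin_symm_primitive ((innerSL ℝ (E := S)).comp C)
      (fun a b => ?_) hei)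
    · change inner ℝ (C _) (e t) = inner ℝ (C (e t)) _
      rw [hC, real_inner_comm]
    · change inner ℝ (C a) b = inner ℝ (C b) a
      rw [hC, real_inner_comm]
  -- Fubini moves the time integral off m and onto e. This replaces the irregular strain by
  -- increments of its continuous primitive.
  have e3 : ∫ t in Ioo 0 s, inner ℝ (B (∫ r in Ioo 0 t, m r)) (e t) =
      ∫ t in Ioo 0 s, inner ℝ (B (m t)) ((∫ r in Ioo 0 s, e r) - ∫ r in Ioo 0 t, e r) := by
    refine (integral_bilin_primitive ((innerSL ℝ (E := S)).comp B) hm hei).trans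
      (setIntegral_congr_fun measurableSet_Ioo fun r hr => ?_)
    simp only [ContinuousLinearMap.comp_apply, innerSL_apply_apply]
    rw [← setIntegral_Ioo_add hei ⟨hr.1.le, hr.2.le⟩, add_sub_cancel_left]
  have i1 : IntegrableOn (fun t => inner ℝ (C (∫ r in Ioo 0 t, e r)) (e t)) (Ioo 0 s) :=
    integrableOn_inner_of_bound (C.continuous.comp_continuousOn
      (continuousOn_primitive_Ioo hei)) hei
  have i2 : IntegrableOn (fun t => inner ℝ (B (∫ r in Ioo 0 t, m r)) (e t)) (Ioo 0 s) :=
    integrableOn_inner_of_bound (B.continuous.comp_continuousOn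
      (continuousOn_primitive_Ioo hm)) hei
  have i3 : IntegrableOn (fun t => inner ℝ (B (z t)) (z t)) (Ioo 0 s) :=
    integrable_inner_of_memLp_two (memLp_clm_apply B hz) hz
  -- The primitive of p equals y - 2∫₀ᵗ m, and pairing 𝔹y with e yields the dissipation (𝔹z, z)
  -- because y = Ψ²e and z = Ψe in the application.
  have e4 : ∫ t in Ioo 0 s, inner ℝ (∫ r in Ioo 0 t, (C (e r) + B (p r))) (e t) =
      (∫ t in Ioo 0 s, inner ℝ (C (∫ r in Ioo 0 t, e r)) (e t)) +
      ((∫ t in Ioo 0 s, inner ℝ (B (z t)) (z t)) -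
        2 * ∫ t in Ioo 0 s, inner ℝ (B (∫ r in Ioo 0 t, m r)) (e t)) := by
    rw [← integral_const_mul, ← integral_sub i3 (i2.const_mul 2)]
    refine Eq.trans (integral_congr_ae ?_) (integral_add i1 (i3.sub (i2.const_mul 2)))
    filter_upwards [hy, hyz, ae_restrict_mem measurableSet_Ioo] with t h1 h2 ht
    have hsub : Ioo 0 t ⊆ Ioo 0 s := Ioo_subset_Ioo_right ht.2.le
    have j1 : IntegrableOn e (Ioo 0 t) := hei.mono_set hsub
    have j2 : IntegrableOn p (Ioo 0 t) := hp.mono_set hsub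
    have j3 : IntegrableOn m (Ioo 0 t) := hm.mono_set hsub
    rw [integral_add (integrableOn_clm_apply C j1) (integrableOn_clm_apply B j2),
      ← clm_integral_comm C j1, ← clm_integral_comm B j2, inner_add_left]
    have j4 : ∫ r in Ioo 0 t, (p r + (2 : ℝ) • m r) =
        (∫ r in Ioo 0 t, p r) + (2 : ℝ) • ∫ r in Ioo 0 t, m r :=
      (integral_add j2 (j3.smul (2 : ℝ))).trans (congrArg _ (integral_smul _ _))
    rw [j4] at h1
    rw [← h2, h1, map_add, map_smul, inner_add_left, real_inner_smul_left]
    ring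
  rw [← e3, ← e1, ← e2]
  linarith

/-- The right side of the energy identity is at most a constant times ∫‖z‖‖ξ(t) - ξ(s)‖, so the
Gronwall-type lemma gives ξ = 0. The strain e is the weak derivative of ξ, hence zero, and what
remains of the identity forces the primitive of ψ to vanish. -/
theorem eq_zero_of_energy_identity {T : ℝ} (hT : 0 < T) {B C : S →L[ℝ] S}
    (hC : ∀ a b, inner ℝ (C a) b = inner ℝ a (C b)) {cB cC L : ℝ} (hcB : 0 < cB) (hcC : 0 < cC)
    (hBc : ∀ a, cB * ‖a‖ ^ 2 ≤ inner ℝ (B a) a) (hCc : ∀ a, cC * ‖a‖ ^ 2 ≤ inner ℝ (C a) a)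
    {ψ U : ℝ → H} {e z m p y : ℝ → S} (hψ : IntegrableOn ψ (Ioo 0 T))
    (hU : ∀ᵐ t ∂(volume.restrict (Ioo 0 T)), U t = ∫ r in Ioo 0 t, ψ r)
    (he : MemLp e 2 (volume.restrict (Ioo 0 T))) (hz : MemLp z 2 (volume.restrict (Ioo 0 T)))
    (hm : IntegrableOn m (Ioo 0 T)) (hp : IntegrableOn p (Ioo 0 T))
    (hmz : ∀ᵐ t ∂(volume.restrict (Ioo 0 T)), ‖m t‖ ≤ L * ‖z t‖)
    (hy : ∀ᵐ t ∂(volume.restrict (Ioo 0 T)), y t = ∫ r in Ioo 0 t, (p r + (2 : ℝ) • m r))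
    (hyz : ∀ᵐ t ∂(volume.restrict (Ioo 0 T)), inner ℝ (B (y t)) (e t) = inner ℝ (B (z t)) (z t))
    (h : ∀ s ∈ Icc 0 T, (∫ t in Ioo 0 s, inner ℝ (ψ t) (U t)) +
      ∫ t in Ioo 0 s, inner ℝ (∫ r in Ioo 0 t, (C (e r) + B (p r))) (e t) = 0) :
    (∀ᵐ t ∂(volume.restrict (Ioo 0 T)), U t = 0) ∧
      ∀ᵐ t ∂(volume.restrict (Ioo 0 T)), e t = 0 := by
  have hei : IntegrableOn e (Ioo 0 T) := he.integrable (by norm_num)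
  let ξ : ℝ → S := fun t => ∫ r in Ioo 0 t, e r
  have hξ : ContinuousOn ξ (Icc 0 T) := continuousOn_primitive_Ioo hei
  have hz2 : IntegrableOn (fun t => ‖z t‖ ^ 2) (Ioo 0 T) :=
    (memLp_two_iff_integrable_sq_norm hz.1).1 hz
  have hid : ∀ s ∈ Icc 0 T, 1 / 2 * ‖∫ t in Ioo 0 s, ψ t‖ ^ 2 +
      1 / 2 * inner ℝ (C (ξ s)) (ξ s) + ∫ t in Ioo 0 s, inner ℝ (B (z t)) (z t) =
      2 * ∫ t in Ioo 0 s, inner ℝ (B (m t)) (ξ s - ξ t) := fun s hs => by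
    have hsub : Ioo 0 s ⊆ Ioo 0 T := Ioo_subset_Ioo_right hs.2
    have hle := Measure.restrict_mono_set (volume : Measure ℝ) hsub
    exact energy_identity hC (hψ.mono_set hsub)
      (ae_restrict_of_ae_restrict_of_subset hsub hU) (he.mono_measure hle) (hz.mono_measure hle)
      (hm.mono_set hsub) (hp.mono_set hsub) (ae_restrict_of_ae_restrict_of_subset hsub hy)
      (ae_restrict_of_ae_restrict_of_subset hsub hyz) (h s hs)
  have hBz : ∀ s ∈ Icc 0 T, cB * ∫ t in Ioo 0 s, ‖z t‖ ^ 2 ≤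
      ∫ t in Ioo 0 s, inner ℝ (B (z t)) (z t) := fun s hs => by
    have hsub : Ioo 0 s ⊆ Ioo 0 T := Ioo_subset_Ioo_right hs.2
    have hz' := hz.mono_measure (Measure.restrict_mono_set (volume : Measure ℝ) hsub)
    rw [← integral_const_mul]
    exact integral_mono ((hz2.mono_set hsub).const_mul _)
      (integrable_inner_of_memLp_two (memLp_clm_apply B hz') hz') fun t => hBc _
  -- The kinetic term is nonnegative and discarded here; it is recovered once ξ = 0 is known.
  have hξ0 : ∀ s ∈ Icc 0 T, ξ s = 0 := by
    refine eq_zero_of_energy_inequality (C := 2 * (‖B‖ * L)) (half_pos hcC) hcB hz.1 hz2 hξ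
      (fun s hs => ?_) (by simp [ξ])
    have hsub : Ioo 0 s ⊆ Ioo 0 T := Ioo_subset_Ioo_right hs.2
    have hz' := hz.mono_measure (Measure.restrict_mono_set (volume : Measure ℝ) hsub)
    have hzi : IntegrableOn (fun t => ‖z t‖) (Ioo 0 s) := hz'.norm.integrable (by norm_num)
    have hcont : ContinuousOn (fun t => ‖ξ t - ξ s‖) (Icc 0 s) :=
      ((hξ.mono (Icc_subset_Icc_right hs.2)).sub continuousOn_const).norm
    have hprod : IntegrableOn (fun t => ‖z t‖ * ‖ξ t - ξ s‖) (Ioo 0 s) := by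
      obtain ⟨M, hM⟩ := (isCompact_Icc (a := 0) (b := s)).exists_bound_of_continuousOn hcont
      refine Integrable.mul_bdd (c := M) hzi
        ((hcont.mono Ioo_subset_Icc_self).aestronglyMeasurable measurableSet_Ioo) ?_
      filter_upwards [ae_restrict_mem measurableSet_Ioo] with t ht
      exact hM t (Ioo_subset_Icc_self ht)
    have hrhs : ∫ t in Ioo 0 s, inner ℝ (B (m t)) (ξ s - ξ t) ≤
        ‖B‖ * L * ∫ t in Ioo 0 s, ‖z t‖ * ‖ξ t - ξ s‖ := by
      rw [← integral_const_mul]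
      refine (Real.le_norm_self _).trans (norm_integral_le_of_norm_le (hprod.const_mul _) ?_)
      filter_upwards [ae_restrict_of_ae_restrict_of_subset hsub hmz] with t ht
      calc ‖(inner ℝ (B (m t)) (ξ s - ξ t) : ℝ)‖ ≤ ‖B (m t)‖ * ‖ξ s - ξ t‖ :=
            norm_inner_le_norm _ _
        _ ≤ ‖B‖ * (L * ‖z t‖) * ‖ξ t - ξ s‖ := by
            rw [norm_sub_rev]
            gcongr
            exact (B.le_opNorm _).trans (by gcongr)
        _ = ‖B‖ * L * (‖z t‖ * ‖ξ t - ξ s‖) := by ring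
    have h1 := hid s hs
    have h2 := hBz s hs
    have h3 := hCc (ξ s)
    have h4 : 0 ≤ ‖∫ t in Ioo 0 s, ψ t‖ ^ 2 := by positivity
    linarith
  -- The vanishing function ξ has both e and 0 as weak derivatives, so they agree.
  have he0 : ∀ᵐ t ∂(volume.restrict (Ioo 0 T)), e t = 0 := by
    have d1 : IsWeakTimeDeriv T ξ e := isWeakTimeDeriv_of_primitive (c := 0) hT.le hei
      (Eventually.of_forall fun t => (zero_add _).symm)
    have d2 : IsWeakTimeDeriv T ξ fun _ => 0 := by
      refine isWeakTimeDeriv_of_primitive (c := 0) hT.le (integrable_zero _ _ _) ?_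
      filter_upwards [ae_restrict_mem measurableSet_Ioo] with t ht
      simp [hξ0 t (Ioo_subset_Icc_self ht)]
    exact d1.unique hei (integrable_zero _ _ _) d2
  refine ⟨?_, he0⟩
  filter_upwards [hU, ae_restrict_mem measurableSet_Ioo] with t h1 ht
  have ht' := Ioo_subset_Icc_self ht
  have h2 := hid t ht'
  have h3 := hBz t ht'
  have h4 : 0 ≤ cB * ∫ r in Ioo 0 t, ‖z r‖ ^ 2 := by
    have : 0 ≤ ∫ r in Ioo 0 t, ‖z r‖ ^ 2 := integral_nonneg fun _ => by positivity
    positivity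
  have h5 : ∫ r in Ioo 0 t, inner ℝ (B (m r)) (ξ t - ξ r) = 0 := by
    rw [setIntegral_congr_fun (g := fun _ => (0 : ℝ)) measurableSet_Ioo fun r hr => ?_]
    · simp
    · simp [hξ0 t ht', hξ0 r ⟨hr.1.le, (hr.2.trans ht.2).le⟩]
  rw [h5, hξ0 t ht', inner_zero_right] at h2
  rw [h1, ← norm_eq_zero, ← sq_eq_zero_iff]
  have h6 : 0 ≤ ‖∫ r in Ioo 0 t, ψ r‖ ^ 2 := by positivity
  linarith

end EnergyIdentity

/-! ### Tensor fields as operators on L² -/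

section TensorFields

variable {d : ℕ} {Ω : Set (Vec d)} {A : Vec d → (SymMat d →L[ℝ] SymMat d)}

open Classical in
/-- The action on `L²` of a field of fourth-order tensors. -/
def tensorOp (Ω : Set (Vec d)) (A : Vec d → (SymMat d →L[ℝ] SymMat d)) : L2Sym Ω →L[ℝ] L2Sym Ω :=
  if h : MemLp A ∞ (volume.restrict Ω) then
    (ContinuousLinearMap.id ℝ (SymMat d →L[ℝ] SymMat d)).holderL (volume.restrict Ω) ∞ 2 2
      (h.toLp A) else 0

theorem coeFn_tensorOp (hA : MemLp A ∞ (volume.restrict Ω)) (f : L2Sym Ω) :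
    tensorOp Ω A f =ᵐ[volume.restrict Ω] fun x => A x (f x) := by
  rw [tensorOp, dif_pos hA, ContinuousLinearMap.holderL_apply_apply]
  filter_upwards [ContinuousLinearMap.coeFn_holder (𝕜 := ℝ) (E := SymMat d →L[ℝ] SymMat d)
    (F := SymMat d) (G := SymMat d) (r := 2) (ContinuousLinearMap.id ℝ (SymMat d →L[ℝ] SymMat d)) (hA.toLp A) f,
    MemLp.coeFn_toLp (E := SymMat d →L[ℝ] SymMat d) hA] with x h1 h2
  rw [h1, h2]
  rfl

namespace IsTensorField

theorem inner_tensorOp_left (h : IsTensorField Ω A) (f g : L2Sym Ω) :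
    inner ℝ (tensorOp Ω A f) g = inner ℝ f (tensorOp Ω A g) := by
  rw [L2.inner_def, L2.inner_def]
  refine integral_congr_ae ?_
  filter_upwards [coeFn_tensorOp h.bounded f, coeFn_tensorOp h.bounded g, h.symmetric]
    with x h1 h2 h3
  rw [h1, h2, h3]

theorem exists_coercive (h : IsTensorField Ω A) :
    ∃ c : ℝ, 0 < c ∧ ∀ f : L2Sym Ω, c * ‖f‖ ^ 2 ≤ inner ℝ (tensorOp Ω A f) f := by
  obtain ⟨c, hc, h0⟩ := h.coercive
  refine ⟨c, hc, fun f => ?_⟩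
  rw [L2.inner_def, lp_norm_sq_eq_integral, ← integral_const_mul]
  refine integral_mono_ae ((integrable_norm_sq_lp f).const_mul c)
    (L2.integrable_inner (𝕜 := ℝ) (tensorOp Ω A f) f) ?_
  filter_upwards [coeFn_tensorOp h.bounded f, h0] with x h1 h2
  rw [h1]
  exact h2 _

theorem tensorOp_mulOp (h : IsTensorField Ω A) {a : Vec d → ℝ}
    (ha : MemLp a ∞ (volume.restrict Ω)) (f : L2Sym Ω) :
    tensorOp Ω A (mulOp _ (SymMat d) a f) = mulOp _ (SymMat d) a (tensorOp Ω A f) := by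
  refine Lp.ext ?_
  filter_upwards [coeFn_tensorOp h.bounded (mulOp _ (SymMat d) a f), coeFn_mulOp ha f,
    coeFn_mulOp ha (tensorOp Ω A f), coeFn_tensorOp h.bounded f] with x h1 h2 h3 h4
  rw [h1, h2, h3, h4, map_smul]

/-- Multiplication by a scalar function commutes with the tensor and is symmetric, so one factor a
moves to the other side. With a = Ψ this gives the coercive viscous term. -/
theorem inner_tensorOp_mulOp_mulOp (h : IsTensorField Ω A) {a : Vec d → ℝ}
    (ha : MemLp a ∞ (volume.restrict Ω)) (f : L2Sym Ω) :
    inner ℝ (tensorOp Ω A (mulOp _ (SymMat d) a (mulOp _ (SymMat d) a f))) f =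
      inner ℝ (tensorOp Ω A (mulOp _ (SymMat d) a f)) (mulOp _ (SymMat d) a f) := by
  rw [h.tensorOp_mulOp ha, inner_mulOp_left ha]

theorem integral_inner (h : IsTensorField Ω A) (f g : L2Sym Ω) :
    ∫ x in Ω, inner ℝ (A x (f x)) (g x) = inner ℝ (tensorOp Ω A f) g := by
  rw [L2.inner_def]
  refine integral_congr_ae ?_
  filter_upwards [coeFn_tensorOp h.bounded f] with x h1
  rw [h1]

end IsTensorField

end TensorFields

/-! ### Closed subspaces of the energy space -/

section Spaces

variable {d : ℕ}

theorem PairSpace.norm_fst_le {Ω : Set (Vec d)} (p : PairSpace Ω) : ‖p.fst‖ ≤ ‖p‖ := by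
  rw [← sq_le_sq₀ (norm_nonneg _) (norm_nonneg _), p.norm_sq]
  exact le_add_of_nonneg_right (by positivity)

theorem PairSpace.norm_snd_le {Ω : Set (Vec d)} (p : PairSpace Ω) : ‖p.snd‖ ≤ ‖p‖ := by
  refine (sq_le_sq₀ (norm_nonneg p.snd) (norm_nonneg p)).1 ?_
  rw [p.norm_sq]
  exact le_add_of_nonneg_left (sq_nonneg _)

/-- The first component of a pair, as a continuous linear map. -/
def fstCLM (Ω : Set (Vec d)) : PairSpace Ω →L[ℝ] L2Vec Ω :=
  LinearMap.mkContinuous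
    ({ toFun := PairSpace.fst
       map_add' := fun p q => PairSpace.add_fst p q
       map_smul' := fun c p => PairSpace.smul_fst c p } : PairSpace Ω →ₗ[ℝ] L2Vec Ω) 1
    fun p => (PairSpace.norm_fst_le p).trans_eq (one_mul _).symm

/-- The second component of a pair, as a continuous linear map. -/
def sndCLM (Ω : Set (Vec d)) : PairSpace Ω →L[ℝ] L2Sym Ω :=
  LinearMap.mkContinuous (𝕜 := ℝ) (𝕜₂ := ℝ) (σ := RingHom.id ℝ) (E := PairSpace Ω) (F := L2Sym Ω)
    ({ toFun := PairSpace.snd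
       map_add' := fun p q => PairSpace.add_snd p q
       map_smul' := fun c p => PairSpace.smul_snd c p } : PairSpace Ω →ₗ[ℝ] L2Sym Ω) 1
    fun p => (PairSpace.norm_snd_le p).trans_eq (one_mul _).symm

/-- Each test function imposes the equality of two continuous functionals of the pair. Closedness
supplies completeness, so Bochner integrals stay in the space. -/
theorem isClosed_symGradSpace {Ω : Set (Vec d)} (hΩo : IsOpen Ω) (hΩ : Bornology.IsBounded Ω)
    (K : Set (Vec d)) : IsClosed (symGradSpace Ω K : Set (PairSpace Ω)) := by
  have := isFiniteMeasure_restrict_of_isBounded hΩ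
  have e : (symGradSpace Ω K : Set (PairSpace Ω)) =
      {p | ∀ η : Vec d → ℝ, ContDiff ℝ ∞ η → HasCompactSupport η → tsupport η ⊆ Ω \ K →
        ∀ i j : Fin d, integralL2 _ (mulOp _ ℝ η (compSym Ω i j (sndCLM Ω p))) =
        -((1 / 2) * (integralL2 _ (mulOp _ ℝ (partialX j η) (compVec Ω i (fstCLM Ω p))) +
          integralL2 _ (mulOp _ ℝ (partialX i η) (compVec Ω j (fstCLM Ω p)))))} := by
    ext p
    exact isSymGrad_iff_integralL2 hΩo hΩ
  rw [e]
  simp only [ofPred_forall]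
  refine isClosed_iInter fun η => isClosed_iInter fun _ => isClosed_iInter fun _ =>
    isClosed_iInter fun _ => isClosed_iInter fun i => isClosed_iInter fun j =>
    isClosed_eq ?_ ?_
  · fun_prop
  · fun_prop

namespace CrackedBody

variable (D : CrackedBody d)

instance completeSpace_X : CompleteSpace D.X :=
  (isClosed_symGradSpace D.isOpen_Ω D.isBounded_Ω D.Γ).completeSpace_coe

/-- The map `(v, E v) ↦ v`. -/
def fnCLM : D.X →L[ℝ] L2Vec D.Ω := (fstCLM D.Ω).comp (symGradSpace D.Ω D.Γ).subtypeL

/-- The map `(v, E v) ↦ E v`. -/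
def eCLM : D.X →L[ℝ] L2Sym D.Ω := (sndCLM D.Ω).comp (symGradSpace D.Ω D.Γ).subtypeL

theorem fnCLM_apply (p : D.X) : D.fnCLM p = p.fn := rfl

theorem eCLM_apply (p : D.X) : D.eCLM p = p.E := rfl

theorem X_eq_zero {D : CrackedBody d} {p : D.X} (h1 : p.fn = 0) (h2 : p.E = 0) : p = 0 := by
  have h := (p : PairSpace D.Ω).norm_sq
  rw [show (p : PairSpace D.Ω).fst = 0 from h1, show (p : PairSpace D.Ω).snd = 0 from h2] at h
  simpa using h

/-- The restriction of the trace to the Dirichlet part of the boundary. -/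
def dirichletTrace : D.X →L[ℝ] Lp (Vec d) 2 ((surface (frontier D.Ω)).restrict D.dirichlet) :=
  (LpToLpRestrictCLM (Vec d) (Vec d) ℝ (surface (frontier D.Ω)) 2 D.dirichlet).comp
    (trace D.Ω D.Γ)

/-- The space `V_t^D` as a subspace. -/
def dirichletSpace (t : ℝ) : Submodule ℝ D.X :=
  (symGradSpace D.Ω (D.crack t)).comap (symGradSpace D.Ω D.Γ).subtype ⊓
    LinearMap.ker D.dirichletTrace.toLinearMap

/-- Only boundedness and linearity of the trace enter, so this holds also for its default value 0.
-/
theorem isClosed_dirichletSpace (t : ℝ) : IsClosed (D.dirichletSpace t : Set D.X) := by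
  refine IsClosed.inter ?_ D.dirichletTrace.isClosed_ker
  exact (isClosed_symGradSpace D.isOpen_Ω D.isBounded_Ω _).preimage continuous_subtype_val

/-- The surface measure of the Dirichlet part is the restriction of that of the whole boundary, so
vanishing there means that the restricted trace is zero in L². -/
theorem mem_dirichletSpace {t : ℝ} {p : D.X} : p ∈ D.dirichletSpace t ↔ p ∈ D.VD t := by
  refine and_congr Iff.rfl ?_
  have e : surface D.dirichlet = (surface (frontier D.Ω)).restrict D.dirichlet := by
    rw [surface, surface, Measure.restrict_restrict D.measurableSet_dirichlet,
      inter_eq_left.2 D.dirichlet_subset]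
  have hr := LpToLpRestrictCLM_coeFn ℝ D.dirichlet (trace D.Ω D.Γ p)
  rw [e]
  change LpToLpRestrictCLM (Vec d) (Vec d) ℝ (surface (frontier D.Ω)) 2 D.dirichlet
    (trace D.Ω D.Γ p) = 0 ↔ _
  rw [Lp.eq_zero_iff_ae_eq_zero]
  constructor
  · intro h
    filter_upwards [h, hr] with x h1 h2
    rw [← h2, h1, Pi.zero_apply]
  · intro h
    filter_upwards [h, hr] with x h1 h2
    rw [h2, h1, Pi.zero_apply]

end CrackedBody

end Spaces

theorem tendsto_average_of_le {T : ℝ} (hT : 0 < T) {F G : ℝ → ℝ} (hF : ∀ t, 0 ≤ F t)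
    (hG : IntegrableOn G (Ioo 0 T)) (h : ∀ᵐ t ∂(volume.restrict (Ioo 0 T)), F t ≤ G t)
    (h0 : Tendsto (fun s : ℝ => (1 / s) * ∫ t in Ioo 0 s, G t) (𝓝[>] 0) (𝓝 0)) :
    Tendsto (fun s : ℝ => (1 / s) * ∫ t in Ioo 0 s, F t) (𝓝[>] 0) (𝓝 0) := by
  refine squeeze_zero' ?_ ?_ h0
  · filter_upwards [self_mem_nhdsWithin] with s hs
    exact mul_nonneg (one_div_nonneg.2 (le_of_lt hs)) (integral_nonneg hF)
  · filter_upwards [Ioo_mem_nhdsGT hT] with s hs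
    have hsub : Ioo 0 s ⊆ Ioo 0 T := Ioo_subset_Ioo_right hs.2.le
    refine mul_le_mul_of_nonneg_left ?_ (one_div_nonneg.2 hs.1.le)
    exact integral_mono_of_nonneg (Eventually.of_forall hF) (hG.mono_set hsub)
      (ae_restrict_of_ae_restrict_of_subset hsub h)

theorem integrableOn_norm_sq {Y : Type*} [NormedAddCommGroup Y] {T : ℝ} {F : ℝ → Y}
    (hF : MemLp F 2 (volume.restrict (Ioo 0 T))) : IntegrableOn (fun t => ‖F t‖ ^ 2) (Ioo 0 T) :=
  (memLp_two_iff_integrable_sq_norm hF.1).1 hF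

theorem IsMultiplier.norm_sq_apply_apply_le {d : ℕ} {Ω : Set (Vec d)} {Y : Type*}
    [NormedAddCommGroup Y] [InnerProductSpace ℝ Y] {T M : ℝ} {a : ℝ × Vec d → ℝ}
    (h : IsMultiplier T Ω a M) (hΩo : IsOpen Ω) {t : ℝ} (ht : t ∈ Ioo 0 T)
    (g : Lp Y 2 (volume.restrict Ω)) :
    ‖sliceOp Ω Y a t (sliceOp Ω Y a t g)‖ ^ 2 ≤ (M * M) ^ 2 * ‖g‖ ^ 2 := by
  have i1 := h.norm_apply_le hΩo ht g
  have i2 := h.norm_apply_le hΩo ht (sliceOp Ω Y a t g)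
  have i3 : ‖sliceOp Ω Y a t (sliceOp Ω Y a t g)‖ ≤ |M| * (|M| * ‖g‖) :=
    i2.trans (mul_le_mul (le_abs_self M) (i1.trans (mul_le_mul_of_nonneg_right (le_abs_self M)
      (norm_nonneg g))) (norm_nonneg _) (abs_nonneg M))
  refine (pow_le_pow_left₀ (norm_nonneg _) i3 2).trans_eq ?_
  rw [mul_pow, mul_pow, sq_abs]
  ring

/-! ### The homogeneous problem -/

section Homogeneous

variable {d : ℕ} {D : CrackedBody d}

theorem norm_fn_sq_le (p : D.X) : ‖p.fn‖ ^ 2 ≤ ‖p‖ ^ 2 :=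
  (le_add_of_nonneg_right (sq_nonneg _)).trans_eq (p : PairSpace D.Ω).norm_sq.symm

theorem norm_E_sq_le (p : D.X) : ‖p.E‖ ^ 2 ≤ ‖p‖ ^ 2 :=
  (le_add_of_nonneg_left (sq_nonneg _)).trans_eq (p : PairSpace D.Ω).norm_sq.symm

/-- The curve `Ψ (E q - ∇Ψ ⊙ u̇)`, where `q = Ψ u̇`. -/
def viscousStrain (D : CrackedBody d) (f : ℝ × Vec d → ℝ) (ψ : ℝ → L2Vec D.Ω) (q : ℝ → D.X)
    (t : ℝ) : L2Sym D.Ω :=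
  sliceOp D.Ω (SymMat d) f t ((q t).E - symGradOp D.Ω f t (ψ t))

theorem memLp_viscousStrain {f : ℝ × Vec d → ℝ} {L : ℝ≥0} (hf : LipschitzWith L f)
    {ψ : ℝ → L2Vec D.Ω} {q : ℝ → D.X} (hψ : MemL2 D.T ψ) (hq : MemL2 D.T q) :
    MemLp (viscousStrain D f ψ q) 2 (volume.restrict (Ioo 0 D.T)) := by
  obtain ⟨C, hC⟩ := exists_isMultiplier_of_continuous D.T D.isBounded_Ω hf.continuous
  have h1 : MemLp (fun t => (q t).E) 2 (volume.restrict (Ioo 0 D.T)) :=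
    memLp_clm_apply (W := L2Sym D.Ω) D.eCLM hq
  exact hC.memLp_curve D.isOpen_Ω D.isBounded_Ω
    (h1.sub (memLp_symGradOp D.isOpen_Ω D.isBounded_Ω hf hψ))

theorem memLp_stress (B C : Vec d → (SymMat d →L[ℝ] SymMat d)) {f : ℝ × Vec d → ℝ} {L : ℝ≥0}
    (hf : LipschitzWith L f) {u q : ℝ → D.X} {ψ : ℝ → L2Vec D.Ω} (hu : MemL2 D.T u)
    (hψ : MemL2 D.T ψ) (hq : MemL2 D.T q) :
    MemLp (fun t => tensorOp D.Ω C (u t).E + tensorOp D.Ω B (viscousStrain D f ψ q t)) 2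
      (volume.restrict (Ioo 0 D.T)) := by
  have he : MemLp (fun t => (u t).E) 2 (volume.restrict (Ioo 0 D.T)) :=
    memLp_clm_apply (W := L2Sym D.Ω) D.eCLM hu
  have h1 : MemLp (fun t => tensorOp D.Ω C (u t).E) 2 (volume.restrict (Ioo 0 D.T)) :=
    memLp_clm_apply (V := L2Sym D.Ω) (W := L2Sym D.Ω) (tensorOp D.Ω C) he
  have h2 : MemLp (fun t => tensorOp D.Ω B (viscousStrain D f ψ q t)) 2
      (volume.restrict (Ioo 0 D.T)) :=
    memLp_clm_apply (V := L2Sym D.Ω) (W := L2Sym D.Ω) (tensorOp D.Ω B)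
      (memLp_viscousStrain hf hψ hq)
  exact h1.add h2

/-- The weak derivative determines Ψ²Eu up to a constant. That constant is zero because ‖Ψ²Eu‖² is
dominated by a multiple of ‖u‖², whose averages tend to 0 at the initial time. -/
theorem sq_mul_symGrad_eq_primitive {f : ℝ × Vec d → ℝ} {L : ℝ≥0}
    (hf : LipschitzWith L f) {u q : ℝ → D.X} {ψ : ℝ → L2Vec D.Ω} (hu : MemL2 D.T u)
    (hψ : MemL2 D.T ψ) (hq : MemL2 D.T q)
    (hqv : ∀ᵐ t ∂(volume.restrict (Ioo 0 D.T)), (q t).fn = sliceOp D.Ω (Vec d) f t (ψ t))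
    (h0 : Tendsto (fun h : ℝ => (1 / h) * ∫ t in Ioo 0 h, (‖u t‖ ^ 2 + ‖ψ t‖ ^ 2))
      (𝓝[>] 0) (𝓝 0))
    (hprim : ∀ᵐ t ∂(volume.restrict (Ioo 0 D.T)), (u t).fn = ∫ r in Ioo 0 t, ψ r) :
    ∀ᵐ t ∂(volume.restrict (Ioo 0 D.T)),
      sliceOp D.Ω (SymMat d) f t (sliceOp D.Ω (SymMat d) f t (u t).E) =
        ∫ r in Ioo 0 t, (viscousStrain D f ψ q r +
          (2 : ℝ) • sliceOp D.Ω (SymMat d) (fun z => fderiv ℝ f z (1, 0)) r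
            (sliceOp D.Ω (SymMat d) f r (u r).E)) := by
  have hfin := isFiniteMeasure_restrict_of_isBounded D.isBounded_Ω
  have hΩo := D.isOpen_Ω
  have hΩ := D.isBounded_Ω
  have hT := D.T_pos
  obtain ⟨M, hM⟩ := exists_isMultiplier_of_continuous D.T hΩ hf.continuous
  have hDt := isMultiplier_fderiv D.T D.Ω hf (1, 0)
  have he : MemLp (fun t => (u t).E) 2 (volume.restrict (Ioo 0 D.T)) :=
    memLp_clm_apply (W := L2Sym D.Ω) D.eCLM hu
  have hqe : MemLp (fun t => (q t).E) 2 (volume.restrict (Ioo 0 D.T)) :=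
    memLp_clm_apply (W := L2Sym D.Ω) D.eCLM hq
  have hz := hM.memLp_curve hΩo hΩ he
  have hy := hM.memLp_curve hΩo hΩ hz
  have hm := hDt.memLp_curve hΩo hΩ hz
  have hp := memLp_viscousStrain hf hψ hq
  have h0' : Tendsto (fun h : ℝ => (1 / h) * ∫ t in Ioo 0 h, (M * M) ^ 2 *
      (‖u t‖ ^ 2 + ‖ψ t‖ ^ 2)) (𝓝[>] 0) (𝓝 0) := by
    have := h0.const_mul ((M * M) ^ 2)
    rw [mul_zero] at this
    refine this.congr fun h => ?_
    rw [integral_const_mul]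
    ring
  have hmaj : IntegrableOn (fun t => (M * M) ^ 2 * (‖u t‖ ^ 2 + ‖ψ t‖ ^ 2)) (Ioo 0 D.T) :=
    ((integrableOn_norm_sq hu).add (integrableOn_norm_sq hψ)).const_mul _
  have a3 := tendsto_average_of_le (F := fun t => ‖sliceOp D.Ω (SymMat d) f t
      (sliceOp D.Ω (SymMat d) f t (u t).E)‖ ^ 2) hT (fun t => sq_nonneg _) hmaj (by
      filter_upwards [ae_restrict_mem measurableSet_Ioo] with t ht
      refine (hM.norm_sq_apply_apply_le hΩo ht (u t).E).trans
        (mul_le_mul_of_nonneg_left ?_ (sq_nonneg _))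
      exact (norm_E_sq_le (u t)).trans (le_add_of_nonneg_right (sq_nonneg ‖ψ t‖))) h0'
  -- Here K is the full set Γ: every element of the ambient space has its symmetrized gradient off
  -- Γ, which is closed and null.
  have hder := isWeakTimeDeriv_sq_mul_symGrad (K := D.Γ) hΩo hΩ D.isClosed_Γ D.volume_Γ
    (hψ.integrable (by norm_num)) hprim (Eventually.of_forall fun t => (u t).2)
    (he.integrable (by norm_num)) hf hqv (Eventually.of_forall fun t => (q t).2)
    (hqe.integrable (by norm_num))
  have hpi : IntegrableOn (viscousStrain D f ψ q) (Ioo 0 D.T) := hp.integrable (by norm_num)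
  have hmi : IntegrableOn (fun t => sliceOp D.Ω (SymMat d) (fun z => fderiv ℝ f z (1, 0)) t
      (sliceOp D.Ω (SymMat d) f t (u t).E)) (Ioo 0 D.T) := hm.integrable (by norm_num)
  exact hder.eq_primitive hT (hy.integrable (by norm_num)) (hpi.add (hmi.smul (2 : ℝ)))
    (integrableOn_norm_sq hy) a3

/-- The abstract energy argument applied with z = ΨEu, m = Ψ̇ΨEu, y = Ψ²Eu and p the viscous strain.
It yields both components of u, the function and its symmetrized gradient. -/
theorem eq_zero_of_homogeneous {B C : Vec d → (SymMat d →L[ℝ] SymMat d)}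
    (hB : IsTensorField D.Ω B) (hC : IsTensorField D.Ω C) {f : ℝ × Vec d → ℝ} {L : ℝ≥0}
    (hf : LipschitzWith L f) {u q : ℝ → D.X} {ψ : ℝ → L2Vec D.Ω} (hu : MemL2 D.T u)
    (huW : ∀ᵐ t ∂(volume.restrict (Ioo 0 D.T)), u t ∈ D.dirichletSpace 0)
    (hψ : D.IsDot u ψ) (hq : MemL2 D.T q)
    (hqv : ∀ᵐ t ∂(volume.restrict (Ioo 0 D.T)), (q t).fn = sliceOp D.Ω (Vec d) f t (ψ t))
    (h0 : Tendsto (fun h : ℝ => (1 / h) * ∫ t in Ioo 0 h, (‖u t‖ ^ 2 + ‖ψ t‖ ^ 2))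
      (𝓝[>] 0) (𝓝 0))
    (heq : ∀ v : ℝ → D.X, MemLp v 2 (volume.restrict (Ioo 0 D.T)) →
      (∀ᵐ t ∂(volume.restrict (Ioo 0 D.T)), v t ∈ D.dirichletSpace 0) →
      ∫ t in Ioo 0 D.T, v t = 0 →
      -(∫ t in Ioo 0 D.T, inner ℝ (ψ t) (D.fnCLM (v t))) +
        ∫ t in Ioo 0 D.T, inner ℝ (tensorOp D.Ω C (u t).E +
          tensorOp D.Ω B (viscousStrain D f ψ q t)) (D.eCLM (∫ r in Ioo 0 t, v r)) = 0) :
    ∀ᵐ t ∂(volume.restrict (Ioo 0 D.T)), u t = 0 := by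
  have hfin := isFiniteMeasure_restrict_of_isBounded D.isBounded_Ω
  have hΩo := D.isOpen_Ω
  have hΩ := D.isBounded_Ω
  have hT := D.T_pos
  obtain ⟨M, hM⟩ := exists_isMultiplier_of_continuous D.T hΩ hf.continuous
  have hDt := isMultiplier_fderiv D.T D.Ω hf (1, 0)
  have hfn : MemLp (fun t => (u t).fn) 2 (volume.restrict (Ioo 0 D.T)) :=
    memLp_clm_apply D.fnCLM hu
  have he : MemLp (fun t => (u t).E) 2 (volume.restrict (Ioo 0 D.T)) :=
    memLp_clm_apply (W := L2Sym D.Ω) D.eCLM hu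
  have hz := hM.memLp_curve hΩo hΩ he
  have hm := hDt.memLp_curve hΩo hΩ hz
  have hp := memLp_viscousStrain hf hψ.1 hq
  have hu2 := integrableOn_norm_sq hu
  have hψ2 := integrableOn_norm_sq hψ.1
  have a1 := tendsto_average_of_le (F := fun t => ‖ψ t‖ ^ 2) hT (fun t => by positivity)
    (hu2.add hψ2) (Eventually.of_forall fun t => le_add_of_nonneg_left (sq_nonneg ‖u t‖)) h0
  have a2 := tendsto_average_of_le (F := fun t => ‖(u t).fn‖ ^ 2) hT (fun t => by positivity)
    (hu2.add hψ2) (Eventually.of_forall fun t =>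
      (norm_fn_sq_le (u t)).trans (le_add_of_nonneg_right (sq_nonneg ‖ψ t‖))) h0
  have hprim := hψ.2.eq_primitive hT (hfn.integrable (by norm_num)) (hψ.1.integrable (by norm_num))
    (integrableOn_norm_sq hfn) a2
  have hpi : IntegrableOn (viscousStrain D f ψ q) (Ioo 0 D.T) := hp.integrable (by norm_num)
  have hmi : IntegrableOn (fun t => sliceOp D.Ω (SymMat d) (fun z => fderiv ℝ f z (1, 0)) t
      (sliceOp D.Ω (SymMat d) f t (u t).E)) (Ioo 0 D.T) := hm.integrable (by norm_num)
  have hyprim := sq_mul_symGrad_eq_primitive hf hu hψ.1 hq hqv h0 hprim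
  obtain ⟨cB, hcB, hBc⟩ := hB.exists_coercive
  obtain ⟨cC, hcC, hCc⟩ := hC.exists_coercive
  have hg : MemLp (fun t => tensorOp D.Ω C (u t).E + tensorOp D.Ω B (viscousStrain D f ψ q t)) 2
      (volume.restrict (Ioo 0 D.T)) := memLp_stress B C hf hu hψ.1 hq
  have hmz : ∀ᵐ t ∂(volume.restrict (Ioo 0 D.T)), ‖sliceOp D.Ω (SymMat d)
      (fun z => fderiv ℝ f z (1, 0)) t (sliceOp D.Ω (SymMat d) f t (u t).E)‖ ≤
      L * ‖((1 : ℝ), (0 : Vec d))‖ * ‖sliceOp D.Ω (SymMat d) f t (u t).E‖ := by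
    filter_upwards [ae_restrict_mem measurableSet_Ioo] with t ht
    exact hDt.norm_apply_le hΩo ht _
  have hyz : ∀ᵐ t ∂(volume.restrict (Ioo 0 D.T)), inner ℝ (tensorOp D.Ω B
      (sliceOp D.Ω (SymMat d) f t (sliceOp D.Ω (SymMat d) f t (u t).E))) (u t).E =
      inner ℝ (tensorOp D.Ω B (sliceOp D.Ω (SymMat d) f t (u t).E))
        (sliceOp D.Ω (SymMat d) f t (u t).E) := by
    filter_upwards [ae_restrict_mem measurableSet_Ioo] with t ht
    exact hB.inner_tensorOp_mulOp_mulOp (hM.memLp_slice hΩo ht) (u t).E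
  have hid : ∀ s ∈ Icc 0 D.T, (∫ t in Ioo 0 s, inner ℝ (ψ t) (u t).fn) +
      ∫ t in Ioo 0 s, inner ℝ (∫ r in Ioo 0 t, (tensorOp D.Ω C (u r).E +
        tensorOp D.Ω B (viscousStrain D f ψ q r))) (u t).E = 0 := fun s hs => by
    have h := integral_velocity_add_integral_primitive_eq_zero (H := L2Vec D.Ω) (S := L2Sym D.Ω)
      (X := D.X) (g := fun t => tensorOp D.Ω C (u t).E + tensorOp D.Ω B (viscousStrain D f ψ q t))
      hT D.fnCLM D.eCLM (D.isClosed_dirichletSpace 0) hu huW hψ.1 a1 hg heq hs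
    simp only [CrackedBody.fnCLM_apply, CrackedBody.eCLM_apply] at h
    exact h
  have hfinal := eq_zero_of_energy_identity (H := L2Vec D.Ω) (S := L2Sym D.Ω)
    (U := fun t => (u t).fn) (e := fun t => (u t).E)
    (z := fun t => sliceOp D.Ω (SymMat d) f t (u t).E)
    (m := fun t => sliceOp D.Ω (SymMat d) (fun z => fderiv ℝ f z (1, 0)) t
      (sliceOp D.Ω (SymMat d) f t (u t).E)) (p := viscousStrain D f ψ q)
    (y := fun t => sliceOp D.Ω (SymMat d) f t (sliceOp D.Ω (SymMat d) f t (u t).E))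
    hT hC.inner_tensorOp_left hcB hcC hBc hCc (hψ.1.integrable (by norm_num)) hprim he hz hmi hpi
    hmz hyprim hyz hid
  filter_upwards [hfinal.1, hfinal.2] with t h1 h2
  exact CrackedBody.X_eq_zero h1 h2

end Homogeneous

theorem inner_add_apply_apply_sub {S : Type*} [NormedAddCommGroup S] [InnerProductSpace ℝ S]
    (A B : S →L[ℝ] S) (a b c e : S) : inner ℝ (a + B (A (b - c))) e =
      inner ℝ a e + (inner ℝ (B (A b)) e - inner ℝ (B (A c)) e) := by
  rw [map_sub, map_sub, inner_add_left, inner_sub_left]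

/-! ### The weak formulation in operator form -/

section WeakFormulation

variable {d : ℕ} {D : CrackedBody d}

/-- An extension to the whole of space-time lets mollification and Rademacher's theorem apply
without boundary effects. Inside the cylinder its gradient is the given weak one, in almost every
time slice. -/
theorem ViscoData.exists_lipschitz_extension (P : ViscoData D)
    (hLip : ∃ L : ℝ≥0, LipschitzOnWith L P.Ψ (Icc 0 D.T ×ˢ closure D.Ω)) :
    ∃ (f : ℝ × Vec d → ℝ) (L : ℝ≥0), LipschitzWith L f ∧
      (∀ t ∈ Ioo 0 D.T, ∀ x ∈ D.Ω, f (t, x) = P.Ψ (t, x)) ∧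
      ∀ᵐ t ∂(volume.restrict (Ioo 0 D.T)), ∀ᵐ x ∂(volume.restrict D.Ω),
        P.gradΨ (t, x) = gradField f (t, x) := by
  obtain ⟨L, hL⟩ := hLip
  obtain ⟨f, hf, hfe⟩ := hL.extend_real
  have hfΨ : ∀ z ∈ Ioo 0 D.T ×ˢ D.Ω, f z = P.Ψ z := fun z hz =>
    (hfe ⟨Ioo_subset_Icc_self hz.1, subset_closure hz.2⟩).symm
  refine ⟨f, L, hf, fun t ht x hx => hfΨ (t, x) ⟨ht, hx⟩, ?_⟩
  have hfinite : IsFiniteMeasure (volume.restrict (Ioo 0 D.T ×ˢ D.Ω)) :=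
    ⟨by
      rw [Measure.restrict_apply_univ, Measure.volume_eq_prod, Measure.prod_prod]
      exact ENNReal.mul_lt_top (by simp) D.isBounded_Ω.measure_lt_top⟩
  have hG : IntegrableOn P.gradΨ (Ioo 0 D.T ×ˢ D.Ω) :=
    MemLp.integrable (by simp) P.gradΨ_bounded
  have hall := ae_all_iff.2 fun i => ae_eq_fderiv_of_isWeakSpaceGrad D.isOpen_Ω P.isGrad_gradΨ
    hG.locallyIntegrableOn hf hfΨ i
  refine ae_slice_of_ae (p := fun z => P.gradΨ z = gradField f z) (hall.mono fun z hz => ?_)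
  ext i
  exact hz i

theorem sliceOp_congr {Ω : Set (Vec d)} {Y : Type*} [NormedAddCommGroup Y] [InnerProductSpace ℝ Y]
    (hΩo : IsOpen Ω) (hΩ : Bornology.IsBounded Ω) {f : ℝ × Vec d → ℝ} (hf : Continuous f) (t : ℝ)
    (g : Lp Y 2 (volume.restrict Ω)) :
    sliceOp Ω Y f t g =ᵐ[volume.restrict Ω] fun x => f (t, x) • g x :=
  coeFn_mulOp (memLp_top_of_continuous hΩo hΩ (hf.comp (by fun_prop))) g

theorem ViscoData.IsPsiDot.fn_eq {P : ViscoData D} {f : ℝ × Vec d → ℝ} {L : ℝ≥0}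
    (hf : LipschitzWith L f) (hfΨ : ∀ t ∈ Ioo 0 D.T, ∀ x ∈ D.Ω, f (t, x) = P.Ψ (t, x))
    {ψ : ℝ → L2Vec D.Ω} {q : ℝ → D.X} (hq : P.IsPsiDot ψ q) :
    ∀ᵐ t ∂(volume.restrict (Ioo 0 D.T)), (q t).fn = sliceOp D.Ω (Vec d) f t (ψ t) := by
  filter_upwards [hq.2, ae_restrict_mem measurableSet_Ioo] with t h1 ht
  refine Lp.ext ?_
  filter_upwards [h1, sliceOp_congr D.isOpen_Ω D.isBounded_Ω hf.continuous t (ψ t),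
    ae_restrict_mem D.isOpen_Ω.measurableSet] with x h2 h3 hx
  rw [h2, h3, hfΨ t ht x hx]

/-- For almost every time, the viscous terms of the weak formulation. -/
theorem ViscoData.ae_viscous_terms (P : ViscoData D) {f : ℝ × Vec d → ℝ} {L : ℝ≥0}
    (hf : LipschitzWith L f) (hfΨ : ∀ t ∈ Ioo 0 D.T, ∀ x ∈ D.Ω, f (t, x) = P.Ψ (t, x))
    (hgrad : ∀ᵐ t ∂(volume.restrict (Ioo 0 D.T)), ∀ᵐ x ∂(volume.restrict D.Ω),
      P.gradΨ (t, x) = gradField f (t, x)) :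
    ∀ᵐ t ∂(volume.restrict (Ioo 0 D.T)), ∀ (e η : L2Sym D.Ω) (g : L2Vec D.Ω),
      (∫ x in D.Ω, inner ℝ (P.B x (e x)) (P.Ψ (t, x) • η x)) =
        inner ℝ (tensorOp D.Ω P.B (sliceOp D.Ω (SymMat d) f t e)) η ∧
      (∫ x in D.Ω, inner ℝ (P.B x (symProd (P.gradΨ (t, x)) (g x))) (P.Ψ (t, x) • η x)) =
        inner ℝ (tensorOp D.Ω P.B (sliceOp D.Ω (SymMat d) f t (symGradOp D.Ω f t g))) η := by
  filter_upwards [hgrad, ae_restrict_mem measurableSet_Ioo] with t h1 ht e η g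
  have hm : MemLp (fun x => f (t, x)) ∞ (volume.restrict D.Ω) :=
    memLp_top_of_continuous D.isOpen_Ω D.isBounded_Ω (hf.continuous.comp (by fun_prop))
  -- The factor Ψ on the test strain is moved onto the stress by symmetry. Allowing any
  -- representative e' treats both viscous terms at once.
  have key : ∀ (e : L2Sym D.Ω) (e' : Vec d → SymMat d), e =ᵐ[volume.restrict D.Ω] e' →
      (∫ x in D.Ω, inner ℝ (P.B x (e' x)) (P.Ψ (t, x) • η x)) =
        inner ℝ (tensorOp D.Ω P.B (sliceOp D.Ω (SymMat d) f t e)) η := fun e e' hee => by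
    rw [sliceOp, P.tensor_B.tensorOp_mulOp hm, inner_mulOp_left hm,
      ← P.tensor_B.integral_inner]
    refine integral_congr_ae ?_
    filter_upwards [hee, coeFn_mulOp hm η, ae_restrict_mem D.isOpen_Ω.measurableSet]
      with x h2 h3 hx
    rw [h2, h3, hfΨ t ht x hx]
  refine ⟨key e e (Eventually.of_forall fun _ => rfl), key _ _ ?_⟩
  filter_upwards [coeFn_symGradOp D.isOpen_Ω hf ht g, h1] with x h2 h3
  rw [h2, h3]

/-- The left-hand side of the weak formulation, in operator form. -/
theorem ViscoData.lhs_eq (P : ViscoData D) {f : ℝ × Vec d → ℝ} {L : ℝ≥0}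
    (hf : LipschitzWith L f) (hfΨ : ∀ t ∈ Ioo 0 D.T, ∀ x ∈ D.Ω, f (t, x) = P.Ψ (t, x))
    (hgrad : ∀ᵐ t ∂(volume.restrict (Ioo 0 D.T)), ∀ᵐ x ∂(volume.restrict D.Ω),
      P.gradΨ (t, x) = gradField f (t, x)) {u q φ : ℝ → D.X} {ψ χ : ℝ → L2Vec D.Ω}
    (hu : MemL2 D.T u) (hψ : MemL2 D.T ψ) (hq : MemL2 D.T q) (hφ : MemL2 D.T φ) :
    -(∫ t in Ioo 0 D.T, ∫ x in D.Ω, inner ℝ (ψ t x) (χ t x))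
    + (∫ t in Ioo 0 D.T, ∫ x in D.Ω, inner ℝ (P.C x ((u t).E x)) ((φ t).E x))
    + (∫ t in Ioo 0 D.T, ∫ x in D.Ω,
        inner ℝ (P.B x ((q t).E x)) (P.Ψ (t, x) • (φ t).E x))
    - (∫ t in Ioo 0 D.T, ∫ x in D.Ω,
        inner ℝ (P.B x (symProd (P.gradΨ (t, x)) (ψ t x))) (P.Ψ (t, x) • (φ t).E x)) =
    -(∫ t in Ioo 0 D.T, inner ℝ (ψ t) (χ t)) +
      ∫ t in Ioo 0 D.T, inner ℝ (tensorOp D.Ω P.C (u t).E +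
        tensorOp D.Ω P.B (viscousStrain D f ψ q t)) (φ t).E := by
  obtain ⟨C, hC⟩ := exists_isMultiplier_of_continuous D.T D.isBounded_Ω hf.continuous
  have he : MemLp (fun t => (u t).E) 2 (volume.restrict (Ioo 0 D.T)) :=
    memLp_clm_apply (W := L2Sym D.Ω) D.eCLM hu
  have hqe : MemLp (fun t => (q t).E) 2 (volume.restrict (Ioo 0 D.T)) :=
    memLp_clm_apply (W := L2Sym D.Ω) D.eCLM hq
  have hφe : MemLp (fun t => (φ t).E) 2 (volume.restrict (Ioo 0 D.T)) :=
    memLp_clm_apply (W := L2Sym D.Ω) D.eCLM hφ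
  have m1 : MemLp (fun t => tensorOp D.Ω P.C (u t).E) 2 (volume.restrict (Ioo 0 D.T)) :=
    memLp_clm_apply (V := L2Sym D.Ω) (W := L2Sym D.Ω) (tensorOp D.Ω P.C) he
  have m2 : MemLp (fun t => tensorOp D.Ω P.B (sliceOp D.Ω (SymMat d) f t (q t).E)) 2
      (volume.restrict (Ioo 0 D.T)) :=
    memLp_clm_apply (V := L2Sym D.Ω) (W := L2Sym D.Ω) (tensorOp D.Ω P.B)
      (hC.memLp_curve D.isOpen_Ω D.isBounded_Ω hqe)
  have m3 : MemLp (fun t => tensorOp D.Ω P.B (sliceOp D.Ω (SymMat d) f t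
      (symGradOp D.Ω f t (ψ t)))) 2 (volume.restrict (Ioo 0 D.T)) :=
    memLp_clm_apply (V := L2Sym D.Ω) (W := L2Sym D.Ω) (tensorOp D.Ω P.B)
      (hC.memLp_curve D.isOpen_Ω D.isBounded_Ω (memLp_symGradOp D.isOpen_Ω D.isBounded_Ω hf hψ))
  have i1 := integrable_inner_of_memLp_two m1 hφe
  have i2 := integrable_inner_of_memLp_two m2 hφe
  have i3 := integrable_inner_of_memLp_two m3 hφe
  have hv := P.ae_viscous_terms hf hfΨ hgrad
  have e1 : ∫ t in Ioo 0 D.T, ∫ x in D.Ω, inner ℝ (P.C x ((u t).E x)) ((φ t).E x) =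
      ∫ t in Ioo 0 D.T, inner ℝ (tensorOp D.Ω P.C (u t).E) (φ t).E :=
    integral_congr_ae (Eventually.of_forall fun t => P.tensor_C.integral_inner (u t).E (φ t).E)
  have e2 : ∫ t in Ioo 0 D.T, ∫ x in D.Ω, inner ℝ (P.B x ((q t).E x)) (P.Ψ (t, x) • (φ t).E x) =
      ∫ t in Ioo 0 D.T, inner ℝ (tensorOp D.Ω P.B (sliceOp D.Ω (SymMat d) f t (q t).E)) (φ t).E :=
    integral_congr_ae (hv.mono fun t h => (h (q t).E (φ t).E (ψ t)).1)
  have e3 : ∫ t in Ioo 0 D.T, ∫ x in D.Ω,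
        inner ℝ (P.B x (symProd (P.gradΨ (t, x)) (ψ t x))) (P.Ψ (t, x) • (φ t).E x) =
      ∫ t in Ioo 0 D.T, inner ℝ (tensorOp D.Ω P.B (sliceOp D.Ω (SymMat d) f t
        (symGradOp D.Ω f t (ψ t)))) (φ t).E :=
    integral_congr_ae (hv.mono fun t h => (h (q t).E (φ t).E (ψ t)).2)
  have e4 : ∫ t in Ioo 0 D.T, ∫ x in D.Ω, inner ℝ (ψ t x) (χ t x) =
      ∫ t in Ioo 0 D.T, inner ℝ (ψ t) (χ t) := rfl
  have e5 : ∫ t in Ioo 0 D.T, inner ℝ (tensorOp D.Ω P.C (u t).E +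
        tensorOp D.Ω P.B (viscousStrain D f ψ q t)) (φ t).E =
      (∫ t in Ioo 0 D.T, inner ℝ (tensorOp D.Ω P.C (u t).E) (φ t).E) +
      ((∫ t in Ioo 0 D.T, inner ℝ (tensorOp D.Ω P.B (sliceOp D.Ω (SymMat d) f t (q t).E))
        (φ t).E) - ∫ t in Ioo 0 D.T, inner ℝ (tensorOp D.Ω P.B (sliceOp D.Ω (SymMat d) f t
        (symGradOp D.Ω f t (ψ t)))) (φ t).E) := by
    rw [← integral_sub i2 i3]
    refine Eq.trans (integral_congr_ae (Eventually.of_forall fun t => ?_))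
      (integral_add i1 (i2.sub i3))
    exact inner_add_apply_apply_sub (S := L2Sym D.Ω) _ _ _ _ _ _
  rw [e1, e2, e3, e4, e5]
  ring

end WeakFormulation

theorem norm_sub_sq_le_two_mul {Y : Type*} [NormedAddCommGroup Y] (a b c : Y) :
    ‖a - b‖ ^ 2 ≤ 2 * (‖a - c‖ ^ 2 + ‖b - c‖ ^ 2) := by
  have h : ‖a - b‖ ≤ ‖a - c‖ + ‖b - c‖ := by
    rw [← sub_sub_sub_cancel_right a b c]
    exact norm_sub_le _ _
  nlinarith [pow_le_pow_left₀ (norm_nonneg _) h 2, sq_nonneg (‖a - c‖ - ‖b - c‖)]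

theorem inner_apply_sub_add_apply_sub {S : Type*} [NormedAddCommGroup S]
    [InnerProductSpace ℝ S] (B C : S →L[ℝ] S) (a₁ a₂ b₁ b₂ e : S) :
    inner ℝ (C (a₁ - a₂) + B (b₁ - b₂)) e =
      inner ℝ (C a₁ + B b₁) e - inner ℝ (C a₂ + B b₂) e := by
  rw [← inner_sub_left, map_sub, map_sub, add_sub_add_comm]

theorem apply_sub_sub_apply_sub {H S : Type*} [NormedAddCommGroup H] [NormedSpace ℝ H]
    [NormedAddCommGroup S] [NormedSpace ℝ S] (A : S →L[ℝ] S) (G : H →L[ℝ] S) (b₁ b₂ : S)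
    (c₁ c₂ : H) : A (b₁ - b₂ - G (c₁ - c₂)) = A (b₁ - G c₁) - A (b₂ - G c₂) := by
  rw [← map_sub, map_sub G, sub_sub_sub_comm]

theorem viscousStrain_sub {d : ℕ} {D : CrackedBody d} (f : ℝ × Vec d → ℝ) (ψ₁ ψ₂ : ℝ → L2Vec D.Ω)
    (q₁ q₂ : ℝ → D.X) (t : ℝ) :
    viscousStrain D f (fun t => ψ₁ t - ψ₂ t) (fun t => q₁ t - q₂ t) t =
      viscousStrain D f ψ₁ q₁ t - viscousStrain D f ψ₂ q₂ t :=
  apply_sub_sub_apply_sub (H := L2Vec D.Ω) (S := L2Sym D.Ω) (sliceOp D.Ω (SymMat d) f t)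
    (symGradOp D.Ω f t) (q₁ t).E (q₂ t).E (ψ₁ t) (ψ₂ t)

theorem E_sub {d : ℕ} {D : CrackedBody d} (p₁ p₂ : D.X) : (p₁ - p₂).E = p₁.E - p₂.E :=
  map_sub D.eCLM p₁ p₂

theorem inner_stress_sub {d : ℕ} {D : CrackedBody d} (B C : Vec d → (SymMat d →L[ℝ] SymMat d))
    (p₁ p₂ : D.X) {y y₁ y₂ : L2Sym D.Ω} (h : y = y₁ - y₂) (e : L2Sym D.Ω) :
    inner ℝ (tensorOp D.Ω C (p₁ - p₂).E + tensorOp D.Ω B y) e =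
      inner ℝ (tensorOp D.Ω C p₁.E + tensorOp D.Ω B y₁) e -
        inner ℝ (tensorOp D.Ω C p₂.E + tensorOp D.Ω B y₂) e := by
  rw [h, E_sub]
  exact inner_apply_sub_add_apply_sub (S := L2Sym D.Ω) _ _ _ _ _ _ _

/-! ### From two weak solutions to the homogeneous problem -/

section Uniqueness

variable {d : ℕ} {D : CrackedBody d}

namespace CrackedBody

theorem crack_eq_crack_zero (hCrack : D.crack D.T = D.crack 0) {t : ℝ} (ht : t ∈ Icc 0 D.T) :
    D.crack t = D.crack 0 :=
  ((D.crack_mono t D.T ht.1 ht.2 le_rfl).trans_eq hCrack).antisymm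
    (D.crack_mono 0 t le_rfl ht.1 ht.2)

theorem VD_eq_VD_zero (hCrack : D.crack D.T = D.crack 0) {t : ℝ} (ht : t ∈ Icc 0 D.T) :
    D.VD t = D.VD 0 := by
  simp only [VD, V, crack_eq_crack_zero hCrack ht]

theorem memL2_primitive {Y : Type*} [NormedAddCommGroup Y] [NormedSpace ℝ Y] [CompleteSpace Y]
    {T : ℝ} {v : ℝ → Y} (hv : IntegrableOn v (Ioo 0 T)) : MemL2 T fun t => ∫ r in Ioo 0 t, v r := by
  have hc := continuousOn_primitive_Ioo hv
  obtain ⟨M, hM⟩ := (isCompact_Icc (a := 0) (b := T)).exists_bound_of_continuousOn hc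
  refine MemLp.of_bound ((hc.mono Ioo_subset_Icc_self).aestronglyMeasurable measurableSet_Ioo) M ?_
  filter_upwards [ae_restrict_mem measurableSet_Ioo] with t ht
  exact hM t (Ioo_subset_Icc_self ht)

/-- Primitives of square integrable curves in `V_0^D` are test functions if they vanish at the
final time and the crack does not grow. -/
theorem test_primitive (hCrack : D.crack D.T = D.crack 0) {v : ℝ → D.X} (hv : MemL2 D.T v)
    (hvW : ∀ᵐ t ∂(volume.restrict (Ioo 0 D.T)), v t ∈ D.dirichletSpace 0)
    (hv0 : ∫ t in Ioo 0 D.T, v t = 0) :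
    D.MemCalVD (fun t => ∫ r in Ioo 0 t, v r) ∧
      D.IsDot (fun t => ∫ r in Ioo 0 t, v r) (fun t => (v t).fn) ∧
      HasValueAt D.T (fun t => X.fn (∫ r in Ioo 0 t, v r)) 0 0 ∧
      HasValueAt D.T (fun t => X.fn (∫ r in Ioo 0 t, v r)) D.T 0 := by
  have hvi : IntegrableOn v (Ioo 0 D.T) := hv.integrable (by norm_num)
  have hT := D.T_pos
  have hmem : ∀ t ∈ Ioo 0 D.T, ∫ r in Ioo 0 t, v r ∈ D.VD 0 := fun t ht => by
    have hsub : Ioo 0 t ⊆ Ioo 0 D.T := Ioo_subset_Ioo_right ht.2.le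
    exact D.mem_dirichletSpace.1 (integral_mem_submodule (D.isClosed_dirichletSpace 0)
      (hvi.mono_set hsub) (ae_restrict_of_ae_restrict_of_subset hsub hvW))
  have hVD : ∀ᵐ t ∂(volume.restrict (Ioo 0 D.T)), ∫ r in Ioo 0 t, v r ∈ D.VD t := by
    filter_upwards [ae_restrict_mem measurableSet_Ioo] with t ht
    rw [VD_eq_VD_zero hCrack (Ioo_subset_Icc_self ht)]
    exact hmem t ht
  have hVDT : ∀ᵐ t ∂(volume.restrict (Ioo 0 D.T)), ∫ r in Ioo 0 t, v r ∈ D.VD D.T := by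
    filter_upwards [ae_restrict_mem measurableSet_Ioo] with t ht
    rw [VD_eq_VD_zero hCrack ⟨hT.le, le_rfl⟩]
    exact hmem t ht
  have hfn : MemL2 D.T fun t => (v t).fn := memLp_clm_apply (W := L2Vec D.Ω) D.fnCLM hv
  have hdot : D.IsDot (fun t => ∫ r in Ioo 0 t, v r) (fun t => (v t).fn) := by
    refine ⟨hfn, isWeakTimeDeriv_of_primitive (c := 0) hT.le (hfn.integrable (by norm_num)) ?_⟩
    filter_upwards [ae_restrict_mem measurableSet_Ioo] with t ht
    rw [zero_add]
    exact clm_integral_comm D.fnCLM (hvi.mono_set (Ioo_subset_Ioo_right ht.2.le))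
  have hcont : ContinuousOn (fun t => X.fn (∫ r in Ioo 0 t, v r)) (Icc 0 D.T) :=
    D.fnCLM.continuous.comp_continuousOn (continuousOn_primitive_Ioo hvi)
  -- Zero initial value comes from an empty interval of integration and zero final value from the
  -- mean of v; membership at every time rests on the constancy of the crack.
  refine ⟨⟨⟨⟨memL2_primitive hvi, hVDT.mono fun t h => h.1, hVD.mono fun t h => h.1⟩, _, hdot⟩,
    hVD⟩, hdot, ⟨_, hcont, EventuallyEq.rfl, ?_⟩, ⟨_, hcont, EventuallyEq.rfl, ?_⟩⟩
  · simp only [Ioo_self, Measure.restrict_empty, integral_zero_measure]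
    rfl
  · rw [hv0]
    rfl

theorem IsDot.unique {u : ℝ → D.X} {ψ ψ' : ℝ → L2Vec D.Ω} (h : D.IsDot u ψ) (h' : D.IsDot u ψ') :
    ψ =ᵐ[volume.restrict (Ioo 0 D.T)] ψ' :=
  IsWeakTimeDeriv.unique (h.1.integrable (by norm_num)) (h'.1.integrable (by norm_num)) h.2 h'.2

theorem IsDot.sub {u₁ u₂ : ℝ → D.X} {ψ₁ ψ₂ : ℝ → L2Vec D.Ω} (hu₁ : MemL2 D.T u₁)
    (hu₂ : MemL2 D.T u₂) (h₁ : D.IsDot u₁ ψ₁) (h₂ : D.IsDot u₂ ψ₂) :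
    D.IsDot (fun t => u₁ t - u₂ t) fun t => ψ₁ t - ψ₂ t := by
  refine ⟨h₁.1.sub h₂.1, fun θ g1 g2 g3 => ?_⟩
  have f₁ : IntegrableOn (fun t => (u₁ t).fn) (Ioo 0 D.T) :=
    (memLp_clm_apply (W := L2Vec D.Ω) D.fnCLM hu₁).integrable (by norm_num)
  have f₂ : IntegrableOn (fun t => (u₂ t).fn) (Ioo 0 D.T) :=
    (memLp_clm_apply (W := L2Vec D.Ω) D.fnCLM hu₂).integrable (by norm_num)
  have hc := g1.continuous_deriv (by simp)
  have e1 : ∫ t in Ioo 0 D.T, deriv θ t • (u₁ t - u₂ t).fn =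
      (∫ t in Ioo 0 D.T, deriv θ t • (u₁ t).fn) - ∫ t in Ioo 0 D.T, deriv θ t • (u₂ t).fn := by
    refine Eq.trans (integral_congr_ae (Eventually.of_forall fun t => ?_))
      (integral_sub (IntegrableOn.test_smul f₁ hc g2.deriv) (IntegrableOn.test_smul f₂ hc g2.deriv))
    exact smul_sub (deriv θ t) (u₁ t).fn (u₂ t).fn
  have i₁ : IntegrableOn ψ₁ (Ioo 0 D.T) := h₁.1.integrable (by norm_num)
  have i₂ : IntegrableOn ψ₂ (Ioo 0 D.T) := h₂.1.integrable (by norm_num)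
  simp_rw [smul_sub]
  rw [e1, h₁.2 θ g1 g2 g3, h₂.2 θ g1 g2 g3, integral_sub
    (IntegrableOn.test_smul i₁ g1.continuous g2)
    (IntegrableOn.test_smul i₂ g1.continuous g2)]
  abel

end CrackedBody

namespace ViscoData

variable {P : ViscoData D}

/-- The initial condition and the weak equation each come with their own representative of the
velocity. Uniqueness of the weak derivative makes them interchangeable under the integral. -/
theorem SatisfiesInitial.tendsto {u : ℝ → D.X} {ψ : ℝ → L2Vec D.Ω} (h : P.SatisfiesInitial u)
    (hψ : D.IsDot u ψ) :
    Tendsto (fun h : ℝ => (1 / h) * ∫ t in Ioo 0 h, (‖u t - P.u0‖ ^ 2 + ‖ψ t - P.u1‖ ^ 2))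
      (𝓝[>] 0) (𝓝 0) := by
  obtain ⟨ψ', h1, h2⟩ := h
  refine h2.congr' ?_
  filter_upwards [Ioo_mem_nhdsGT D.T_pos] with s hs
  congr 1
  refine integral_congr_ae ?_
  filter_upwards [ae_restrict_of_ae_restrict_of_subset (Ioo_subset_Ioo_right hs.2.le)
    (h1.unique hψ)] with t ht
  rw [ht]

theorem tendsto_average_sub {u₁ u₂ : ℝ → D.X} {ψ₁ ψ₂ : ℝ → L2Vec D.Ω} (hu₁ : MemL2 D.T u₁)
    (hu₂ : MemL2 D.T u₂) (h₁ : D.IsDot u₁ ψ₁) (h₂ : D.IsDot u₂ ψ₂) (hi₁ : P.SatisfiesInitial u₁)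
    (hi₂ : P.SatisfiesInitial u₂) :
    Tendsto (fun h : ℝ => (1 / h) * ∫ t in Ioo 0 h, (‖u₁ t - u₂ t‖ ^ 2 + ‖ψ₁ t - ψ₂ t‖ ^ 2))
      (𝓝[>] 0) (𝓝 0) := by
  have j : ∀ {u : ℝ → D.X} {ψ : ℝ → L2Vec D.Ω}, MemL2 D.T u → D.IsDot u ψ →
      IntegrableOn (fun t => ‖u t - P.u0‖ ^ 2 + ‖ψ t - P.u1‖ ^ 2) (Ioo 0 D.T) := fun hu hψ =>
    (integrableOn_norm_sq (hu.sub (memLp_const P.u0))).add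
      (integrableOn_norm_sq (hψ.1.sub (memLp_const P.u1)))
  have j₁ := j hu₁ h₁
  have j₂ := j hu₂ h₂
  refine tendsto_average_of_le D.T_pos (fun t => by positivity) ((j₁.add j₂).const_mul 2)
    (Eventually.of_forall fun t => ?_) ?_
  · have a1 := norm_sub_sq_le_two_mul (u₁ t) (u₂ t) P.u0
    have a2 := norm_sub_sq_le_two_mul (ψ₁ t) (ψ₂ t) P.u1
    simp only [Pi.add_apply]
    linarith
  · have := ((hi₁.tendsto h₁).add (hi₂.tendsto h₂)).const_mul 2
    rw [add_zero, mul_zero] at this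
    refine this.congr' ?_
    filter_upwards [Ioo_mem_nhdsGT D.T_pos] with s hs
    have hsub : Ioo 0 s ⊆ Ioo 0 D.T := Ioo_subset_Ioo_right hs.2.le
    rw [integral_const_mul]
    simp only [Pi.add_apply]
    rw [integral_add (j₁.mono_set hsub) (j₂.mono_set hsub)]
    ring

/-- The load terms are literally the same for both solutions, so equating the left sides removes
them without any integrability of the loads or traces. -/
theorem WeakEquation.sub {f : ℝ × Vec d → ℝ} {L : ℝ≥0}
    (hf : LipschitzWith L f) (hfΨ : ∀ t ∈ Ioo 0 D.T, ∀ x ∈ D.Ω, f (t, x) = P.Ψ (t, x))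
    (hgrad : ∀ᵐ t ∂(volume.restrict (Ioo 0 D.T)), ∀ᵐ x ∂(volume.restrict D.Ω),
      P.gradΨ (t, x) = gradField f (t, x)) {u₁ u₂ q₁ q₂ φ : ℝ → D.X} {ψ₁ ψ₂ χ : ℝ → L2Vec D.Ω}
    (hu₁ : MemL2 D.T u₁) (hψ₁ : MemL2 D.T ψ₁) (hq₁ : MemL2 D.T q₁)
    (hu₂ : MemL2 D.T u₂) (hψ₂ : MemL2 D.T ψ₂) (hq₂ : MemL2 D.T q₂) (hφ : MemL2 D.T φ)
    (hχ : MemL2 D.T χ) (h₁ : P.WeakEquation u₁ ψ₁ q₁ φ χ) (h₂ : P.WeakEquation u₂ ψ₂ q₂ φ χ) :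
    -(∫ t in Ioo 0 D.T, inner ℝ (ψ₁ t - ψ₂ t) (χ t)) +
      ∫ t in Ioo 0 D.T, inner ℝ (tensorOp D.Ω P.C (u₁ t - u₂ t).E + tensorOp D.Ω P.B
        (viscousStrain D f (fun t => ψ₁ t - ψ₂ t) (fun t => q₁ t - q₂ t) t)) (φ t).E = 0 := by
  have h := h₁.trans h₂.symm
  rw [P.lhs_eq hf hfΨ hgrad hu₁ hψ₁ hq₁ hφ, P.lhs_eq hf hfΨ hgrad hu₂ hψ₂ hq₂ hφ] at h
  have hφe : MemLp (fun t => (φ t).E) 2 (volume.restrict (Ioo 0 D.T)) :=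
    memLp_clm_apply (W := L2Sym D.Ω) D.eCLM hφ
  have e1 : ∫ t in Ioo 0 D.T, inner ℝ (ψ₁ t - ψ₂ t) (χ t) =
      (∫ t in Ioo 0 D.T, inner ℝ (ψ₁ t) (χ t)) - ∫ t in Ioo 0 D.T, inner ℝ (ψ₂ t) (χ t) := by
    rw [← integral_sub (integrable_inner_of_memLp_two hψ₁ hχ)
      (integrable_inner_of_memLp_two hψ₂ hχ)]
    simp_rw [inner_sub_left]
  have e2 : ∫ t in Ioo 0 D.T, inner ℝ (tensorOp D.Ω P.C (u₁ t - u₂ t).E + tensorOp D.Ω P.B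
        (viscousStrain D f (fun t => ψ₁ t - ψ₂ t) (fun t => q₁ t - q₂ t) t)) (φ t).E =
      (∫ t in Ioo 0 D.T, inner ℝ (tensorOp D.Ω P.C (u₁ t).E +
        tensorOp D.Ω P.B (viscousStrain D f ψ₁ q₁ t)) (φ t).E) -
      ∫ t in Ioo 0 D.T, inner ℝ (tensorOp D.Ω P.C (u₂ t).E +
        tensorOp D.Ω P.B (viscousStrain D f ψ₂ q₂ t)) (φ t).E := by
    refine Eq.trans (integral_congr_ae (Eventually.of_forall fun t => ?_))
      (integral_sub (integrable_inner_of_memLp_two (memLp_stress P.B P.C hf hu₁ hψ₁ hq₁) hφe)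
      (integrable_inner_of_memLp_two (memLp_stress P.B P.C hf hu₂ hψ₂ hq₂) hφe))
    exact inner_stress_sub P.B P.C (u₁ t) (u₂ t) (viscousStrain_sub f ψ₁ ψ₂ q₁ q₂ t) (φ t).E
  rw [e1, e2]
  linarith

end ViscoData

end Uniqueness

end CrackVisco

end

theorem mainTheorem4 {d : ℕ} (D : CrackVisco.CrackedBody d) (P : CrackVisco.ViscoData D)
    (hLip : ∃ L : NNReal, LipschitzOnWith L P.Ψ (Icc 0 D.T ×ˢ closure D.Ω))
    (hMixed : ∃ M : ℝ × CrackVisco.Vec d → CrackVisco.Vec d,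
      CrackVisco.IsWeakMixedGrad D.T D.Ω P.Ψ M ∧ CrackVisco.MemLInfTX D.T D.Ω M)
    (hCrack : D.crack D.T = D.crack 0)
    (u₁ u₂ : ℝ → D.X)
    (hu₁ : P.IsWeakSolution u₁) (hi₁ : P.SatisfiesInitial u₁)
    (hu₂ : P.IsWeakSolution u₂) (hi₂ : P.SatisfiesInitial u₂) :
    u₁ =ᵐ[volume.restrict (Ioo 0 D.T)] u₂ := by
  obtain ⟨f, L, hf, hfΨ, hgrad⟩ := P.exists_lipschitz_extension hLip
  obtain ⟨⟨⟨⟨hm₁, -⟩, -⟩, -⟩, hw₁, ψ₁, q₁, hψ₁, hq₁, heq₁⟩ := hu₁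
  obtain ⟨⟨⟨⟨hm₂, -⟩, -⟩, -⟩, hw₂, ψ₂, q₂, hψ₂, hq₂, heq₂⟩ := hu₂
  have huW : ∀ᵐ t ∂(volume.restrict (Ioo 0 D.T)), u₁ t - u₂ t ∈ D.dirichletSpace 0 := by
    filter_upwards [hw₁.2, hw₂.2, ae_restrict_mem measurableSet_Ioo] with t h1 h2 ht
    rw [CrackVisco.CrackedBody.VD_eq_VD_zero hCrack (Ioo_subset_Icc_self ht)] at h1 h2
    -- The Dirichlet datum cancels: u₁ - u₂ is the difference of u₁ - w and u₂ - w, both in the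
    -- fixed space V_0^D.
    rw [← sub_sub_sub_cancel_right (u₁ t) (u₂ t) (P.w t)]
    exact Submodule.sub_mem _ (D.mem_dirichletSpace.2 h1) (D.mem_dirichletSpace.2 h2)
  have hqv : ∀ᵐ t ∂(volume.restrict (Ioo 0 D.T)), (q₁ t - q₂ t).fn =
      CrackVisco.sliceOp D.Ω (CrackVisco.Vec d) f t (ψ₁ t - ψ₂ t) := by
    filter_upwards [hq₁.fn_eq hf hfΨ, hq₂.fn_eq hf hfΨ] with t h1 h2
    rw [map_sub, ← h1, ← h2]
    rfl
  have hzero := CrackVisco.eq_zero_of_homogeneous P.tensor_B P.tensor_C hf (hm₁.sub hm₂) huW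
    (hψ₁.sub hm₁ hm₂ hψ₂) (hq₁.1.1.sub hq₂.1.1) hqv
    -- Any zero-mean v in L²(0, T; V_0^D) has an admissible primitive, so both weak equations can be
    -- tested with it and subtracted.
    (CrackVisco.ViscoData.tendsto_average_sub hm₁ hm₂ hψ₁ hψ₂ hi₁ hi₂) fun v hv hvW hv0 => by
      obtain ⟨t1, t2, t3, t4⟩ := CrackVisco.CrackedBody.test_primitive hCrack hv hvW hv0
      exact CrackVisco.ViscoData.WeakEquation.sub hf hfΨ hgrad hm₁ hψ₁.1 hq₁.1.1 hm₂ hψ₂.1 hq₂.1.1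
        t1.1.1.1 t2.1 (heq₁ _ _ t1 t2 t3 t4) (heq₂ _ _ t1 t2 t3 t4)
  filter_upwards [hzero] with t ht
  exact sub_eq_zero.1 ht
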